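/- **Setting.** Let $\mathcal H,\widetilde{\mathcal H}$ be complex Hilbert spaces, and let $\mathcal H^1\subset\mathcal H$, $\widetilde{\mathcal H}^1\subset\widetilde{\mathcal H}$ be dense subspaces which are Hilbert spaces for norms $\|\cdot\|_1$ with $\|f\|\le\|f\|_1$. Let $\mathfrak h,\widetilde{\mathfrak h}$ be closed quadratic forms, semi-bounded from below, with domains $\mathcal H^1,\widetilde{\mathcal H}^1$, and let $H,\widetilde H$ be the associated self-adjoint operators. The forms are *$\delta$-quasi-unitarily equivalent* (with identification operator $J$) if there are bounded operators $J:\mathcal H\to\widetilde{\mathcal H}$, $J^1:\mathcal H^1\to\widetilde{\mathcal H}^1$, $J'^1:\widetilde{\mathcal H}^1\to\mathcal H^1$ such that, for all $f\in\mathcal H^1$, $u\in\widetilde{\mathcal H}^1$, $$\|Jf-J^1f\|\le\delta\|f\|_1,\quad \|J^*u-J'^1u\|\le\delta\|u\|_1,\quad \|J^*Jf-f\|\le\delta\|f\|_1,\quad \|JJ^*u-u\|\le\delta\|u\|_1,$$ $$|\mathfrak h(J'^1u,f)-\widetilde{\mathfrak h}(u,J^1f)|\le\delta\|u\|_1\|f\|_1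 .$$ The operators $H,\widetilde H$ are *$\delta$-quasi-unitarily equivalent* (with identification operator $J$) if there is a bounded $J:\mathcal H\to\widetilde{\mathcal H}$ such that, for both signs, with $R^\pm=(H\mp i)^{-1}$, $\widetilde R^\pm=(\widetilde H\mp i)^{-1}$, $$\|(1-J^*J)R^\pm\|\le\delta,\qquad\|(1-JJ^*)\widetilde R^\pm\|\le\delta,\qquad\|JR^\pm-\widetilde R^\pm J\|\le\delta .$$ The discrete spectrum consists of the isolated points of the spectrum that have finite multiplicity; the essential spectrum is its complement in the spectrum. **Theorem.** In (i) and (ii) let $\delta>0$, $C\ge1$, let $\mathfrak h,\widetilde{\mathfrak h}$ be $\delta$-quasi-unitarily equivalent with identification operator $J$, and assume $$\|f\|_1^2\le2(\mathfrak h(f)+C\|f\|^2),\qquad\|u\|_1^2\le2(\widetilde{\mathfrak h}(u)+C\|u\|^2)\qquad(f\in\mathcal H^1,\ u\in\widetilde{\mathcal H}^1).$$ 1. (i) $H$ and $\widetilde H$ are $(12C\delta)$-quasi-unitarily equivalent, with the same $J$. 2. (ii) For every $z\in\mathbb C\setminus\mathbb R$ there is a constant $c(z)>0$ depending only on $z$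 such that $$\|J(H-z)^{-1}-(\widetilde H-z)^{-1}J\|\le c(z)C\delta,\qquad\|J(H-z)^{-1}J^*-(\widetilde H-z)^{-1}\|\le c(z)C\delta .$$ Moreover, let $\varphi:\mathbb R\to\mathbb C$ be bounded and measurable with $\varphi(\lambda)\to a\in\mathbb C$ as $\lambda\to+\infty$, let $S\subset\mathbb R$ be closed and bounded below, let $\varphi$ be continuous on an open neighbourhood of $S$, and let $M\in\mathbb R$. Then for every $\eta>0$ there is $\kappa>0$, depending only on $\varphi,S,M,\eta$, such that, whenever $\operatorname{spec}H\subset S$, $\|J\|\le M$ and $C\delta\le\kappa$, $$\|J\varphi(H)-\varphi(\widetilde H)J\|\le\eta,\qquad\text{and, if } a=0,\qquad\|J\varphi(H)J^*-\varphi(\widetilde H)\|\le\eta .$$ In (iii) and (iv) let $H$ be as above and let $(H_\varepsilon)$ be a family of operators associated with closed semi-bounded forms in Hilbert spaces $\mathcal H_\varepsilon$ such that $H$ and $H_\varepsilon$ are $\delta_\varepsilon$-quasi-unitarily equivalent, with identification operators $J_\varepsilon$, for all small $\varepsilon$, where $\delta_\varepsilon\to0$ as $\varepsilon\to0$. (The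 index $\varepsilon\to 0$ may be replaced by any proper filter on any index set. Statements about members of families are meant for all small $\varepsilon$.) 3. (iii) If $\lambda_\varepsilon\in\operatorname{spec}H_\varepsilon$ and $\lambda_\varepsilon\to\lambda$, then $\lambda\in\operatorname{spec}H$; if $\lambda\in\operatorname{spec}H$, then there are $\lambda_\varepsilon\in\operatorname{spec}H_\varepsilon$ with $\lambda_\varepsilon\to\lambda$. The same is true for the essential spectrum. 4. (iv) For every $\lambda\in\operatorname{spec}_{\rm disc}H$ there are $\lambda_\varepsilon\in\operatorname{spec}_{\rm disc}H_\varepsilon$ with $\lambda_\varepsilon\to\lambda$. The multiplicity is preserved: for all sufficiently small $r>0$ and then all small $\varepsilon$, the spectrum of $H_\varepsilon$ in the ball of radius $r$ about $\lambda$ consists of finitely many discrete eigenvalues, whose multiplicities add up to that of $\lambda$. If $\lambda$ is a simple discrete eigenvalue of $H$ with normalised eigenfunction $\phi$, then there are $\lambda_\varepsilon\to\lambda$ and $\phi_\varepsilon$ such that, for small $\varepsilon$, $\lambda_\varepsilon$ is a simple discrete eigenvalue of $H_\varepsilon$ with normalised eigenfunction $\phi_\varepsilon$, and $\|J_\varepsilon\phi-\phi_\varepsilon\|\to0$.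 -/

import Mathlib

open Filter Topology MeasureTheory
open scoped InnerProductSpace ComplexConjugate

universe u v w

/-- A closed quadratic form, semi-bounded from below, in the Hilbert space `E`. Its domain is a
Hilbert space `Dom` (the space `H¹` with its own norm `‖·‖₁`), which is a dense subspace of `E`
through the injection `incl`, with `‖f‖ ≤ ‖f‖₁`. The form is given by its Hermitian sesquilinear
form (conjugate linear in the first argument, as the inner product of Mathlib). -/
structure ClosedForm (E : Type u) [NormedAddCommGroup E] [InnerProductSpace ℂ E] where
  Dom : Type u
  [normedAddCommGroup : NormedAddCommGroup Dom]
  [innerProductSpace : InnerProductSpace ℂ Dom]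
  [completeSpace : CompleteSpace Dom]
  incl : Dom →L[ℂ] E
  incl_injective : Function.Injective incl
  incl_denseRange : DenseRange incl
  norm_incl_le : ∀ f : Dom, ‖incl f‖ ≤ ‖f‖
  form : Dom →ₗ⋆[ℂ] Dom →ₗ[ℂ] ℂ
  hermitian : ∀ f g : Dom, form f g = conj (form g f)
  semibounded : ∃ m : ℝ, ∀ f : Dom, m * ‖incl f‖ ^ 2 ≤ (form f f).re
  /-- Closedness: if `u n → f` in `E` and `h(u n - u m) → 0`, then `f` lies in the domain and
  `h(u n - f) → 0`. -/
  closed : ∀ (u : ℕ → Dom) (f : E), Tendsto (fun n => incl (u n)) atTop (𝓝 f) →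
    Tendsto (fun p : ℕ × ℕ => form (u p.1 - u p.2) (u p.1 - u p.2)) atTop (𝓝 0) →
    ∃ g : Dom, incl g = f ∧ Tendsto (fun n => form (u n - g) (u n - g)) atTop (𝓝 0)

attribute [instance] ClosedForm.normedAddCommGroup ClosedForm.innerProductSpace
  ClosedForm.completeSpace

namespace ClosedForm

variable {E : Type u} [NormedAddCommGroup E] [InnerProductSpace ℂ E]

/-- The graph of the operator associated with the form: `(f, w)` belongs to it iff `f` lies in the
form domain and `h(f, g) = ⟪w, g⟫` for all `g` in the form domain. -/
def operatorGraph (h : ClosedForm E) : Submodule ℂ (E × E) where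
  carrier := {p | ∃ f : h.Dom, h.incl f = p.1 ∧ ∀ g : h.Dom, h.form f g = ⟪p.2, h.incl g⟫_ℂ}
  add_mem' := by
    rintro p q ⟨f, hf, hf'⟩ ⟨g, hg, hg'⟩
    refine ⟨f + g, by simp [hf, hg], fun k => ?_⟩
    simp [hf', hg']
  zero_mem' := ⟨0, by simp, fun g => by simp⟩
  smul_mem' := by
    rintro c p ⟨f, hf, hf'⟩
    refine ⟨c • f, by simp [hf], fun k => ?_⟩
    simp [hf', mul_comm]

theorem operatorGraph_single_valued (h : ClosedForm E) :
    ∀ p ∈ h.operatorGraph, p.1 = 0 → p.2 = 0 := by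
  rintro p ⟨f, hf, hf'⟩ h0
  have hf0 : f = 0 := h.incl_injective (by rw [hf, h0, map_zero])
  refine h.incl_denseRange.eq_zero_of_inner_left (𝕜 := ℂ) ?_
  intro g
  rw [← hf' g, hf0]
  simp

/-- The (self-adjoint, unbounded) operator associated with a closed form. -/
noncomputable def operator (h : ClosedForm E) : E →ₗ.[ℂ] E := h.operatorGraph.toLinearPMap

theorem graph_operator (h : ClosedForm E) : h.operator.graph = h.operatorGraph :=
  Submodule.toLinearPMap_graph_eq _ h.operatorGraph_single_valued

/-- The estimate `‖f‖₁² ≤ 2 (h(f) + C ‖f‖²)` on the form domain. -/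
def NormBound (h : ClosedForm E) (C : ℝ) : Prop :=
  ∀ f : h.Dom, ‖f‖ ^ 2 ≤ 2 * ((h.form f f).re + C * ‖h.incl f‖ ^ 2)

end ClosedForm

section Operators

variable {E : Type u} [NormedAddCommGroup E] [InnerProductSpace ℂ E]

/-- `R` is the bounded two-sided inverse of `A - z`. -/
def IsResolvent (A : E →ₗ.[ℂ] E) (z : ℂ) (R : E →L[ℂ] E) : Prop :=
  (∀ f : E, (R f, f + z • R f) ∈ A.graph) ∧ ∀ f g : E, (f, g) ∈ A.graph → R (g - z • f) = f

/-- The resolvent set of an unbounded operator. -/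
def resolventSetOf (A : E →ₗ.[ℂ] E) : Set ℂ := {z | ∃ R : E →L[ℂ] E, IsResolvent A z R}

/-- The spectrum of an unbounded operator. -/
def specOf (A : E →ₗ.[ℂ] E) : Set ℂ := (resolventSetOf A)ᶜ

open Classical in
/-- The resolvent `(A - z)⁻¹`, for `z` in the resolvent set. -/
noncomputable def resolventOf (A : E →ₗ.[ℂ] E) (z : ℂ) : E →L[ℂ] E :=
  if hz : ∃ R : E →L[ℂ] E, IsResolvent A z R then hz.choose else 0

/-- The eigenspace `ker (A - l)`. -/
def eigenspaceOf (A : E →ₗ.[ℂ] E) (l : ℂ) : Submodule ℂ E where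
  carrier := {f | (f, l • f) ∈ A.graph}
  add_mem' := by
    intro f g hf hg
    have h0 : (f + g, l • (f + g)) = (f, l • f) + (g, l • g) := by ext <;> simp
    simp only [Set.mem_ofPred_eq, h0]
    exact A.graph.add_mem hf hg
  zero_mem' := by
    have h0 : ((0 : E), l • (0 : E)) = 0 := by ext <;> simp
    simp only [Set.mem_ofPred_eq, h0]
    exact A.graph.zero_mem
  smul_mem' := by
    intro c f hf
    have h0 : (c • f, l • c • f) = c • (f, l • f) := by ext <;> simp [smul_comm c l f]
    simp only [Set.mem_ofPred_eq, h0]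
    exact A.graph.smul_mem c hf

/-- The multiplicity of an eigenvalue (of finite multiplicity). -/
noncomputable def multOf (A : E →ₗ.[ℂ] E) (l : ℂ) : ℕ := Module.finrank ℂ (eigenspaceOf A l)

/-- The discrete spectrum (of a self-adjoint operator): the isolated points of the spectrum with
finite-dimensional eigenspace. -/
def discSpecOf (A : E →ₗ.[ℂ] E) : Set ℂ :=
  {l | (∃ r > 0, specOf A ∩ Metric.ball l r = {l}) ∧ FiniteDimensional ℂ (eigenspaceOf A l)}

/-- The essential spectrum: the complement of the discrete spectrum in the spectrum. -/
def essSpecOf (A : E →ₗ.[ℂ] E) : Set ℂ := specOf A \ discSpecOf A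

/-- `μ` is the (scalar) spectral measure of the self-adjoint operator `A` at the vector `f`: the
finite Borel measure with `⟪f, (A - z)⁻¹ f⟫ = ∫ (x - z)⁻¹ dμ(x)` for all non-real `z`. -/
def IsSpectralMeasureAt (A : E →ₗ.[ℂ] E) (f : E) (μ : Measure ℝ) : Prop :=
  IsFiniteMeasure μ ∧
    ∀ z : ℂ, z.im ≠ 0 → ⟪f, resolventOf A z f⟫_ℂ = ∫ x : ℝ, ((x : ℂ) - z)⁻¹ ∂μ

/-- `B = φ(A)` for a bounded Borel function `φ`: `⟪f, B f⟫ = ∫ φ dμ` for all `f`, where `μ` is the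
spectral measure of `A` at `f`. -/
def IsBorelFunctionOf (A : E →ₗ.[ℂ] E) (φ : ℝ → ℂ) (B : E →L[ℂ] E) : Prop :=
  ∀ f : E, ∃ μ : Measure ℝ, IsSpectralMeasureAt A f μ ∧ ⟪f, B f⟫_ℂ = ∫ x : ℝ, φ x ∂μ

open Classical in
/-- The operator `φ(A)`, for `A` self-adjoint and `φ` a bounded Borel function. -/
noncomputable def borelFunctionOf (A : E →ₗ.[ℂ] E) (φ : ℝ → ℂ) : E →L[ℂ] E :=
  if hB : ∃ B : E →L[ℂ] E, IsBorelFunctionOf A φ B then hB.choose else 0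

end Operators

section QuasiUnitary

variable {E : Type u} [NormedAddCommGroup E] [InnerProductSpace ℂ E] [CompleteSpace E]
  {F : Type v} [NormedAddCommGroup F] [InnerProductSpace ℂ F] [CompleteSpace F]

/-- The forms `h` and `k` are `δ`-quasi-unitarily equivalent, with identification operator `J`
between the Hilbert spaces (and some identification operators `J₁`, `J₁'` between the form
domains). -/
def FormQUE (δ : ℝ) (J : E →L[ℂ] F) (h : ClosedForm E) (k : ClosedForm F) : Prop :=
  ∃ (J₁ : h.Dom →L[ℂ] k.Dom) (J₁' : k.Dom →L[ℂ] h.Dom),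
    (∀ f : h.Dom, ‖J (h.incl f) - k.incl (J₁ f)‖ ^ 2 ≤ δ ^ 2 * ‖f‖ ^ 2) ∧
    (∀ g : k.Dom, ‖J.adjoint (k.incl g) - h.incl (J₁' g)‖ ^ 2 ≤ δ ^ 2 * ‖g‖ ^ 2) ∧
    (∀ f : h.Dom, ‖J.adjoint (J (h.incl f)) - h.incl f‖ ^ 2 ≤ δ ^ 2 * ‖f‖ ^ 2) ∧
    (∀ g : k.Dom, ‖J (J.adjoint (k.incl g)) - k.incl g‖ ^ 2 ≤ δ ^ 2 * ‖g‖ ^ 2) ∧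
    ∀ (f : h.Dom) (g : k.Dom), ‖h.form (J₁' g) f - k.form g (J₁ f)‖ ≤ δ * ‖g‖ * ‖f‖

/-- The self-adjoint operators `A` and `B` are `δ`-quasi-unitarily equivalent, with identification
operator `J`; the resolvents are those at `i` and at `-i`. -/
def OperatorQUE (δ : ℝ) (J : E →L[ℂ] F) (A : E →ₗ.[ℂ] E) (B : F →ₗ.[ℂ] F) : Prop :=
  ∀ z : ℂ, z = Complex.I ∨ z = -Complex.I →
    ‖(ContinuousLinearMap.id ℂ E - J.adjoint ∘L J) ∘L resolventOf A z‖ ≤ δ ∧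
    ‖(ContinuousLinearMap.id ℂ F - J ∘L J.adjoint) ∘L resolventOf B z‖ ≤ δ ∧
    ‖J ∘L resolventOf A z - resolventOf B z ∘L J‖ ≤ δ

end QuasiUnitary

/-! ### From closed forms to bounded self-adjoint inverses -/

section FormToOperator

/-! Unbounded operators are handled through bounded ones. A closed form, shifted by a constant, is a
complete inner product on its domain, so Riesz duality yields a bounded self-adjoint inverse `T` of
`H - z₀` at some real `z₀` (`ClosedForm.exists_hasRealResolvent`). All other resolvents, the
spectral subspaces and the functional calculus are built from `T`.

Resolvent estimates. Pairing `J R - R̃ J` with two vectors and passing to the weak form equations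
leaves only errors of size `δ` times form norms (`FormQUEData.norm_inner_sub_inner_le`); the form
norm of a resolvent is of order `√C`, and two such factors give `C δ`. At `±i` the constant is 12.
The estimate of `J R J† - R̃` cannot be deduced by multiplying with `J†`, because `‖J‖` must not
enter the constant. Instead `J` and `J†` are bounded only on vectors of the form domains, where `‖J
f‖² - ‖f‖² = ⟪J† J f - f, f⟫` is small, and the case `C δ ≥ 1` is settled by size alone
(`FormQUEData.norm_sandwich_le`).

Functional calculus. By Stone–Weierstrass, `φ` is uniformly close to `a + ∑ c_z (x - z)⁻¹` near `S`
and near `+∞`. To use this for both operators, the spectrum of the second must lie where the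
approximation holds: `neg_notMem_specOf` excludes far negative points uniformly in `C`, and
`exists_mem_specOf_dist_lt` puts the rest of any bounded region near `S`. The operators `φ(H)` exist
because the spectral measures, obtained by Riesz–Markov from the continuous calculus of `T`, are
determined by their Stieltjes transforms.

Spectral convergence rests on one dimension comparison, `OperatorQUE.finrank_le`: if `|A - μ| ≤ r'`
on a reducing `V` and `|B - μ| ≥ r > r'` off a finite-dimensional reducing `W`, then for small `δ`
the map `P_W J R²` is injective on `V`. With `W = 0` this compares resolvent sets, with
finite-dimensional `W` essential spectra, and used in both directions it gives equality of
multiplicities. For a simple eigenvalue, the projection of `J φ` to the nearby eigenspace,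
normalised, is the approximating eigenfunction. -/

/-- The operator `ι ι†` of a Hilbert space structure, given by its core, on a space `D` that is
continuously mapped to `E` by `ι`. -/
theorem exists_selfAdjoint_of_core {E : Type*} [NormedAddCommGroup E] [InnerProductSpace ℂ E]
    [CompleteSpace E] {D : Type*} [AddCommGroup D] [Module ℂ D]
    (c : InnerProductSpace.Core ℂ D) (ι : D →ₗ[ℂ] E)
    (hι : ∀ d, ‖ι d‖ ^ 2 ≤ (c.inner d d).re)
    (hc : ∀ u : ℕ → D,
      Tendsto (fun p : ℕ × ℕ => (c.inner (u p.1 - u p.2) (u p.1 - u p.2)).re) atTop (𝓝 0) →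
      ∃ g, Tendsto (fun n => (c.inner (u n - g) (u n - g)).re) atTop (𝓝 0)) :
    ∃ T : E →L[ℂ] E, IsSelfAdjoint T ∧ ∀ w : E, ∃ d, ι d = T w ∧
      (∀ g, c.inner d g = ⟪w, ι g⟫_ℂ) ∧ ∀ d', (∀ g, c.inner d' g = ⟪w, ι g⟫_ℂ) → d' = d := by
  let _ : NormedAddCommGroup D := c.toNormedAddCommGroup
  let _ : InnerProductSpace ℂ D := InnerProductSpace.ofCore c.toCore
  have hnorm : ∀ d : D, ‖d‖ ^ 2 = (c.inner d d).re := fun d => by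
    rw [← inner_self_eq_norm_sq (𝕜 := ℂ) d]; rfl
  have hcomp : CompleteSpace D := by
    refine Metric.complete_of_cauchySeq_tendsto fun u hu => ?_
    obtain ⟨g, hg⟩ := hc u (by
      have h1 : Tendsto (fun p : ℕ × ℕ => dist (u p.1) (u p.2)) atTop (𝓝 0) := by
        rw [← prod_atTop_atTop_eq]
        exact (cauchySeq_iff_tendsto_dist_atTop_0.1 hu).mono_left
          (by rw [prod_atTop_atTop_eq])
      have h2 := h1.pow 2
      simpa [dist_eq_norm, hnorm] using h2)
    refine ⟨g, tendsto_iff_norm_sub_tendsto_zero.2 ?_⟩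
    have h3 := hg.sqrt
    simp only [← hnorm, Real.sqrt_zero] at h3
    simpa using h3
  let j : D →L[ℂ] E := ι.mkContinuous 1 fun d => by
    rw [one_mul]
    refine (sq_le_sq₀ (norm_nonneg _) (norm_nonneg _)).1 ?_
    rw [hnorm]; exact hι d
  refine ⟨j ∘L j.adjoint, by
    rw [ContinuousLinearMap.isSelfAdjoint_iff']; simp [ContinuousLinearMap.adjoint_comp],
    fun w => ⟨j.adjoint w, rfl, fun g => ?_, fun d' hd' => ?_⟩⟩
  · exact ContinuousLinearMap.adjoint_inner_left j g w
  · refine ext_inner_right ℂ fun g => ?_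
    rw [ContinuousLinearMap.adjoint_inner_left]
    exact hd' g

/-- `T` is the self-adjoint resolvent of `A` at the real point `z₀`. -/
structure HasRealResolvent {E : Type*} [NormedAddCommGroup E] [InnerProductSpace ℂ E]
    [CompleteSpace E] (A : E →ₗ.[ℂ] E) (z₀ : ℝ) (T : E →L[ℂ] E) : Prop where
  isResolvent : IsResolvent A z₀ T
  isSelfAdjoint : IsSelfAdjoint T

/-- The inner product used on `Dom` is the shifted form, not the given one: closedness of the form
is precisely completeness for the shifted form. The operator `ι ι†` is then the inverse of `H - (m -
1)`, where `m` is a lower bound of the form. -/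
theorem ClosedForm.exists_hasRealResolvent {E : Type u} [NormedAddCommGroup E]
    [InnerProductSpace ℂ E] [CompleteSpace E] (h : ClosedForm E) :
    ∃ (z₀ : ℝ) (T : E →L[ℂ] E), HasRealResolvent h.operator z₀ T := by
  obtain ⟨m, hm⟩ := h.semibounded
  have hre : ∀ d, (h.form d d).im = 0 := fun d => by
    have := congrArg Complex.im (h.hermitian d d)
    rw [Complex.conj_im] at this; linarith
  have hnn : ∀ d, ⟪h.incl d, h.incl d⟫_ℂ = ((‖h.incl d‖ ^ 2 : ℝ) : ℂ) := fun d => by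
    rw [inner_self_eq_norm_sq_to_K]; norm_cast
  -- The shift `1 - m` rather than `-m` makes the new square norm dominate `‖incl f‖²`; this gives
  -- definiteness and makes `incl` a contraction.
  let c : InnerProductSpace.Core ℂ h.Dom :=
    { inner := fun f g => h.form f g + (1 - m : ℝ) * ⟪h.incl f, h.incl g⟫_ℂ
      conj_inner_symm := fun f g => by
        simp [← h.hermitian f g]
      re_inner_nonneg := fun f => by
        have := hm f
        rw [hnn]
        simp only [← Complex.ofReal_mul, map_add, RCLike.re_to_complex, Complex.ofReal_re]
        nlinarith [sq_nonneg ‖h.incl f‖]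
      add_left := fun f g k => by simp; ring
      smul_left := fun f g r => by simp; ring
      definite := fun f hf => by
        have := hm f
        rw [hnn] at hf
        have h1 := congrArg Complex.re hf
        simp only [← Complex.ofReal_mul, Complex.add_re, Complex.ofReal_re, Complex.zero_re] at h1
        have h2 : ‖h.incl f‖ ^ 2 ≤ 0 := by nlinarith
        have h3 : h.incl f = 0 := norm_eq_zero.1 (pow_eq_zero_iff two_ne_zero |>.1
          (le_antisymm h2 (sq_nonneg _)))
        exact h.incl_injective (by rw [h3, map_zero]) }
  have hcre : ∀ d, (c.inner d d).re = (h.form d d).re + (1 - m) * ‖h.incl d‖ ^ 2 := fun d => by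
    change (h.form d d + (1 - m : ℝ) * ⟪h.incl d, h.incl d⟫_ℂ).re = _
    rw [hnn]
    simp only [← Complex.ofReal_mul, Complex.add_re, Complex.ofReal_re]
  have hle : ∀ d, ‖h.incl d‖ ^ 2 ≤ (c.inner d d).re := fun d => by
    rw [hcre]; nlinarith [hm d]
  obtain ⟨T, hT, hT'⟩ := exists_selfAdjoint_of_core c h.incl.toLinearMap hle (by
    intro u hu
    have hn2 : Tendsto (fun p : ℕ × ℕ => ‖h.incl (u p.1 - u p.2)‖ ^ 2) atTop (𝓝 0) :=
      squeeze_zero (fun _ => sq_nonneg _) (fun p => hle _) hu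
    have hn : Tendsto (fun p : ℕ × ℕ => ‖h.incl (u p.1 - u p.2)‖) atTop (𝓝 0) := by
      simpa using hn2.sqrt
    have hcau : CauchySeq fun n => h.incl (u n) := by
      rw [cauchySeq_iff_tendsto_dist_atTop_0, ]
      simpa [dist_eq_norm] using hn
    obtain ⟨f, hf⟩ := cauchySeq_tendsto_of_complete hcau
    have hform : Tendsto (fun p : ℕ × ℕ => h.form (u p.1 - u p.2) (u p.1 - u p.2)) atTop
        (𝓝 0) := by
      have h1 := hu.sub (hn2.const_mul (1 - m))
      simp only [hcre] at h1
      have h2 : Tendsto (fun p : ℕ × ℕ => (h.form (u p.1 - u p.2) (u p.1 - u p.2)).re) atTop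
        (𝓝 0) := by simpa using h1
      have h3 := (Complex.continuous_ofReal.tendsto 0).comp h2
      rw [Complex.ofReal_zero] at h3
      refine h3.congr fun p => ?_
      exact Complex.ext (by simp) (by rw [hre]; simp)
    obtain ⟨g, hg, hg'⟩ := h.closed u f hf hform
    refine ⟨g, ?_⟩
    have h4 : Tendsto (fun n => ‖h.incl (u n - g)‖ ^ 2) atTop (𝓝 0) := by
      have : Tendsto (fun n => h.incl (u n) - f) atTop (𝓝 0) := by
        simpa using hf.sub_const f
      simpa [hg] using this.norm.pow 2
    have h5 := ((Complex.continuous_re.tendsto 0).comp hg').add (h4.const_mul (1 - m))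
    simpa [hcre] using h5)
  have hinner : ∀ f g, c.inner f g = h.form f g + (1 - m : ℝ) * ⟪h.incl f, h.incl g⟫_ℂ :=
    fun _ _ => rfl
  refine ⟨m - 1, T, ⟨fun w => ?_, fun f w hfw => ?_⟩, hT⟩
  · rw [h.graph_operator]
    obtain ⟨d, hd, hd', -⟩ := hT' w
    refine ⟨d, hd, fun g => ?_⟩
    have := hd' g
    rw [hinner] at this
    rw [inner_add_left, inner_smul_left, ← hd]
    simp only [ContinuousLinearMap.coe_coe] at this ⊢
    rw [← this, Complex.conj_ofReal]; push_cast; ring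
  · rw [h.graph_operator] at hfw
    obtain ⟨d, hd, hd'⟩ := hfw
    obtain ⟨d₂, hd₂, -, huniq⟩ := hT' (w - ((m - 1 : ℝ) : ℂ) • f)
    rw [← hd₂, ← huniq d fun g => ?_]
    · exact hd
    · rw [hinner, hd', inner_sub_left, inner_smul_left, Complex.conj_ofReal]
      simp only [ContinuousLinearMap.coe_coe] at hd ⊢
      rw [hd]; push_cast; ring

end FormToOperator

/-! ### Algebra of resolvents -/

section Resolvents

variable {E : Type*} [NormedAddCommGroup E] [InnerProductSpace ℂ E]
  {A : E →ₗ.[ℂ] E} {z w : ℂ} {R R' : E →L[ℂ] E}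

theorem IsResolvent.unique (h : IsResolvent A z R) (h' : IsResolvent A z R') : R' = R := by
  ext f
  simpa using (h'.2 _ _ (h.1 f))

theorem IsResolvent.mem (h : IsResolvent A z R) : z ∈ resolventSetOf A := ⟨R, h⟩

theorem isResolvent_resolventOf (hz : z ∈ resolventSetOf A) :
    IsResolvent A z (resolventOf A z) := by
  have hz' : ∃ R : E →L[ℂ] E, IsResolvent A z R := hz
  rw [resolventOf, dif_pos hz']
  exact hz'.choose_spec

theorem IsResolvent.resolventOf_eq (h : IsResolvent A z R) : resolventOf A z = R :=
  h.unique (isResolvent_resolventOf h.mem)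

theorem IsResolvent.mem_graph_iff (h : IsResolvent A z R) {f g : E} :
    (f, g) ∈ A.graph ↔ f = R (g - z • f) := by
  refine ⟨fun hfg => (h.2 _ _ hfg).symm, fun hf => ?_⟩
  have := h.1 (g - z • f)
  rwa [← hf, sub_add_cancel] at this

theorem IsResolvent.eq_zero (h : IsResolvent A z R) {f : E} (hf : R f = 0) : f = 0 := by
  have h1 := h.1 f
  rw [hf] at h1
  have h2 := LinearPMap.graph_fst_eq_zero_snd A h1 rfl
  simpa using h2

/-- This is the factorisation `A - z = (1 - (z - w) R)(A - w)`: inverting the bounded factor inverts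
`A - z`. -/
theorem IsResolvent.of_isUnit (h : IsResolvent A w R) {V : E →L[ℂ] E}
    (h₁ : (1 - (z - w) • R) * V = 1) (h₂ : V * (1 - (z - w) • R) = 1) :
    IsResolvent A z (R * V) := by
  constructor
  · intro f
    have h3 : V f - (z - w) • R (V f) = f := by
      simpa using DFunLike.congr_fun h₁ f
    have h4 := h.1 (V f)
    have h5 : f + z • R (V f) = V f + w • R (V f) := by
      nth_rewrite 1 [← h3]; module
    simpa [h5] using h4
  · intro f g hfg
    have h3 := h.mem_graph_iff.1 hfg
    have h4 : g - z • f = (1 - (z - w) • R) (g - w • f) := by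
      simp only [sub_apply, one_apply_eq_self,
        smul_apply, ← h3]
      module
    have h5 : V ((1 - (z - w) • R) (g - w • f)) = g - w • f := DFunLike.congr_fun h₂ _
    rw [mul_apply_eq_comp, h4, h5, ← h3]

theorem IsResolvent.sub (h : IsResolvent A z R) (h' : IsResolvent A w R') :
    R - R' = (z - w) • (R * R') := by
  ext f
  have h1 := h.2 _ _ (h'.1 f)
  have h2 : f + w • R' f - z • R' f = f - (z - w) • R' f := by module
  rw [h2, map_sub, map_smul] at h1
  simp only [sub_apply, smul_apply,
    mul_apply_eq_comp]
  nth_rewrite 1 [← h1]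
  exact sub_sub_cancel _ _

theorem IsResolvent.mul_shift (h : IsResolvent A w R) (h' : IsResolvent A z R') :
    (1 - (z - w) • R) * (1 + (z - w) • R') = 1 ∧ (1 + (z - w) • R') * (1 - (z - w) • R) = 1 := by
  have h1 := h.sub h'
  have h2 := h'.sub h
  constructor
  · have : (1 - (z - w) • R) * (1 + (z - w) • R')
      = 1 - (z - w) • ((R - R') - (w - z) • (R * R')) := by
      simp only [sub_mul, mul_add, smul_mul_assoc, mul_smul_comm, one_mul, mul_one]
      module
    rw [this, h1]; simp
  · have : (1 + (z - w) • R') * (1 - (z - w) • R)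
      = 1 + (z - w) • ((R' - R) - (z - w) • (R' * R)) := by
      simp only [add_mul, mul_sub, smul_mul_assoc, mul_smul_comm, one_mul, mul_one]
      module
    rw [this, h2]; simp

/-- Membership in the resolvent set of an unbounded operator becomes invertibility in a Banach
algebra, whence closedness of the spectrum and the link with the spectrum of `R`. -/
theorem IsResolvent.mem_resolventSetOf_iff (h : IsResolvent A w R) :
    z ∈ resolventSetOf A ↔ IsUnit (1 - (z - w) • R) := by
  constructor
  · rintro ⟨R', h'⟩
    have := h.mul_shift h'
    exact ⟨⟨_, _, this.1, this.2⟩, rfl⟩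
  · rintro ⟨V, hV⟩
    exact (h.of_isUnit (V := ↑V⁻¹) (by rw [← hV]; simp) (by rw [← hV]; simp)).mem

/-- All resolvents are `R V` with `V` the inverse of `1 - (z - w) R`, so whatever commutes with one
commutes with all. -/
theorem IsResolvent.commute (h : IsResolvent A w R) (h' : IsResolvent A z R')
    {P : E →L[ℂ] E} (hP : Commute P R) : Commute P R' := by
  have h0 := h.mul_shift h'
  let V : (E →L[ℂ] E)ˣ := ⟨1 - (z - w) • R, 1 + (z - w) • R', h0.1, h0.2⟩
  have h1 := (h.of_isUnit h0.1 h0.2)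
  rw [h1.unique h']
  have h2 : Commute P (V : E →L[ℂ] E) := (Commute.one_right P).sub_right (hP.smul_right _)
  have h3 : Commute P ((V⁻¹ : (E →L[ℂ] E)ˣ) : E →L[ℂ] E) := h2.units_inv_right
  exact hP.mul_right h3

theorem IsResolvent.mem_spectrum [CompleteSpace E] (h : IsResolvent A w R) {ζ : ℂ} (hζ : ζ ≠ 0)
    (hs : ζ ∈ spectrum ℂ R) : w + ζ⁻¹ ∈ specOf A := by
  intro hmem
  rw [h.mem_resolventSetOf_iff] at hmem
  refine hs ?_
  have : algebraMap ℂ (E →L[ℂ] E) ζ - R = ζ • (1 - (w + ζ⁻¹ - w) • R) := by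
    rw [add_sub_cancel_left, smul_sub, smul_smul, mul_inv_cancel₀ hζ, one_smul,
      Algebra.algebraMap_eq_smul_one]
  rw [spectrum.mem_resolventSet_iff, this]
  exact hmem.smul (Units.mk0 ζ hζ)

end Resolvents

/-! ### Self-adjointness: real spectrum and lower bounds -/

section SelfAdjoint

variable {E : Type*} [NormedAddCommGroup E] [InnerProductSpace ℂ E] [CompleteSpace E]
  {A : E →ₗ.[ℂ] E} {z₀ : ℝ} {T : E →L[ℂ] E} {z w : ℂ}

namespace HasRealResolvent

theorem inner_comm (h : HasRealResolvent A z₀ T) {f g f' g' : E} (hf : (f, g) ∈ A.graph)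
    (hf' : (f', g') ∈ A.graph) : ⟪g, f'⟫_ℂ = ⟪f, g'⟫_ℂ := by
  have h1 := h.isResolvent.mem_graph_iff.1 hf
  have h2 := h.isResolvent.mem_graph_iff.1 hf'
  have h3 : ⟪f, g' - (z₀ : ℂ) • f'⟫_ℂ = ⟪g - (z₀ : ℂ) • f, f'⟫_ℂ := by
    nth_rewrite 1 [h1]
    rw [← ContinuousLinearMap.adjoint_inner_right, h.isSelfAdjoint.adjoint_eq, ← h2]
  rw [inner_sub_left, inner_sub_right, inner_smul_left, inner_smul_right, Complex.conj_ofReal] at h3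
  linear_combination -h3

/-- A non-real `z` in the spectrum of `A` would give the non-real point `(z - z₀)⁻¹` in the spectrum
of the self-adjoint `T`. -/
theorem mem_of_im_ne_zero (h : HasRealResolvent A z₀ T) (hz : z.im ≠ 0) :
    z ∈ resolventSetOf A := by
  by_contra hc
  have hne : z - z₀ ≠ 0 := fun h0 => hz (by rw [sub_eq_zero.1 h0]; simp)
  rw [h.isResolvent.mem_resolventSetOf_iff] at hc
  have hs : (z - z₀)⁻¹ ∈ spectrum ℂ T := by
    intro hr
    refine hc ?_
    rw [spectrum.mem_resolventSet_iff] at hr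
    have : 1 - (z - z₀) • T = (z - z₀) • (algebraMap ℂ (E →L[ℂ] E) (z - z₀)⁻¹ - T) := by
      rw [smul_sub, Algebra.algebraMap_eq_smul_one, smul_smul, mul_inv_cancel₀ hne, one_smul]
    rw [this]
    exact hr.smul (Units.mk0 _ hne)
  have him := h.isSelfAdjoint.im_eq_zero_of_mem_spectrum hs
  rw [Complex.inv_im, div_eq_zero_iff] at him
  rcases him with him | him
  · simp at him; exact hz him
  · exact hne (Complex.normSq_eq_zero.1 him)

theorem isResolvent_of_im_ne_zero (h : HasRealResolvent A z₀ T) (hz : z.im ≠ 0) :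
    IsResolvent A z (resolventOf A z) := isResolvent_resolventOf (h.mem_of_im_ne_zero hz)

theorem im_eq_zero (h : HasRealResolvent A z₀ T) (hz : z ∈ specOf A) : z.im = 0 := by
  by_contra hc
  exact hz (h.mem_of_im_ne_zero hc)

theorem adjoint_resolventOf (h : HasRealResolvent A z₀ T) (hz : z ∈ resolventSetOf A)
    (hz' : conj z ∈ resolventSetOf A) : (resolventOf A z).adjoint = resolventOf A (conj z) := by
  symm
  rw [ContinuousLinearMap.eq_adjoint_iff]
  intro a b
  have h1 := (isResolvent_resolventOf hz').1 a
  have h2 := (isResolvent_resolventOf hz).1 b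
  have h3 := h.inner_comm h1 h2
  rw [inner_add_left, inner_add_right, inner_smul_left, inner_smul_right, Complex.conj_conj] at h3
  linear_combination -h3

theorem adjoint_resolventOf' (h : HasRealResolvent A z₀ T) (hz : z.im ≠ 0) :
    (resolventOf A z).adjoint = resolventOf A (conj z) :=
  h.adjoint_resolventOf (h.mem_of_im_ne_zero hz) (h.mem_of_im_ne_zero (by simpa using hz))

theorem shift (h : HasRealResolvent A z₀ T) {μ : ℝ} (hμ : (μ : ℂ) ∈ resolventSetOf A) :
    HasRealResolvent A μ (resolventOf A μ) := by
  refine ⟨isResolvent_resolventOf hμ, ?_⟩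
  rw [ContinuousLinearMap.isSelfAdjoint_iff',
    h.adjoint_resolventOf hμ (by rwa [Complex.conj_ofReal]), Complex.conj_ofReal]

/-- By symmetry `⟪f, g⟫` is real, so the imaginary part of `⟪f, g - z f⟫` is `-Im z ‖f‖²`;
Cauchy–Schwarz does the rest. -/
theorem norm_le (h : HasRealResolvent A z₀ T) {f g : E} (hf : (f, g) ∈ A.graph) (z : ℂ) :
    |z.im| * ‖f‖ ≤ ‖g - z • f‖ := by
  have h1 : (⟪f, g⟫_ℂ).im = 0 := by
    have h2 := h.inner_comm hf hf
    have h3 := inner_conj_symm (𝕜 := ℂ) f g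
    rw [h2] at h3
    have := congrArg Complex.im h3
    rw [Complex.conj_im] at this; linarith
  have h2 : (⟪f, g - z • f⟫_ℂ).im = -(z.im * ‖f‖ ^ 2) := by
    rw [inner_sub_right, inner_smul_right, inner_self_eq_norm_sq_to_K, Complex.sub_im, h1]
    have : (z * ((‖f‖ : ℝ) : ℂ) ^ 2).im = z.im * ‖f‖ ^ 2 := by
      rw [← Complex.ofReal_pow, Complex.im_mul_ofReal]
    rw [zero_sub, neg_inj]; exact this
  have h3 : |z.im| * ‖f‖ ^ 2 ≤ ‖f‖ * ‖g - z • f‖ := by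
    calc |z.im| * ‖f‖ ^ 2 = |(⟪f, g - z • f⟫_ℂ).im| := by
          rw [h2, abs_neg, abs_mul, abs_of_nonneg (sq_nonneg ‖f‖)]
      _ ≤ ‖⟪f, g - z • f⟫_ℂ‖ := Complex.abs_im_le_norm _
      _ ≤ _ := norm_inner_le_norm _ _
  rcases (norm_nonneg f).eq_or_lt with h0 | h0
  · rw [← h0, mul_zero]; exact norm_nonneg _
  · refine le_of_mul_le_mul_left ?_ h0
    linarith

theorem norm_resolventOf_le (h : HasRealResolvent A z₀ T) (hz : z.im ≠ 0) (f : E) :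
    |z.im| * ‖resolventOf A z f‖ ≤ ‖f‖ := by
  simpa using h.norm_le ((h.isResolvent_of_im_ne_zero hz).1 f) z

theorem isClosed_specOf (h : HasRealResolvent A z₀ T) : IsClosed (specOf A) := by
  rw [specOf, isClosed_compl_iff]
  have : resolventSetOf A = (fun z : ℂ => 1 - (z - z₀) • T) ⁻¹' {S | IsUnit S} := by
    ext z; exact h.isResolvent.mem_resolventSetOf_iff
  rw [this]
  exact Units.isOpen.preimage (by fun_prop)

/-- If a real point has distance at least `r` to the spectrum, then `A - μ` is bounded below
by `r`. -/
theorem le_norm_of_disjoint (h : HasRealResolvent A z₀ T) {μ r : ℝ} (hr : 0 < r)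
    (hμ : ∀ z ∈ specOf A, r ≤ dist z μ) {f g : E} (hf : (f, g) ∈ A.graph) :
    r * ‖f‖ ≤ ‖g - (μ : ℂ) • f‖ := by
  have hmem : (μ : ℂ) ∈ resolventSetOf A := by
    by_contra hc
    have := hμ _ hc
    rw [dist_self] at this; linarith
  have hR := h.shift hmem
  set R := resolventOf A (μ : ℂ) with hRdef
  -- For a self-adjoint operator the norm is the spectral radius, and the nonzero points `ζ` of the
  -- spectrum of `R` come from the points `μ + ζ⁻¹` of the spectrum of `A`.
  have hnorm : ‖R‖ ≤ r⁻¹ := by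
    rw [← hR.isSelfAdjoint.toReal_spectralRadius_complex_eq_norm]
    refine ENNReal.toReal_le_of_le_ofReal (by positivity) ?_
    refine iSup₂_le fun ζ hζ => ?_
    rw [← ENNReal.ofReal_coe_nnreal, coe_nnnorm]
    refine ENNReal.ofReal_le_ofReal ?_
    rcases eq_or_ne ζ 0 with h0 | h0
    · rw [h0, norm_zero]; positivity
    · have := hμ _ (hR.isResolvent.mem_spectrum h0 hζ)
      rw [dist_eq_norm, add_sub_cancel_left, norm_inv] at this
      exact (le_inv_comm₀ hr (norm_pos_iff.2 h0)).1 this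
  have h1 := hR.isResolvent.mem_graph_iff.1 hf
  have h2 : ‖f‖ ≤ r⁻¹ * ‖g - (μ : ℂ) • f‖ := by
    nth_rewrite 1 [h1]
    exact (R.le_opNorm _).trans (by gcongr)
  rwa [← div_eq_inv_mul, le_div_iff₀ hr, mul_comm] at h2

/-- If `A - μ` is bounded below by `r`, then the points of distance less than `r` to `μ` lie in
the resolvent set. -/
theorem mem_of_le_norm (h : HasRealResolvent A z₀ T) {μ r : ℝ}
    (hμ : ∀ f g, (f, g) ∈ A.graph → r * ‖f‖ ≤ ‖g - (μ : ℂ) • f‖) (hz : dist z μ < r) :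
    z ∈ resolventSetOf A := by
  by_cases hzim : z.im ≠ 0
  · exact h.mem_of_im_ne_zero hzim
  rw [not_not] at hzim
  obtain ⟨ν, rfl⟩ : ∃ ν : ℝ, z = ν := ⟨z.re, Complex.ext (by simp) (by simp [hzim])⟩
  rw [h.isResolvent.mem_resolventSetOf_iff]
  set c : ℝ := r - dist (ν : ℂ) μ with hc
  have hcpos : 0 < c := by linarith
  -- `S` is `(A - ν) T`, a bounded self-adjoint operator. It is bounded below, hence injective with
  -- closed range, and by self-adjointness its range is also dense.
  set S := 1 - ((ν : ℂ) - z₀) • T with hS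
  have hsa : S.adjoint = S := by
    rw [hS, ← ContinuousLinearMap.star_eq_adjoint, star_sub, star_one, star_smul,
      h.isSelfAdjoint.star_eq]
    simp
  have hb1 : ∀ g, c * ‖T g‖ ≤ ‖S g‖ := fun g => by
    have h1 := hμ _ _ (h.isResolvent.1 g)
    have h2 : S g = (g + (z₀ : ℂ) • T g - (μ : ℂ) • T g) - ((ν : ℂ) - μ) • T g := by
      simp only [hS, sub_apply, one_apply_eq_self,
        smul_apply]
      module
    have h3 := norm_sub_norm_le (g + (z₀ : ℂ) • T g - (μ : ℂ) • T g) (((ν : ℂ) - μ) • T g)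
    rw [norm_smul, ← dist_eq_norm (ν : ℂ)] at h3
    rw [h2, hc]
    linarith
  -- Writing `g = S g + (ν - z₀) T g`, and using `‖T g‖ ≤ ‖S g‖ / c`, gives this constant.
  set K : ℝ := 1 + ‖(ν : ℂ) - z₀‖ / c with hK
  have hKpos : 0 < K := by positivity
  have hb2 : ∀ g, ‖g‖ ≤ K * ‖S g‖ := fun g => by
    have h1 : g = S g + ((ν : ℂ) - z₀) • T g := by
      simp [hS]
    have h2 : ‖T g‖ ≤ ‖S g‖ / c := by rw [le_div_iff₀ hcpos, mul_comm]; exact hb1 g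
    calc ‖g‖ ≤ ‖S g‖ + ‖(ν : ℂ) - z₀‖ * ‖T g‖ := by
          nth_rewrite 1 [h1]
          exact (norm_add_le _ _).trans (by rw [norm_smul])
      _ ≤ ‖S g‖ + ‖(ν : ℂ) - z₀‖ * (‖S g‖ / c) := by gcongr
      _ = _ := by rw [hK]; ring
  rw [ContinuousLinearMap.isUnit_iff_bijective,
    ContinuousLinearMap.bijective_iff_dense_range_and_antilipschitz]
  refine ⟨?_, ⟨K.toNNReal, S.antilipschitz_of_bound fun g => ?_⟩⟩
  · rw [Submodule.topologicalClosure_eq_top_iff, Submodule.eq_bot_iff]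
    intro x hx
    have h1 : S x = 0 := by
      refine ext_inner_right ℂ fun y => ?_
      rw [← hsa, ContinuousLinearMap.adjoint_inner_left, inner_zero_left]
      exact inner_eq_zero_symm.1 (hx _ ⟨y, rfl⟩)
    have h2 := hb2 x
    rw [h1, norm_zero, mul_zero] at h2
    exact norm_le_zero_iff.1 h2
  · rw [Real.coe_toNNReal _ hKpos.le]; exact hb2 g

end HasRealResolvent

end SelfAdjoint

/-! ### Reducing subspaces and spectral subspaces of intervals -/

section Reducing

variable {E : Type*} [NormedAddCommGroup E] [InnerProductSpace ℂ E]

/-- The subspace `W` is invariant under all non-real resolvents of `A`. -/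
def IsReducing (A : E →ₗ.[ℂ] E) (W : Submodule ℂ E) : Prop :=
  ∀ z : ℂ, z.im ≠ 0 → ∀ v ∈ W, resolventOf A z v ∈ W

/-- On `W`, the operator `A - μ` is bounded by `r`. -/
def UpperOn (A : E →ₗ.[ℂ] E) (μ r : ℝ) (W : Submodule ℂ E) : Prop :=
  ∀ f g, (f, g) ∈ A.graph → f ∈ W → ‖g - (μ : ℂ) • f‖ ≤ r * ‖f‖

/-- On the orthogonal complement of `W`, the operator `A - μ` is bounded below by `r`. -/
def LowerOff (A : E →ₗ.[ℂ] E) (μ r : ℝ) (W : Submodule ℂ E) : Prop :=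
  ∀ f g, (f, g) ∈ A.graph → f ∈ Wᗮ → r * ‖f‖ ≤ ‖g - (μ : ℂ) • f‖

theorem LowerOff.mono {A : E →ₗ.[ℂ] E} {μ r r' : ℝ} {W : Submodule ℂ E} (h : LowerOff A μ r W)
    (hr : r' ≤ r) : LowerOff A μ r' W :=
  fun f g hf hfW => (mul_le_mul_of_nonneg_right hr (norm_nonneg f)).trans (h f g hf hfW)

theorem isReducing_bot (A : E →ₗ.[ℂ] E) : IsReducing A ⊥ := by
  intro z _ v hv
  rw [Submodule.mem_bot] at hv ⊢
  rw [hv, map_zero]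

variable {A : E →ₗ.[ℂ] E} {z₀ : ℝ} {T : E →L[ℂ] E} {z : ℂ} {W : Submodule ℂ E}

theorem mem_of_commute_starProjection [W.HasOrthogonalProjection] {S : E →L[ℂ] E}
    (hS : Commute W.starProjection S) {v : E} (hv : v ∈ W) : S v ∈ W := by
  rw [← Submodule.starProjection_eq_self_iff] at hv ⊢
  have := DFunLike.congr_fun hS.eq v
  rw [mul_apply_eq_comp, mul_apply_eq_comp, hv] at this
  exact this

theorem mem_orthogonal_of_commute_starProjection [W.HasOrthogonalProjection] {S : E →L[ℂ] E}
    (hS : Commute W.starProjection S) {v : E} (hv : v ∈ Wᗮ) : S v ∈ Wᗮ := by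
  rw [← Submodule.starProjection_apply_eq_zero_iff] at hv ⊢
  have := DFunLike.congr_fun hS.eq v
  rw [mul_apply_eq_comp, mul_apply_eq_comp, hv, map_zero] at this
  exact this

theorem mem_eigenspaceOf {l : ℂ} {f : E} : f ∈ eigenspaceOf A l ↔ (f, l • f) ∈ A.graph := Iff.rfl

theorem mem_specOf_of_mem_eigenspaceOf {l : ℂ} {f : E} (hf : f ∈ eigenspaceOf A l) (h0 : f ≠ 0) :
    l ∈ specOf A := by
  rintro ⟨R, hR⟩
  have := hR.2 _ _ hf
  rw [sub_self, map_zero] at this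
  exact h0 this.symm

theorem IsReducing.iSup {κ : Sort*} {V : κ → Submodule ℂ E} (hV : ∀ i, IsReducing A (V i)) :
    IsReducing A (⨆ i, V i) := by
  intro z hz
  have : (⨆ i, V i) ≤ (⨆ i, V i).comap (resolventOf A z).toLinearMap :=
    iSup_le fun i v hv => Submodule.mem_iSup_of_mem i (hV i z hz v hv)
  exact fun v hv => this hv

theorem exists_lowerOff_bot_of_mem {μ : ℝ}
    (hμ : (μ : ℂ) ∈ resolventSetOf A) : ∃ r > 0, LowerOff A μ r ⊥ := by
  have hR := isResolvent_resolventOf hμ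
  refine ⟨(‖resolventOf A (μ : ℂ)‖ + 1)⁻¹, by positivity, fun f g hf _ => ?_⟩
  rw [← div_eq_inv_mul, div_le_iff₀ (by positivity)]
  nth_rewrite 1 [hR.mem_graph_iff.1 hf]
  refine ((resolventOf A (μ : ℂ)).le_opNorm _).trans ?_
  rw [mul_comm]; gcongr; linarith

theorem mem_specOf_of_mem_discSpecOf {x : ℂ} (hx : x ∈ discSpecOf A) : x ∈ specOf A := by
  obtain ⟨⟨r, -, h⟩, -⟩ := hx
  have : x ∈ specOf A ∩ Metric.ball x r := by rw [h]; rfl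
  exact this.1

variable [CompleteSpace E]

/-- A self-adjoint operator that leaves `W` invariant commutes with the projection to `W`. -/
theorem commute_starProjection_of_adjoint [W.HasOrthogonalProjection] {S : E →L[ℂ] E}
    (hS : ∀ v ∈ W, S v ∈ W) (hS' : ∀ v ∈ W, S.adjoint v ∈ W) : Commute W.starProjection S := by
  ext x
  rw [mul_apply_eq_comp, mul_apply_eq_comp]
  refine Submodule.eq_starProjection_of_mem_of_inner_eq_zero
    (hS _ (Submodule.starProjection_apply_mem _ _)) fun w hw => ?_
  rw [← map_sub, ← ContinuousLinearMap.adjoint_inner_right]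
  exact Submodule.starProjection_inner_eq_zero _ _ (hS' w hw)

theorem IsReducing.commute [W.HasOrthogonalProjection] (hW : IsReducing A W)
    (h : HasRealResolvent A z₀ T) (hz : z.im ≠ 0) :
    Commute W.starProjection (resolventOf A z) := by
  refine commute_starProjection_of_adjoint (hW z hz) ?_
  rw [h.adjoint_resolventOf' hz]
  exact hW _ (by simpa using hz)

theorem IsReducing.commute_real [W.HasOrthogonalProjection] (hW : IsReducing A W)
    (h : HasRealResolvent A z₀ T) : Commute W.starProjection T :=
  (h.isResolvent_of_im_ne_zero (z := Complex.I) (by simp)).commute h.isResolvent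
    (hW.commute h (by simp))

theorem HasRealResolvent.isReducing [W.HasOrthogonalProjection]
    (h : HasRealResolvent A z₀ T) (hW : ∀ v ∈ W, T v ∈ W) : IsReducing A W := by
  intro z hz v hv
  have hc : Commute W.starProjection T := commute_starProjection_of_adjoint hW (by
    rw [h.isSelfAdjoint.adjoint_eq]; exact hW)
  exact mem_of_commute_starProjection (h.isResolvent.commute (h.isResolvent_of_im_ne_zero hz) hc) hv

/-- The projection to `W` commutes with `T`, hence maps the graph of `A` to itself. This is how `A`
splits into parts on `W` and `Wᗮ`. -/
theorem IsReducing.starProjection_mem_graph [W.HasOrthogonalProjection] (hW : IsReducing A W)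
    (h : HasRealResolvent A z₀ T) {f g : E} (hf : (f, g) ∈ A.graph) :
    (W.starProjection f, W.starProjection g) ∈ A.graph := by
  rw [h.isResolvent.mem_graph_iff] at hf ⊢
  have h1 := DFunLike.congr_fun (hW.commute_real h).eq (g - (z₀ : ℂ) • f)
  rw [mul_apply_eq_comp, mul_apply_eq_comp, ← hf] at h1
  rw [map_sub, map_smul] at h1
  exact h1

theorem isReducing_eigenspaceOf (h : HasRealResolvent A z₀ T) (l : ℂ) :
    IsReducing A (eigenspaceOf A l) := by
  intro z hz v hv
  have hR := h.isResolvent_of_im_ne_zero hz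
  have h1 := hR.2 _ _ (mem_eigenspaceOf.1 hv)
  rw [← sub_smul, map_smul] at h1
  rcases eq_or_ne (l - z) 0 with h0 | h0
  · rw [h0, zero_smul] at h1
    rw [← h1, map_zero]; exact Submodule.zero_mem _
  · have h2 : resolventOf A z v = (l - z)⁻¹ • v := by
      nth_rewrite 2 [← h1]
      rw [smul_smul, inv_mul_cancel₀ h0, one_smul]
    rw [h2]; exact Submodule.smul_mem _ _ hv

/-- The spectral subspace of a closed interval. -/
theorem HasRealResolvent.exists_spectral_subspace (h : HasRealResolvent A z₀ T) (μ : ℝ) {r : ℝ}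
    (hr : 0 ≤ r) : ∃ W : Submodule ℂ E, IsClosed (W : Set E) ∧ IsReducing A W ∧
      UpperOn A μ r W ∧ LowerOff A μ r W := by
  set S : E →L[ℂ] E := 1 - ((μ - z₀ : ℝ) : ℂ) • T with hS
  -- Formally `S = (A - μ) T` and `G = ((A - μ)² - r²) T²`, so `⟪k, G k⟫` compares `‖(A - μ) f‖²`
  -- with `r² ‖f‖²` for `f = T k`. The kernel of the positive part of `G` is then the spectral
  -- subspace of `[μ - r, μ + r]`, obtained from continuous functional calculus alone.
  set G : E →L[ℂ] E := S * S - ((r ^ 2 : ℝ) : ℂ) • (T * T) with hG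
  have hTsa := h.isSelfAdjoint
  have hSsa : IsSelfAdjoint S := by
    rw [isSelfAdjoint_iff, hS, star_sub, star_one, star_smul, hTsa.star_eq]; simp
  have hGsa : IsSelfAdjoint G := by
    rw [isSelfAdjoint_iff, hG, star_sub, star_mul, star_smul, star_mul, hTsa.star_eq,
      hSsa.star_eq]; simp
  have hTS : Commute T S := (Commute.one_right T).sub_right ((Commute.refl T).smul_right _)
  have hTG : Commute T G :=
    (hTS.mul_right hTS).sub_right (((Commute.refl T).mul_right (Commute.refl T)).smul_right _)
  have hTp : Commute G⁺ T := hTG.symm.cfcₙ_real _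
  have hTn : Commute G⁻ T := hTG.symm.cfcₙ_real _
  have hpsa : IsSelfAdjoint (G⁺) := (CFC.posPart_nonneg G).isSelfAdjoint
  have hps : G⁺ - G⁻ = G := CFC.posPart_sub_negPart G hGsa
  have hquad : ∀ k, ‖S k‖ ^ 2 - r ^ 2 * ‖T k‖ ^ 2 = (⟪k, G k⟫_ℂ).re := by
    intro k
    have h1 : ⟪k, S (S k)⟫_ℂ = ((‖S k‖ ^ 2 : ℝ) : ℂ) := by
      rw [← ContinuousLinearMap.adjoint_inner_left, hSsa.adjoint_eq, inner_self_eq_norm_sq_to_K]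
      norm_cast
    have h2 : ⟪k, T (T k)⟫_ℂ = ((‖T k‖ ^ 2 : ℝ) : ℂ) := by
      rw [← ContinuousLinearMap.adjoint_inner_left, hTsa.adjoint_eq, inner_self_eq_norm_sq_to_K]
      norm_cast
    have h3 : ⟪k, G k⟫_ℂ = ((‖S k‖ ^ 2 - r ^ 2 * ‖T k‖ ^ 2 : ℝ) : ℂ) := by
      simp only [hG, sub_apply, mul_apply_eq_comp, smul_apply, inner_sub_right,
        inner_smul_right, h1, h2]
      push_cast; ring
    rw [h3, Complex.ofReal_re]
  have hgr : ∀ {f g}, (f, g) ∈ A.graph → f = T (g - (z₀ : ℂ) • f) ∧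
      g - (μ : ℂ) • f = S (g - (z₀ : ℂ) • f) := by
    intro f g hf
    have h1 := h.isResolvent.mem_graph_iff.1 hf
    refine ⟨h1, ?_⟩
    simp only [hS, sub_apply, one_apply_eq_self, smul_apply, ← h1]
    push_cast; module
  let W : Submodule ℂ E := LinearMap.ker (G⁺).toLinearMap
  have hWmem : ∀ {v}, v ∈ W ↔ G⁺ v = 0 := fun {v} => LinearMap.mem_ker
  have hWc : IsClosed (W : Set E) := (G⁺).isClosed_ker
  have : CompleteSpace W := hWc.completeSpace_coe
  refine ⟨W, hWc, h.isReducing fun v hv => ?_, fun f g hf hfW => ?_, fun f g hf hfW => ?_⟩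
  · rw [hWmem] at hv ⊢
    have := DFunLike.congr_fun hTp.eq v
    rw [mul_apply_eq_comp, mul_apply_eq_comp, hv, map_zero] at this
    exact this
  · obtain ⟨h1, h2⟩ := hgr hf
    set k := g - (z₀ : ℂ) • f
    have h3 : G⁺ k = 0 := by
      rw [hWmem, h1] at hfW
      have := DFunLike.congr_fun hTp.eq k
      rw [mul_apply_eq_comp, mul_apply_eq_comp, hfW] at this
      exact h.isResolvent.eq_zero this.symm
    have h4 : 0 ≤ (⟪k, G⁻ k⟫_ℂ).re := by
      have := (ContinuousLinearMap.nonneg_iff_isPositive _).1 (CFC.negPart_nonneg G)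
      exact this.re_inner_nonneg_right k
    have h5 := hquad k
    rw [show G k = G⁺ k - G⁻ k by rw [← sub_apply, hps], h3, zero_sub, inner_neg_right, Complex.neg_re] at h5
    rw [h2, h1]
    refine (sq_le_sq₀ (norm_nonneg _) (by positivity)).1 ?_
    rw [mul_pow]; linarith
  · obtain ⟨h1, h2⟩ := hgr hf
    set k := g - (z₀ : ℂ) • f
    -- Since `G⁺ G⁻ = 0`, the range of `G⁻` lies in `W`; thus `G⁻` vanishes on `Wᗮ`, and commutation
    -- with the injective `T` carries this over from `f = T k` to `k`.
    have h3 : G⁻ k = 0 := by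
      have h4 : G⁻ f = 0 := by
        refine ext_inner_right ℂ fun y => ?_
        have hnsa : IsSelfAdjoint (G⁻) := (CFC.negPart_nonneg G).isSelfAdjoint
        have h5 : G⁻ y ∈ W := by
          rw [hWmem]
          exact DFunLike.congr_fun (CFC.posPart_mul_negPart G) y
        rw [inner_zero_left, ← hnsa.adjoint_eq, ContinuousLinearMap.adjoint_inner_left]
        exact inner_eq_zero_symm.1 (hfW _ h5)
      rw [h1] at h4
      have := DFunLike.congr_fun hTn.eq k
      rw [mul_apply_eq_comp, mul_apply_eq_comp, h4] at this
      exact h.isResolvent.eq_zero this.symm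
    have h4 : 0 ≤ (⟪k, G⁺ k⟫_ℂ).re := by
      have := (ContinuousLinearMap.nonneg_iff_isPositive _).1 (CFC.posPart_nonneg G)
      exact this.re_inner_nonneg_right k
    have h5 := hquad k
    rw [show G k = G⁺ k - G⁻ k by rw [← sub_apply, hps], h3, sub_zero] at h5
    rw [h2, h1]
    refine (sq_le_sq₀ (by positivity) (norm_nonneg _)).1 ?_
    rw [mul_pow]; linarith

theorem HasRealResolvent.mem_of_lowerOff_bot (h : HasRealResolvent A z₀ T) {μ r : ℝ}
    (hl : LowerOff A μ r ⊥) (hz : dist z μ < r) : z ∈ resolventSetOf A :=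
  h.mem_of_le_norm (fun f g hf => hl f g hf (by simp)) hz

/-- The complement of the eigenspace of an isolated point of the spectrum. -/
theorem HasRealResolvent.exists_lowerOff_eigenspaceOf (h : HasRealResolvent A z₀ T) {μ ε : ℝ}
    (hε : 0 < ε) (hμ : specOf A ∩ Metric.ball (μ : ℂ) ε = {(μ : ℂ)}) :
    ∃ r > 0, LowerOff A μ r (eigenspaceOf A μ) := by
  set S : E →L[ℂ] E := 1 - ((μ - z₀ : ℝ) : ℂ) • T with hS
  have hTsa := h.isSelfAdjoint
  have hSsa : IsSelfAdjoint S := by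
    rw [isSelfAdjoint_iff, hS, star_sub, star_one, star_smul, hTsa.star_eq]; simp
  have hTS : Commute T S := (Commute.one_right T).sub_right ((Commute.refl T).smul_right _)
  have hμz : μ - z₀ ≠ 0 := by
    intro h0
    have h1 : (μ : ℂ) ∈ specOf A ∩ Metric.ball (μ : ℂ) ε := by rw [hμ]; rfl
    rw [sub_eq_zero.1 h0] at h1
    exact h1.1 h.isResolvent.mem
  -- The point `s` of the spectrum of `S = 1 - (μ - z₀) T` corresponds to `z₀ + (μ - z₀) / (1 - s)`
  -- in the spectrum of `A`, with `s = 0` matching `μ`. Isolation of `μ` thus makes 0 isolated in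
  -- the spectrum of `S`; `d ≤ 1` keeps away from the pole.
  have hiso : ∃ d > 0, ∀ s ∈ spectrum ℝ S, |s| < d → s = 0 := by
    have hcont : ContinuousAt (fun s : ℝ => z₀ + (μ - z₀) / (1 - s)) 0 := by
      fun_prop (disch := norm_num)
    obtain ⟨d, hd, hd'⟩ := Metric.continuousAt_iff.1 hcont ε hε
    refine ⟨min d 1, lt_min hd one_pos, fun s hs hsd => ?_⟩
    have hs1 : |s| < 1 := hsd.trans_le (min_le_right _ _)
    have hs1' : 1 - s ≠ 0 := by have := (abs_lt.1 hs1).2; linarith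
    have h1 := @hd' s (by rw [Real.dist_eq, sub_zero]; exact hsd.trans_le (min_le_left _ _))
    have h2 : ((z₀ + (μ - z₀) / (1 - s) : ℝ) : ℂ) ∈ specOf A := by
      intro hmem
      rw [h.isResolvent.mem_resolventSetOf_iff] at hmem
      refine hs ?_
      rw [spectrum.mem_resolventSet_iff]
      have : algebraMap ℝ (E →L[ℂ] E) s - S =
          (-(1 - s : ℝ) : ℂ) • (1 - (((z₀ + (μ - z₀) / (1 - s) : ℝ) : ℂ) - z₀) • T) := by
        rw [smul_sub, smul_smul, hS, Algebra.algebraMap_eq_smul_one, ← Complex.coe_smul]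
        have h3 : (-(1 - s : ℝ) : ℂ) * (((z₀ + (μ - z₀) / (1 - s) : ℝ) : ℂ) - z₀)
            = -((μ - z₀ : ℝ) : ℂ) := by
          rw [← Complex.ofReal_sub, ← Complex.ofReal_neg, ← Complex.ofReal_mul,
            ← Complex.ofReal_neg]
          congr 1; field_simp; ring
        rw [h3]; push_cast; module
      rw [this]
      have h4 : (-(1 - s : ℝ) : ℂ) ≠ 0 := by
        rw [← Complex.ofReal_neg, Complex.ofReal_ne_zero]; exact neg_ne_zero.2 hs1'
      exact hmem.smul (Units.mk0 _ h4)
    have h3 : ((z₀ + (μ - z₀) / (1 - s) : ℝ) : ℂ) ∈ specOf A ∩ Metric.ball (μ : ℂ) ε := by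
      refine ⟨h2, ?_⟩
      rw [Metric.mem_ball, Complex.dist_eq, ← Complex.ofReal_sub, Complex.norm_real,
        ← dist_eq_norm]
      simpa using h1
    rw [hμ, Set.mem_singleton_iff, Complex.ofReal_inj] at h3
    have h4 : (μ - z₀) / (1 - s) = μ - z₀ := by linarith
    rw [div_eq_iff hs1'] at h4
    have h5 : (μ - z₀) * s = 0 := by linarith
    exact (mul_eq_zero.1 h5).resolve_left hμz
  obtain ⟨d, hd, hd'⟩ := hiso
  -- The convention `0⁻¹ = 0` causes no discontinuity here, since 0 is isolated in the spectrum. The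
  -- resulting `V` is the bounded pseudo-inverse of `S`: `V S` is the projection along `ker S`, the
  -- eigenspace.
  have hinv : ContinuousOn (fun s : ℝ => s⁻¹) (spectrum ℝ S) := by
    intro s hs
    rcases eq_or_ne s 0 with h0 | h0
    · rw [Metric.continuousWithinAt_iff]
      intro η hη
      refine ⟨d, hd, fun y hy hyd => ?_⟩
      rw [h0, Real.dist_eq, sub_zero] at hyd
      rw [hd' y hy hyd, h0, dist_self]; exact hη
    · exact (continuousAt_inv₀ h0).continuousWithinAt
  set V : E →L[ℂ] E := cfc (fun s : ℝ => s⁻¹) S with hV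
  have hTV : Commute V T := hTS.symm.cfc_real _
  have hSV : Commute V S := (Commute.refl S).cfc_real _
  have hVsa : IsSelfAdjoint V := cfc_predicate _ _
  have hSVS : S * V * S = S := by
    have hid : S = cfc (fun s : ℝ => s) S := (cfc_id' ℝ S).symm
    have h1 : S * V = cfc (fun s : ℝ => s * s⁻¹) S := by
      rw [cfc_mul (fun s : ℝ => s) _ S continuousOn_id hinv, ← hid]
    have h2 : S * V * S = cfc (fun s : ℝ => s * s⁻¹ * s) S := by
      rw [cfc_mul (fun s : ℝ => s * s⁻¹) (fun s => s) S (continuousOn_id.mul hinv)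
        continuousOn_id, ← hid, h1]
    refine h2.trans (Eq.trans (cfc_congr fun s _ => ?_) hid.symm)
    simp
  have heig : ∀ {f}, f ∈ eigenspaceOf A (μ : ℂ) ↔ S f = 0 := by
    intro f
    rw [mem_eigenspaceOf, h.isResolvent.mem_graph_iff, ← sub_smul, map_smul, hS, sub_apply,
      one_apply_eq_self, smul_apply, Complex.ofReal_sub, sub_eq_zero]
  refine ⟨(‖T‖ * ‖V‖ + 1)⁻¹, by positivity, fun f g hf hfW => ?_⟩
  have h1 := h.isResolvent.mem_graph_iff.1 hf
  set k := g - (z₀ : ℂ) • f with hk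
  have h2 : g - (μ : ℂ) • f = S k := by
    rw [hS, sub_apply, one_apply_eq_self, smul_apply, ← h1, hk]
    push_cast; module
  have hp : ∀ y, y - V (S y) ∈ eigenspaceOf A (μ : ℂ) := fun y => by
    rw [heig, map_sub, sub_eq_zero]
    exact (DFunLike.congr_fun hSVS y).symm
  have h3 : f - V (S f) = 0 := by
    have h4 := hfW _ (hp f)
    have h5 : ⟪f - V (S f), V (S f)⟫_ℂ = 0 := by
      have h6 : V (S f) = S (V f) := DFunLike.congr_fun hSV.eq f
      nth_rewrite 2 [h6]
      rw [← ContinuousLinearMap.adjoint_inner_left, hSsa.adjoint_eq, heig.1 (hp f),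
        inner_zero_left]
    refine (inner_self_eq_zero (𝕜 := ℂ)).1 ?_
    rw [inner_sub_right, h4, h5, sub_zero]
  have h4 : k = V (S k) := by
    have h5 : T (k - V (S k)) = 0 := by
      rw [map_sub, ← h1]
      have h6 := DFunLike.congr_fun hTV.eq (S k)
      have h7 := DFunLike.congr_fun hTS.eq k
      simp only [mul_apply_eq_comp] at h6 h7
      rw [← h6, h7, ← h1]; exact h3
    exact sub_eq_zero.1 (h.isResolvent.eq_zero h5)
  rw [← div_eq_inv_mul, div_le_iff₀ (by positivity), h2]
  calc ‖f‖ ≤ ‖T‖ * ‖k‖ := by nth_rewrite 1 [h1]; exact T.le_opNorm _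
    _ ≤ ‖T‖ * (‖V‖ * ‖S k‖) := by
      gcongr; nth_rewrite 1 [h4]; exact V.le_opNorm _
    _ ≤ _ := by nlinarith [norm_nonneg (S k)]

end Reducing

/-! ### Spectrum in a ball with finite-dimensional spectral subspace -/

section FiniteMultiplicity

variable {E : Type*} [NormedAddCommGroup E] [InnerProductSpace ℂ E] [CompleteSpace E]
  {A : E →ₗ.[ℂ] E} {z₀ : ℝ} {T : E →L[ℂ] E} {z : ℂ} {W : Submodule ℂ E}

/-- The dimension of a sum of finitely many eigenspaces. -/
theorem HasRealResolvent.finrank_iSup_eigenspaceOf (h : HasRealResolvent A z₀ T) (s : Finset ℂ)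
    (hs : ∀ x ∈ s, x.im = 0) (hfin : ∀ x ∈ s, FiniteDimensional ℂ (eigenspaceOf A x)) :
    Module.finrank ℂ (⨆ x : s, eigenspaceOf A (x : ℂ) : Submodule ℂ E) = ∑ x ∈ s, multOf A x := by
  classical
  have hort : OrthogonalFamily ℂ (fun x : s => eigenspaceOf A (x : ℂ))
      fun x => (eigenspaceOf A (x : ℂ)).subtypeₗᵢ := by
    intro x y hxy v w
    have h1 := h.inner_comm (mem_eigenspaceOf.1 v.2) (mem_eigenspaceOf.1 w.2)
    rw [inner_smul_left, inner_smul_right, Complex.conj_eq_iff_im.2 (hs x x.2)] at h1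
    have h2 : ((x : ℂ) - y) * ⟪(v : E), (w : E)⟫_ℂ = 0 := by rw [sub_mul, h1, sub_self]
    exact (mul_eq_zero.1 h2).resolve_left
      (sub_ne_zero.2 fun h3 => hxy (Subtype.ext h3))
  have : ∀ x : s, FiniteDimensional ℂ (eigenspaceOf A (x : ℂ)) := fun x => hfin x x.2
  have hind := hort.independent
  have hinj := hind.dfinsupp_lsum_injective
  rw [Submodule.iSup_eq_range_dfinsupp_lsum,
    LinearMap.finrank_range_of_inj hinj]
  have := Module.finrank_directSum (R := ℂ) (fun x : s => eigenspaceOf A (x : ℂ))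
  refine Eq.trans this ?_
  rw [← Finset.sum_coe_sort s]
  rfl

/-- If the spectral subspace of a neighbourhood is finite-dimensional, the spectrum in this
neighbourhood consists of finitely many discrete eigenvalues. -/
theorem HasRealResolvent.exists_finset_specOf (h : HasRealResolvent A z₀ T)
    [FiniteDimensional ℂ W] {μ r : ℝ} (hW : IsReducing A W)
    (hlow : LowerOff A μ r W) :
    ∃ s : Finset ℂ, (s : Set ℂ) = specOf A ∩ Metric.ball (μ : ℂ) r ∧ (∀ x ∈ s, x ∈ discSpecOf A) ∧
      ∃ X : Submodule ℂ E, X ≤ W ∧ IsReducing A X ∧ LowerOff A μ r X ∧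
        X = ⨆ x : s, eigenspaceOf A (x : ℂ) ∧
        Module.finrank ℂ X = ∑ x ∈ s, multOf A x := by
  classical
  have hTW : ∀ v ∈ W, T v ∈ W := fun v hv =>
    mem_of_commute_starProjection (hW.commute_real h) hv
  have hTsym : (T : E →ₗ[ℂ] E).IsSymmetric := h.isSelfAdjoint.isSymmetric
  have hsym : ((T : E →ₗ[ℂ] E).restrict hTW).IsSymmetric := hTsym.restrict_invariant hTW
  -- `T` preserves the finite-dimensional `W` and is diagonalised there; its eigenvalues `t j` are
  -- nonzero because `T` is injective, so `b j` is an eigenvector of `A` for `z₀ + (t j)⁻¹`.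
  let b := hsym.eigenvectorBasis rfl
  let t := hsym.eigenvalues rfl
  have hb : ∀ j, T (b j : E) = (t j : ℂ) • (b j : E) := fun j =>
    congrArg Subtype.val (hsym.apply_eigenvectorBasis rfl j)
  have hb0 : ∀ j, (b j : E) ≠ 0 := fun j hj => by
    have := b.orthonormal.ne_zero j
    exact this (Subtype.ext hj)
  have ht0 : ∀ j, (t j : ℂ) ≠ 0 := fun j hj => by
    have h1 := hb j
    rw [hj, zero_smul] at h1
    exact hb0 j (h.isResolvent.eq_zero h1)
  let ν : Fin (Module.finrank ℂ W) → ℝ := fun j => z₀ + (t j)⁻¹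
  have hν : ∀ j, (b j : E) ∈ eigenspaceOf A (ν j : ℂ) := fun j => by
    rw [mem_eigenspaceOf, h.isResolvent.mem_graph_iff, ← sub_smul, map_smul, hb, smul_smul]
    have : ((ν j : ℂ) - z₀) * t j = 1 := by
      simp only [ν]; push_cast
      rw [add_sub_cancel_left, inv_mul_cancel₀ (ht0 j)]
    rw [this, one_smul]
  -- A lower bound `c` for `A - x` on suitable vectors, from two orthogonal parts: off `W` the bound
  -- `r` at `μ` loses at most `|x - μ|`, and on `W` the coordinates are multiplied by `ν j - x`. It
  -- serves to exclude spectrum at `x` and, with `x = μ`, to bound `A - μ` below off the sum of the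
  -- eigenspaces.
  have key : ∀ (x c : ℝ), 0 ≤ c → c + |x - μ| ≤ r → ∀ f g, (f, g) ∈ A.graph →
      (∀ j, ⟪(b j : E), f⟫_ℂ = 0 ∨ c ≤ |ν j - x|) → c * ‖f‖ ≤ ‖g - (x : ℂ) • f‖ := by
    intro x c hc hcr f g hf hj
    have hP := hW.starProjection_mem_graph h hf
    have hQ : (f - W.starProjection f, g - W.starProjection g) ∈ A.graph := A.graph.sub_mem hf hP
    have h1 : c * ‖f - W.starProjection f‖ ≤
        ‖g - W.starProjection g - (x : ℂ) • (f - W.starProjection f)‖ := by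
      have h2 := hlow _ _ hQ (Submodule.sub_starProjection_mem_orthogonal f)
      set f' := f - W.starProjection f
      set g' := g - W.starProjection g
      have h3 : g' - (μ : ℂ) • f' = (g' - (x : ℂ) • f') + ((x - μ : ℝ) : ℂ) • f' := by
        push_cast; module
      have h4 : ‖g' - (μ : ℂ) • f'‖ ≤ ‖g' - (x : ℂ) • f'‖ + |x - μ| * ‖f'‖ := by
        rw [h3]
        refine (norm_add_le _ _).trans ?_
        rw [norm_smul, Complex.norm_real, Real.norm_eq_abs]
      nlinarith [norm_nonneg f']
    have hnsq : ∀ y, ‖W.starProjection y‖ ^ 2 = ∑ j, ‖⟪(b j : E), y⟫_ℂ‖ ^ 2 := by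
      intro y
      have h2 := b.sum_sq_norm_inner_right (W.orthogonalProjectionOnto y)
      rw [Submodule.starProjection_apply, ← Submodule.coe_norm, ← h2]
      refine Finset.sum_congr rfl fun j _ => ?_
      rw [Submodule.inner_orthogonalProjectionOnto_eq_of_mem_left]
    have h2 : c * ‖W.starProjection f‖ ≤ ‖W.starProjection (g - (x : ℂ) • f)‖ := by
      refine (sq_le_sq₀ (by positivity) (norm_nonneg _)).1 ?_
      rw [mul_pow, hnsq, hnsq, Finset.mul_sum]
      refine Finset.sum_le_sum fun j _ => ?_
      have h3 := h.inner_comm (mem_eigenspaceOf.1 (hν j)) hf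
      rw [inner_smul_left, Complex.conj_ofReal] at h3
      have h4 : ⟪(b j : E), g - (x : ℂ) • f⟫_ℂ = ((ν j - x : ℝ) : ℂ) * ⟪(b j : E), f⟫_ℂ := by
        rw [inner_sub_right, inner_smul_right, ← h3]; push_cast; ring
      rw [h4, norm_mul, mul_pow, Complex.norm_real, Real.norm_eq_abs]
      rcases hj j with h5 | h5
      · simp [h5]
      · gcongr
    refine (sq_le_sq₀ (by positivity) (norm_nonneg _)).1 ?_
    have hsplit : ∀ y, ‖y‖ ^ 2 = ‖W.starProjection y‖ ^ 2 + ‖y - W.starProjection y‖ ^ 2 := by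
      intro y
      have := norm_add_sq_eq_norm_sq_add_norm_sq_of_inner_eq_zero (𝕜 := ℂ)
        (W.starProjection y) (y - W.starProjection y)
        (Submodule.sub_starProjection_mem_orthogonal y _ (Submodule.starProjection_apply_mem _ _))
      rw [add_sub_cancel] at this
      linarith
    rw [mul_pow, hsplit f, hsplit (g - (x : ℂ) • f)]
    have h6 : g - (x : ℂ) • f - W.starProjection (g - (x : ℂ) • f)
        = g - W.starProjection g - (x : ℂ) • (f - W.starProjection f) := by
      rw [map_sub, map_smul, smul_sub]; abel
    rw [h6, mul_add, ← mul_pow, ← mul_pow]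
    gcongr
  let s : Finset ℂ := (Finset.univ.image fun j => (ν j : ℂ)).filter (dist · (μ : ℂ) < r)
  have hs : ∀ x, x ∈ s ↔ (∃ j, (ν j : ℂ) = x) ∧ dist x μ < r := fun x => by simp [s]
  have hspec : (s : Set ℂ) = specOf A ∩ Metric.ball (μ : ℂ) r := by
    ext x
    rw [Finset.mem_coe, hs, Set.mem_inter_iff, Metric.mem_ball]
    refine and_congr_left fun hx => ⟨?_, fun hxs => ?_⟩
    · rintro ⟨j, rfl⟩
      exact mem_specOf_of_mem_eigenspaceOf (hν j) (hb0 j)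
    · by_contra hne
      push Not at hne
      obtain ⟨y, rfl⟩ : ∃ y : ℝ, x = y :=
        ⟨x.re, Complex.ext (by simp) (by simp [h.im_eq_zero hxs])⟩
      have h1 : y ∈ (Set.range ν)ᶜ := by
        rintro ⟨j, hj⟩
        exact hne j (by rw [hj])
      obtain ⟨ε, hε, hεs⟩ := Metric.isOpen_iff.1 (Set.finite_range ν).isClosed.isOpen_compl y h1
      rw [Complex.dist_eq, ← Complex.ofReal_sub, Complex.norm_real, Real.norm_eq_abs] at hx
      have hc : 0 < min ε (r - |y - μ|) := lt_min hε (by linarith)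
      refine hxs (h.mem_of_le_norm (μ := y) (fun f g hf => key y (min ε (r - |y - μ|)) hc.le ?_ f g
        hf fun j => Or.inr ?_) (by rwa [dist_self]))
      · have := min_le_right ε (r - |y - μ|)
        linarith
      · refine (min_le_left _ _).trans ?_
        by_contra hlt
        push Not at hlt
        exact hεs (show ν j ∈ Metric.ball y ε by rwa [Metric.mem_ball, Real.dist_eq]) ⟨j, rfl⟩
  have hsim : ∀ x ∈ s, x.im = 0 := fun x hx => by
    obtain ⟨⟨j, rfl⟩, -⟩ := (hs x).1 hx
    simp
  -- The component off `W` of an eigenvector is an eigenvector with eigenvalue closer to `μ` than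
  -- `r`, which the lower bound off `W` forbids unless it vanishes.
  have hsW : ∀ x ∈ s, eigenspaceOf A x ≤ W := by
    intro x hx v hv
    obtain ⟨⟨j, rfl⟩, hxr⟩ := (hs x).1 hx
    have h1 := hW.starProjection_mem_graph h (mem_eigenspaceOf.1 hv)
    have h2 := A.graph.sub_mem (mem_eigenspaceOf.1 hv) h1
    have h3 := hlow _ _ h2 (Submodule.sub_starProjection_mem_orthogonal v)
    rw [map_smul, ← smul_sub, ← sub_smul, norm_smul, ← Complex.dist_eq] at h3
    by_contra hvW
    have h4 : 0 < ‖v - W.starProjection v‖ := by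
      rw [norm_pos_iff, sub_ne_zero]
      exact fun h5 => hvW (Submodule.starProjection_eq_self_iff.1 h5.symm)
    exact absurd (le_of_mul_le_mul_right h3 h4) (not_le.2 hxr)
  have hfd : ∀ x ∈ s, FiniteDimensional ℂ (eigenspaceOf A x) := fun x hx =>
    Submodule.finiteDimensional_of_le (hsW x hx)
  refine ⟨s, hspec, fun x hx => ⟨?_, hfd x hx⟩, ⨆ x : s, eigenspaceOf A (x : ℂ),
    iSup_le fun x => hsW x x.2, IsReducing.iSup fun x => isReducing_eigenspaceOf h x, ?_, rfl,
    h.finrank_iSup_eigenspaceOf s hsim hfd⟩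
  · have h1 : x ∈ ((s.erase x : Finset ℂ) : Set ℂ)ᶜ ∩ Metric.ball (μ : ℂ) r := by
      refine ⟨by simp, ((hs x).1 hx).2⟩
    obtain ⟨ε, hε, hεs⟩ := Metric.isOpen_iff.1
      ((s.erase x).finite_toSet.isClosed.isOpen_compl.inter Metric.isOpen_ball) x h1
    refine ⟨ε, hε, ?_⟩
    ext y
    rw [Set.mem_inter_iff, Set.mem_singleton_iff]
    constructor
    · rintro ⟨hy, hyb⟩
      have h2 := hεs hyb
      have h3 : y ∈ s := by
        rw [← Finset.mem_coe, hspec]; exact ⟨hy, h2.2⟩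
      by_contra hne
      exact h2.1 (by simp [hne, h3])
    · rintro rfl
      refine ⟨?_, Metric.mem_ball_self hε⟩
      rw [← Finset.mem_coe, hspec] at hx
      exact hx.1
  · intro f g hf hfX
    rcases le_or_gt r 0 with hr | hr
    · exact (mul_nonpos_of_nonpos_of_nonneg hr (norm_nonneg f)).trans (norm_nonneg _)
    refine key μ r hr.le (by simp) f g hf fun j => ?_
    by_cases hj : |ν j - μ| < r
    · left
      refine hfX _ (Submodule.mem_iSup_of_mem (⟨(ν j : ℂ), (hs _).2 ⟨⟨j, rfl⟩, ?_⟩⟩ : s) (hν j))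
      rwa [Complex.dist_eq, ← Complex.ofReal_sub, Complex.norm_real, Real.norm_eq_abs]
    · exact Or.inr (not_lt.1 hj)

end FiniteMultiplicity

/-! ### Comparison of spectral subspaces of two operators -/

section Comparison

variable {E : Type u} [NormedAddCommGroup E] [InnerProductSpace ℂ E] [CompleteSpace E]
  {F : Type v} [NormedAddCommGroup F] [InnerProductSpace ℂ F] [CompleteSpace F]
  {A : E →ₗ.[ℂ] E} {a₀ : ℝ} {S : E →L[ℂ] E} {B : F →ₗ.[ℂ] F} {b₀ : ℝ} {T : F →L[ℂ] F}
  {J : E →L[ℂ] F} {δ : ℝ}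

/-- The left side is the modulus of `⟪J† J x - x, x⟫`. This makes `J` nearly isometric wherever `J†
J` is nearly the identity, without reference to `‖J‖`. -/
theorem abs_norm_sq_sub_le (J : E →L[ℂ] F) (x : E) :
    |‖J x‖ ^ 2 - ‖x‖ ^ 2| ≤ ‖J.adjoint (J x) - x‖ * ‖x‖ := by
  have h1 : ⟪J.adjoint (J x) - x, x⟫_ℂ = ((‖J x‖ ^ 2 - ‖x‖ ^ 2 : ℝ) : ℂ) := by
    rw [inner_sub_left, ContinuousLinearMap.adjoint_inner_left, inner_self_eq_norm_sq_to_K,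
      inner_self_eq_norm_sq_to_K]
    push_cast; rfl
  have h2 := norm_inner_le_norm (𝕜 := ℂ) (J.adjoint (J x) - x) x
  rwa [h1, Complex.norm_real, Real.norm_eq_abs] at h2

theorem OperatorQUE.nonneg (hQ : OperatorQUE δ J A B) : 0 ≤ δ :=
  (norm_nonneg _).trans (hQ Complex.I (Or.inl rfl)).1

/-- The commutator estimate for `J†` at `z` is the adjoint of that for `J` at `conj z`, which is why
both resolvent points are in the definition. -/
theorem OperatorQUE.symm (hA : HasRealResolvent A a₀ S) (hB : HasRealResolvent B b₀ T)
    (hQ : OperatorQUE δ J A B) : OperatorQUE δ J.adjoint B A := by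
  intro z hz
  obtain ⟨h1, h2, -⟩ := hQ z hz
  have hzim : z.im ≠ 0 := by rcases hz with rfl | rfl <;> simp
  obtain ⟨-, -, h3⟩ := hQ (conj z) (by rcases hz with rfl | rfl <;> simp)
  rw [ContinuousLinearMap.adjoint_adjoint]
  refine ⟨h2, h1, ?_⟩
  rw [← LinearIsometryEquiv.norm_map ContinuousLinearMap.adjoint, map_sub,
    ContinuousLinearMap.adjoint_comp, ContinuousLinearMap.adjoint_comp,
    ContinuousLinearMap.adjoint_adjoint, hA.adjoint_resolventOf' hzim, hB.adjoint_resolventOf' hzim,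
    norm_sub_rev]
  exact h3

theorem OperatorQUE.norm_adjoint_sub_le (hQ : OperatorQUE δ J A B) (g : E) :
    ‖J.adjoint (J (resolventOf A Complex.I g)) - resolventOf A Complex.I g‖ ≤ δ * ‖g‖ := by
  have := ((ContinuousLinearMap.id ℂ E - J.adjoint ∘L J) ∘L resolventOf A Complex.I).le_of_opNorm_le
    (hQ Complex.I (Or.inl rfl)).1 g
  rw [norm_sub_rev]
  exact this

theorem OperatorQUE.norm_comm_le (hQ : OperatorQUE δ J A B) (g : E) :
    ‖J (resolventOf A Complex.I g) - resolventOf B Complex.I (J g)‖ ≤ δ * ‖g‖ :=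
  (J ∘L resolventOf A Complex.I - resolventOf B Complex.I ∘L J).le_of_opNorm_le
    (hQ Complex.I (Or.inl rfl)).2.2 g

theorem norm_I_sub_ofReal_le (μ : ℝ) : ‖Complex.I - μ‖ ≤ 1 + |μ| := by
  refine (norm_sub_le _ _).trans ?_
  rw [Complex.norm_I, Complex.norm_real, Real.norm_eq_abs]

/-- Comparison of the dimensions of spectral subspaces of quasi-unitarily equivalent operators. -/
theorem OperatorQUE.finrank_le (hA : HasRealResolvent A a₀ S) (hB : HasRealResolvent B b₀ T)
    (hQ : OperatorQUE δ J A B) {μ Λ r r' : ℝ} (hΛ : |μ| ≤ Λ) (hr' : 0 ≤ r') (hr : r' < r)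
    (hδ : δ * ((r' + Λ + 1) * (2 * r + r' + Λ + 1)) < r - r')
    {V : Submodule ℂ E} (hV : IsReducing A V) (hVu : UpperOn A μ r' V)
    {W : Submodule ℂ F} [FiniteDimensional ℂ W] (hW : IsReducing B W) (hWl : LowerOff B μ r W) :
    FiniteDimensional ℂ V ∧ Module.finrank ℂ V ≤ Module.finrank ℂ W := by
  have hδ0 := hQ.nonneg
  have hΛ0 : 0 ≤ Λ := (abs_nonneg _).trans hΛ
  set R := resolventOf A Complex.I with hR
  set R' := resolventOf B Complex.I with hR'
  have hRes : IsResolvent A Complex.I R := hA.isResolvent_of_im_ne_zero (by simp)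
  have hRes' : IsResolvent B Complex.I R' := hB.isResolvent_of_im_ne_zero (by simp)
  have hRV : ∀ v ∈ V, R v ∈ V := hV Complex.I (by simp)
  set c := r' + Λ + 1 with hc
  have hc0 : 0 < c := by positivity
  have hIμ : ‖Complex.I - μ‖ ≤ 1 + Λ := (norm_I_sub_ofReal_le μ).trans (by linarith)
  have hAμ : ∀ v ∈ V, ‖v + (Complex.I - μ) • R v‖ ≤ r' * ‖R v‖ := fun v hv => by
    have := hVu _ _ (hRes.1 v) (hRV v hv)
    rwa [add_sub_assoc, ← sub_smul] at this
  -- On `V` the operator `A - i` is bounded by `r' + |i - μ| ≤ c`. This turns errors measured by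
  -- `‖v‖` into errors measured by `‖R v‖`.
  have hcV : ∀ v ∈ V, ‖v‖ ≤ c * ‖R v‖ := fun v hv => by
    have h1 : v = (v + (Complex.I - μ) • R v) - (Complex.I - μ) • R v := by abel
    have h2 : ‖v‖ ≤ ‖v + (Complex.I - μ) • R v‖ + ‖(Complex.I - μ) • R v‖ := by
      nth_rewrite 1 [h1]; exact norm_sub_le _ _
    rw [norm_smul] at h2
    have h3 := hAμ v hv
    have h4 : ‖Complex.I - (μ : ℂ)‖ * ‖R v‖ ≤ (1 + Λ) * ‖R v‖ := by gcongr
    rw [hc]; linarith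
  have hδc : δ * c ≤ 1 := by
    have h1 : δ * c * (2 * r + r' + Λ + 1) < r - r' := by rw [mul_assoc]; exact hδ
    by_contra h2
    push Not at h2
    nlinarith
  have hJ : ∀ y ∈ V, (1 - δ * c) * ‖R y‖ ≤ ‖J (R y)‖ ∧ ‖J (R y)‖ ≤ (1 + δ * c) * ‖R y‖ := by
    intro y hy
    have h1 := abs_norm_sq_sub_le J (R y)
    have h2 := hQ.norm_adjoint_sub_le y
    have h3 : ‖J.adjoint (J (R y)) - R y‖ * ‖R y‖ ≤ δ * c * ‖R y‖ ^ 2 := by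
      have h4 : δ * ‖y‖ ≤ δ * (c * ‖R y‖) := mul_le_mul_of_nonneg_left (hcV y hy) hδ0
      calc _ ≤ (δ * (c * ‖R y‖)) * ‖R y‖ := by gcongr; exact h2.trans h4
        _ = _ := by ring
    have h5 := abs_le.1 (h1.trans h3)
    have hdc0 : 0 ≤ δ * c := by positivity
    constructor
    · refine (sq_le_sq₀ (mul_nonneg (by linarith) (norm_nonneg _)) (norm_nonneg _)).1 ?_
      rw [mul_pow]
      have : (1 - δ * c) ^ 2 ≤ 1 - δ * c := by nlinarith
      nlinarith [sq_nonneg ‖R y‖]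
    · refine (sq_le_sq₀ (norm_nonneg _) (by positivity)).1 ?_
      rw [mul_pow]
      have : 1 + δ * c ≤ (1 + δ * c) ^ 2 := by nlinarith
      nlinarith [sq_nonneg ‖R y‖]
  -- The factor `R²` is needed because the near-isometry of `J` is known only on `R V`, and it is
  -- applied both to `R v` and to `(A - μ) R v` with `v = R² a`; the latter lies in `R V` only if
  -- `v` does.
  let Φ : V →ₗ[ℂ] W :=
    (W.orthogonalProjectionOnto ∘L J ∘L R ∘L R).toLinearMap ∘ₗ V.subtype
  have hΦ : Function.Injective Φ := by
    rw [← LinearMap.ker_eq_bot, LinearMap.ker_eq_bot']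
    intro a ha
    have haV : (a : E) ∈ V := a.2
    set v := R (R (a : E)) with hv
    -- If `Φ a = 0`, then `J v` is in `Wᗮ`, so `(B - μ) R' J v` has norm at least `r ‖R' J v‖`. But
    -- `R' J v` is close to `J R v`, and `(B - μ) R' J v` to `J (A - μ) R v`, of norm about `r' ‖R
    -- v‖` at most. Collecting the errors gives exactly the quantity in `hδ`.
    have hvV : v ∈ V := hRV _ (hRV _ haV)
    have h1 : J v ∈ Wᗮ := by
      rw [← Submodule.starProjection_apply_eq_zero_iff, Submodule.starProjection_apply]
      exact congrArg Subtype.val ha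
    have h2 : R' (J v) ∈ Wᗮ :=
      mem_orthogonal_of_commute_starProjection (hW.commute hB (by simp)) h1
    have h3 := hWl _ _ (hRes'.1 (J v)) h2
    rw [add_sub_assoc, ← sub_smul] at h3
    have h4 := hQ.norm_comm_le v
    have h5 : J v + (Complex.I - μ) • R' (J v) =
        J (v + (Complex.I - μ) • R v) - (Complex.I - μ) • (J (R v) - R' (J v)) := by
      rw [map_add, map_smul]; module
    set y := R (a : E) + (Complex.I - μ) • R (R (a : E)) with hy
    have hyV : y ∈ V := V.add_mem (hRV _ haV) (V.smul_mem _ hvV)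
    have h6 : v + (Complex.I - μ) • R v = R y := by rw [hy, map_add, map_smul]
    have h7 : ‖J v + (Complex.I - μ) • R' (J v)‖
        ≤ (1 + δ * c) * (r' * ‖R v‖) + (1 + Λ) * (δ * (c * ‖R v‖)) := by
      rw [h5, h6]
      refine (norm_sub_le _ _).trans (add_le_add ?_ ?_)
      · refine (hJ y hyV).2.trans ?_
        rw [← h6]
        gcongr
        exact hAμ v hvV
      · rw [norm_smul]
        have := hcV v hvV
        gcongr
        exact h4.trans (by gcongr)
    have h8 : (1 - δ * c) * ‖R v‖ - δ * (c * ‖R v‖) ≤ ‖R' (J v)‖ := by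
      have h9 := (hJ v hvV).1
      have h10 := norm_sub_norm_le (J (R v)) (R' (J v))
      have h11 : δ * ‖v‖ ≤ δ * (c * ‖R v‖) := mul_le_mul_of_nonneg_left (hcV v hvV) hδ0
      linarith
    have hr0 : 0 ≤ r := by linarith
    have h12 : r * ((1 - δ * c) * ‖R v‖ - δ * (c * ‖R v‖)) ≤
        (1 + δ * c) * (r' * ‖R v‖) + (1 + Λ) * (δ * (c * ‖R v‖)) :=
      (mul_le_mul_of_nonneg_left h8 hr0).trans (h3.trans h7)
    have h13 : (r - r' - δ * (c * (2 * r + r' + Λ + 1))) * ‖R v‖ ≤ 0 := by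
      linarith
    have h14 : ‖R v‖ = 0 := by
      refine le_antisymm ?_ (norm_nonneg _)
      by_contra hpos
      push Not at hpos
      have : 0 < (r - r' - δ * (c * (2 * r + r' + Λ + 1))) * ‖R v‖ :=
        mul_pos (by linarith) hpos
      linarith
    have h15 : (a : E) = 0 :=
      hRes.eq_zero (hRes.eq_zero (hRes.eq_zero (norm_eq_zero.1 h14)))
    exact Subtype.ext h15
  exact ⟨FiniteDimensional.of_injective Φ hΦ, LinearMap.finrank_le_finrank_of_injective hΦ⟩

/-- Where `A` has no spectrum, `B` has none. -/
theorem OperatorQUE.mem_resolventSetOf (hA : HasRealResolvent A a₀ S)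
    (hB : HasRealResolvent B b₀ T) (hQ : OperatorQUE δ J A B) {μ Λ r r' : ℝ} (hΛ : |μ| ≤ Λ)
    (hr' : 0 ≤ r') (hr : r' < r)
    (hδ : δ * ((r' + Λ + 1) * (2 * r + r' + Λ + 1)) < r - r')
    (hl : LowerOff A μ r ⊥) {z : ℂ} (hz : dist z μ < r') : z ∈ resolventSetOf B := by
  -- The spectral subspace of `B` for radius `r'` has dimension at most that of `⊥`, so `B - μ` is
  -- bounded below by `r'` everywhere.
  obtain ⟨V, -, hV, hVu, hVl⟩ := hB.exists_spectral_subspace μ hr'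
  obtain ⟨hfin, hle⟩ := (hQ.symm hA hB).finrank_le hB hA hΛ hr' hr hδ hV hVu (isReducing_bot A) hl
  rw [finrank_bot, Nat.le_zero, Submodule.finrank_eq_zero] at hle
  exact hB.mem_of_lowerOff_bot (hle ▸ hVl) hz

/-- Bounds from below near each point of a compact interval are uniform. -/
theorem HasRealResolvent.exists_lowerOff_of_forall (hA : HasRealResolvent A a₀ S)
    {X : Submodule ℂ E} [X.HasOrthogonalProjection] (hX : IsReducing A X) {μ s : ℝ}
    (hs : 0 ≤ s) (hx : ∀ x : ℝ, |x - μ| ≤ s → ∃ c > 0, LowerOff A x c X) :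
    ∃ s' > s, LowerOff A μ s' X := by
  have hSX : ∀ v ∈ Xᗮ, S v ∈ Xᗮ := fun v hv =>
    mem_orthogonal_of_commute_starProjection (hX.commute_real hA) hv
  -- The restriction of `A` to `Xᗮ` is an operator `A'` with self-adjoint resolvent `S'` at `a₀`.
  -- Its spectrum is closed and misses the closed ball of radius `s` about `μ`, so the distance from
  -- `μ` is attained and exceeds `s` strictly.
  let S' : Xᗮ →L[ℂ] Xᗮ := (S ∘L Xᗮ.subtypeL).codRestrict Xᗮ fun v => hSX v v.2
  have hS'c : ∀ v, (S' v : E) = S v := fun v => rfl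
  have hS'sa : IsSelfAdjoint S' := by
    rw [ContinuousLinearMap.isSelfAdjoint_iff', eq_comm, ContinuousLinearMap.eq_adjoint_iff]
    intro x y
    rw [Submodule.coe_inner, Submodule.coe_inner, hS'c, hS'c, ← ContinuousLinearMap.adjoint_inner_right,
      hA.isSelfAdjoint.adjoint_eq]
  let Γ : Submodule ℂ (Xᗮ × Xᗮ) := LinearMap.range
    (S'.toLinearMap.prod (LinearMap.id + (a₀ : ℂ) • S'.toLinearMap))
  have hΓ : ∀ p ∈ Γ, p.1 = 0 → p.2 = 0 := by
    rintro p ⟨v, rfl⟩ h0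
    have h1 : S' v = 0 := h0
    have h2 : v = 0 := Subtype.ext (hA.isResolvent.eq_zero (by rw [← hS'c, h1]; rfl))
    simp [h2]
  let A' : Xᗮ →ₗ.[ℂ] Xᗮ := Γ.toLinearPMap
  have hgr : A'.graph = Γ := Submodule.toLinearPMap_graph_eq Γ hΓ
  have hmem : ∀ {f g}, (f, g) ∈ A'.graph ↔ ((f : E), (g : E)) ∈ A.graph := by
    intro f g
    rw [hgr, hA.isResolvent.mem_graph_iff]
    constructor
    · rintro ⟨v, hv⟩
      have h1 : S' v = f := congrArg Prod.fst hv
      have h2 : v + (a₀ : ℂ) • S' v = g := congrArg Prod.snd hv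
      rw [← h2, ← h1]
      simp [hS'c]
    · intro h1
      have h2 : S' (g - (a₀ : ℂ) • f) = f := Subtype.ext h1.symm
      refine ⟨g - (a₀ : ℂ) • f, Prod.ext h2 ?_⟩
      change g - (a₀ : ℂ) • f + (a₀ : ℂ) • S' (g - (a₀ : ℂ) • f) = g
      rw [h2, sub_add_cancel]
  have hA' : HasRealResolvent A' a₀ S' := by
    refine ⟨⟨fun f => ?_, fun f g hf => ?_⟩, hS'sa⟩
    · rw [hmem]
      exact hA.isResolvent.1 (f : E)
    · rw [hmem, hA.isResolvent.mem_graph_iff] at hf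
      exact Subtype.ext hf.symm
  have hcl : ∀ z ∈ specOf A', s < dist z μ := by
    intro z hz
    by_contra hle
    push Not at hle
    obtain ⟨y, rfl⟩ : ∃ y : ℝ, z = y :=
      ⟨z.re, Complex.ext (by simp) (by simp [hA'.im_eq_zero hz])⟩
    rw [Complex.dist_eq, ← Complex.ofReal_sub, Complex.norm_real, Real.norm_eq_abs] at hle
    obtain ⟨c, hc, hl⟩ := hx y hle
    exact hz (hA'.mem_of_le_norm (μ := y) (r := c)
      (fun f g hf => hl f g (hmem.1 hf) f.2) (by rwa [dist_self]))
  obtain ⟨s', hs', hd⟩ : ∃ s' > s, ∀ z ∈ specOf A', s' ≤ dist z μ := by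
    rcases (specOf A').eq_empty_or_nonempty with h0 | h0
    · exact ⟨s + 1, by simp, fun z hz => by simp [h0] at hz⟩
    · obtain ⟨y, hy, hyd⟩ := hA'.isClosed_specOf.exists_infDist_eq_dist h0 (μ : ℂ)
      refine ⟨dist y μ, hcl y hy, fun z hz => ?_⟩
      rw [dist_comm y, ← hyd, dist_comm z]
      exact Metric.infDist_le_dist_of_mem hz
  refine ⟨s', hs', fun f g hf hfX => ?_⟩
  have hgX : g ∈ Xᗮ := by
    have h1 := hX.starProjection_mem_graph hA hf
    rw [(Submodule.starProjection_apply_eq_zero_iff X).2 hfX] at h1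
    exact (Submodule.starProjection_apply_eq_zero_iff X).1 (LinearPMap.graph_fst_eq_zero_snd A h1 rfl)
  exact hA'.le_norm_of_disjoint (hs.trans_lt hs') hd (f := ⟨f, hfX⟩) (g := ⟨g, hgX⟩) (hmem.2 hf)

theorem HasRealResolvent.ofReal_re_eq (hA : HasRealResolvent A a₀ S) {x : ℂ} (hx : x ∈ specOf A) :
    ((x.re : ℝ) : ℂ) = x := Complex.ext (by simp) (by simp [hA.im_eq_zero hx])

theorem HasRealResolvent.exists_lowerOff_of_mem_discSpecOf (hA : HasRealResolvent A a₀ S) {x : ℝ}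
    (hx : (x : ℂ) ∈ discSpecOf A) : ∃ r > 0, LowerOff A x r (eigenspaceOf A x) := by
  obtain ⟨⟨r, hr, h⟩, -⟩ := hx
  exact hA.exists_lowerOff_eigenspaceOf hr h

/-- An isolated point of the spectrum is an eigenvalue: `A - x` is bounded below off the eigenspace,
so a trivial eigenspace would put `x` in the resolvent set. -/
theorem HasRealResolvent.multOf_pos (hA : HasRealResolvent A a₀ S) {x : ℂ}
    (hx : x ∈ discSpecOf A) : 0 < multOf A x := by
  have hxs := mem_specOf_of_mem_discSpecOf hx
  obtain ⟨y, rfl⟩ : ∃ y : ℝ, x = y := ⟨x.re, (hA.ofReal_re_eq hxs).symm⟩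
  have := hx.2
  obtain ⟨r, hr, hl⟩ := hA.exists_lowerOff_of_mem_discSpecOf hx
  rw [multOf, Nat.pos_iff_ne_zero]
  intro h0
  rw [Submodule.finrank_eq_zero] at h0
  rw [h0] at hl
  exact hxs (hA.mem_of_lowerOff_bot hl (by rwa [dist_self]))

/-- If the spectrum in a closed interval is discrete, its spectral subspace is
finite-dimensional. -/
theorem HasRealResolvent.exists_finiteDimensional_of_disc (hA : HasRealResolvent A a₀ S) {μ s : ℝ}
    (hs : 0 ≤ s) (hd : ∀ x ∈ specOf A, dist x μ ≤ s → x ∈ discSpecOf A) :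
    ∃ X : Submodule ℂ E, FiniteDimensional ℂ X ∧ IsReducing A X ∧ LowerOff A μ s X := by
  -- This part of the spectrum is compact, and discrete because each of its points is isolated.
  have hfin : (specOf A ∩ Metric.closedBall (μ : ℂ) s).Finite := by
    refine ((isCompact_closedBall _ _).inter_left hA.isClosed_specOf).finite ?_
    rw [isDiscrete_iff_forall_mem_exists_isOpen]
    intro x hx
    obtain ⟨⟨r, hr, h⟩, -⟩ := hd x hx.1 hx.2
    refine ⟨Metric.ball x r, Metric.isOpen_ball, ?_⟩
    ext y
    constructor
    · rintro ⟨h1, h2⟩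
      rw [← h]; exact ⟨h2.1, h1⟩
    · rintro rfl
      exact ⟨Metric.mem_ball_self hr, hx⟩
  set Y := specOf A ∩ Metric.closedBall (μ : ℂ) s
  have : Finite Y := hfin
  have hYd : ∀ x : Y, (x : ℂ) ∈ discSpecOf A := fun x => hd x x.2.1 x.2.2
  have : ∀ x : Y, FiniteDimensional ℂ (eigenspaceOf A (x : ℂ)) := fun x => (hYd x).2
  let X : Submodule ℂ E := ⨆ x : Y, eigenspaceOf A (x : ℂ)
  have hX : IsReducing A X := IsReducing.iSup fun x => isReducing_eigenspaceOf hA x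
  have hXfin : FiniteDimensional ℂ X := Submodule.finiteDimensional_iSup _
  obtain ⟨s', hs', hl⟩ := hA.exists_lowerOff_of_forall hX hs fun x hx => by
    by_cases hxs : (x : ℂ) ∈ specOf A
    · have hxY : (x : ℂ) ∈ Y := ⟨hxs, by
        rwa [Metric.mem_closedBall, Complex.dist_eq, ← Complex.ofReal_sub, Complex.norm_real]⟩
      obtain ⟨c, hc, hl⟩ := hA.exists_lowerOff_of_mem_discSpecOf (hYd ⟨x, hxY⟩)
      refine ⟨c, hc, fun f g hf hfX => hl f g hf ?_⟩
      exact Submodule.orthogonal_le (le_iSup (fun x : Y => eigenspaceOf A (x : ℂ)) ⟨x, hxY⟩) hfX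
    · obtain ⟨c, hc, hl⟩ := exists_lowerOff_bot_of_mem (not_not.1 hxs)
      exact ⟨c, hc, fun f g hf _ => hl f g hf (by simp)⟩
  exact ⟨X, hXfin, hX, hl.mono hs'.le⟩

end Comparison

/-! ### Convergence of spectra, multiplicities and eigenvectors -/

section Families

theorem eventually_mul_lt {ι : Type*} {l : Filter ι} {δ : ι → ℝ} (hδ : Tendsto δ l (𝓝 0)) (K : ℝ)
    {ε : ℝ} (hε : 0 < ε) : ∀ᶠ i in l, δ i * K < ε := by
  have := hδ.mul_const K
  rw [zero_mul] at this
  exact this.eventually_lt_const hε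

/-- A choice of nearest points. -/
theorem exists_tendsto_of_eventually_nonempty {ι : Type*} {l : Filter ι} {s : ι → Set ℂ}
    (hs : ∀ i, IsClosed (s i)) {x : ℂ}
    (hx : ∀ ε > 0, ∀ᶠ i in l, (s i ∩ Metric.ball x ε).Nonempty) :
    ∃ y : ι → ℂ, (∀ᶠ i in l, y i ∈ s i) ∧ Tendsto y l (𝓝 x) := by
  classical
  have h1 : ∀ i, ∃ y, (s i).Nonempty → y ∈ s i ∧ ∀ z ∈ s i, dist y x ≤ dist z x := by
    intro i
    by_cases h : (s i).Nonempty
    · obtain ⟨y, hy, hyd⟩ := (hs i).exists_infDist_eq_dist h x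
      refine ⟨y, fun _ => ⟨hy, fun z hz => ?_⟩⟩
      rw [dist_comm y, ← hyd, dist_comm z]
      exact Metric.infDist_le_dist_of_mem hz
    · exact ⟨0, fun h' => absurd h' h⟩
  choose y hy using h1
  refine ⟨y, ?_, ?_⟩
  · filter_upwards [hx 1 one_pos] with i hi
    exact (hy i (hi.mono Set.inter_subset_left)).1
  · rw [Metric.tendsto_nhds]
    intro ε hε
    filter_upwards [hx ε hε] with i hi
    obtain ⟨z, hz, hzd⟩ := hi
    exact ((hy i ⟨z, hz⟩).2 z hz).trans_lt hzd

variable {E : Type u} [NormedAddCommGroup E] [InnerProductSpace ℂ E] [CompleteSpace E]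
  {ι : Type w} {l : Filter ι}
  {F : ι → Type v} [∀ i, NormedAddCommGroup (F i)] [∀ i, InnerProductSpace ℂ (F i)]
  [∀ i, CompleteSpace (F i)]
  {A : E →ₗ.[ℂ] E} {a₀ : ℝ} {S : E →L[ℂ] E}
  {B : ∀ i, F i →ₗ.[ℂ] F i} {b₀ : ι → ℝ} {T : ∀ i, F i →L[ℂ] F i}
  {J : ∀ i, E →L[ℂ] F i} {δ : ι → ℝ}

/-- The limit is real. If it were in the resolvent set, `A - μ` would be bounded below by some `r`,
and by comparison `B i` would have no spectrum within `r / 2` of `μ` once `δ i` is small. -/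
theorem mem_specOf_of_tendsto [l.NeBot] (hA : HasRealResolvent A a₀ S)
    (hB : ∀ i, HasRealResolvent (B i) (b₀ i) (T i)) (hδ : Tendsto δ l (𝓝 0))
    (hQ : ∀ᶠ i in l, OperatorQUE (δ i) (J i) A (B i)) {lam : ι → ℂ} {lam₀ : ℂ}
    (hlam : ∀ᶠ i in l, lam i ∈ specOf (B i)) (hlim : Tendsto lam l (𝓝 lam₀)) :
    lam₀ ∈ specOf A := by
  have him : lam₀.im = 0 := by
    refine tendsto_nhds_unique ((Complex.continuous_im.tendsto _).comp hlim) ?_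
    refine tendsto_const_nhds.congr' ?_
    filter_upwards [hlam] with i hi
    exact ((hB i).im_eq_zero hi).symm
  obtain ⟨μ, rfl⟩ : ∃ μ : ℝ, lam₀ = μ := ⟨lam₀.re, Complex.ext (by simp) (by simp [him])⟩
  intro hμ
  obtain ⟨r, hr, hl⟩ := exists_lowerOff_bot_of_mem hμ
  obtain ⟨i, hi, hiQ, hid, hiδ⟩ := (hlam.and (hQ.and ((hlim.eventually_mem
    (Metric.ball_mem_nhds _ (half_pos hr))).and (eventually_mul_lt hδ
    ((r / 2 + |μ| + 1) * (2 * r + r / 2 + |μ| + 1)) (half_pos hr))))).exists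
  exact hi (hiQ.mem_resolventSetOf hA (hB i) le_rfl (half_pos hr).le (half_lt_self hr)
    (by linarith) hl hid)

/-- The same comparison with the roles exchanged: a gap of radius `ε` in the spectrum of `B i` would
put `lam₀` in the resolvent set of `A`. -/
theorem eventually_specOf_inter_ball (hA : HasRealResolvent A a₀ S)
    (hB : ∀ i, HasRealResolvent (B i) (b₀ i) (T i)) (hδ : Tendsto δ l (𝓝 0))
    (hQ : ∀ᶠ i in l, OperatorQUE (δ i) (J i) A (B i)) {lam₀ : ℂ} (hlam : lam₀ ∈ specOf A)
    {ε : ℝ} (hε : 0 < ε) : ∀ᶠ i in l, (specOf (B i) ∩ Metric.ball lam₀ ε).Nonempty := by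
  obtain ⟨μ, rfl⟩ : ∃ μ : ℝ, lam₀ = μ := ⟨lam₀.re, (hA.ofReal_re_eq hlam).symm⟩
  filter_upwards [hQ, eventually_mul_lt hδ
    ((ε / 2 + |μ| + 1) * (2 * ε + ε / 2 + |μ| + 1)) (half_pos hε)] with i hiQ hiδ
  by_contra hne
  have hd : ∀ z ∈ specOf (B i), ε ≤ dist z μ := fun z hz => by
    by_contra hlt
    exact hne ⟨z, hz, not_le.1 hlt⟩
  have hl : LowerOff (B i) μ ε ⊥ := fun f g hf _ => (hB i).le_norm_of_disjoint hε hd hf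
  exact hlam ((hiQ.symm hA (hB i)).mem_resolventSetOf (hB i) hA le_rfl (half_pos hε).le
    (half_lt_self hε) (by linarith) hl (by rw [dist_self]; exact half_pos hε))

/-- Stability of the multiplicity of a discrete eigenvalue. -/
theorem exists_eventually_finset (hA : HasRealResolvent A a₀ S)
    (hB : ∀ i, HasRealResolvent (B i) (b₀ i) (T i)) (hδ : Tendsto δ l (𝓝 0))
    (hQ : ∀ᶠ i in l, OperatorQUE (δ i) (J i) A (B i)) {lam₀ : ℂ} (hlam : lam₀ ∈ discSpecOf A) :
    ∃ r₀ > 0, ∀ r : ℝ, 0 < r → r < r₀ → ∀ᶠ i in l, ∃ s : Finset ℂ,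
      (s : Set ℂ) = specOf (B i) ∩ Metric.ball lam₀ r ∧ (∀ x ∈ s, x ∈ discSpecOf (B i)) ∧
      ∑ x ∈ s, multOf (B i) x = multOf A lam₀ ∧
      IsReducing (B i) (⨆ x : s, eigenspaceOf (B i) (x : ℂ)) ∧
      LowerOff (B i) lam₀.re r (⨆ x : s, eigenspaceOf (B i) (x : ℂ)) := by
  obtain ⟨μ, rfl⟩ : ∃ μ : ℝ, lam₀ = μ :=
    ⟨lam₀.re, (hA.ofReal_re_eq (mem_specOf_of_mem_discSpecOf hlam)).symm⟩
  obtain ⟨r₁, hr₁, hl⟩ := hA.exists_lowerOff_of_mem_discSpecOf hlam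
  have hfin : FiniteDimensional ℂ (eigenspaceOf A (μ : ℂ)) := hlam.2
  refine ⟨r₁, hr₁, fun r hr hrr => ?_⟩
  -- Two smallness conditions, one per direction. The first compares radius `r` for `B i` with the
  -- gap `r₁` of `A` and bounds the multiplicities of `B i` above. The second compares the
  -- eigenspace of `A`, on which `A - μ` is 0, with the span of the eigenspaces of `B i` and bounds
  -- them below.
  filter_upwards [hQ, eventually_mul_lt hδ ((r + |μ| + 1) * (2 * r₁ + r + |μ| + 1))
    (sub_pos.2 hrr), eventually_mul_lt hδ ((0 + |μ| + 1) * (2 * r + 0 + |μ| + 1)) hr]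
    with i hiQ hi1 hi2
  obtain ⟨V, -, hV, hVu, hVl⟩ := (hB i).exists_spectral_subspace μ hr.le
  obtain ⟨hVfin, hVle⟩ := (hiQ.symm hA (hB i)).finrank_le (hB i) hA le_rfl hr.le hrr hi1 hV hVu
    (isReducing_eigenspaceOf hA _) hl
  obtain ⟨s, hs, hsd, X, hXV, hX, hXl, hXeq, hXr⟩ := (hB i).exists_finset_specOf hV hVl
  have hXfin : FiniteDimensional ℂ X := Submodule.finiteDimensional_of_le hXV
  have hu : UpperOn A μ 0 (eigenspaceOf A (μ : ℂ)) := by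
    intro f g hf hfe
    have h1 := A.graph.sub_mem hf (mem_eigenspaceOf.1 hfe)
    have h2 : g - (μ : ℂ) • f = 0 :=
      LinearPMap.graph_fst_eq_zero_snd A h1 (sub_self f)
    rw [h2, norm_zero, zero_mul]
  obtain ⟨-, hle⟩ := hiQ.finrank_le hA (hB i) le_rfl le_rfl hr (by linarith)
    (isReducing_eigenspaceOf hA _) hu hX hXl
  refine ⟨s, hs, hsd, ?_, hXeq ▸ hX, ?_⟩
  · rw [← hXr, multOf]
    exact le_antisymm ((Submodule.finrank_mono hXV).trans hVle) hle
  · rw [Complex.ofReal_re]; exact hXeq ▸ hXl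

theorem mem_essSpecOf_of_tendsto [l.NeBot] (hA : HasRealResolvent A a₀ S)
    (hB : ∀ i, HasRealResolvent (B i) (b₀ i) (T i)) (hδ : Tendsto δ l (𝓝 0))
    (hQ : ∀ᶠ i in l, OperatorQUE (δ i) (J i) A (B i)) {lam : ι → ℂ} {lam₀ : ℂ}
    (hlam : ∀ᶠ i in l, lam i ∈ essSpecOf (B i)) (hlim : Tendsto lam l (𝓝 lam₀)) :
    lam₀ ∈ essSpecOf A := by
  refine ⟨mem_specOf_of_tendsto hA hB hδ hQ (hlam.mono fun i hi => hi.1) hlim, fun hd => ?_⟩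
  obtain ⟨r₀, hr₀, h⟩ := exists_eventually_finset hA hB hδ hQ hd
  obtain ⟨i, ⟨s, hs, hsd, -⟩, hi, hib⟩ := ((h (r₀ / 2) (half_pos hr₀) (half_lt_self hr₀)).and
    (hlam.and (hlim.eventually_mem (Metric.ball_mem_nhds _ (half_pos hr₀))))).exists
  refine hi.2 (hsd _ ?_)
  rw [← Finset.mem_coe, hs]
  exact ⟨hi.1, hib⟩

/-- A limit of essential points cannot be discrete, since a discrete point is isolated in the whole
spectrum. Closedness allows the choice of nearest points. -/
theorem HasRealResolvent.isClosed_essSpecOf (hA : HasRealResolvent A a₀ S) :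
    IsClosed (essSpecOf A) := by
  refine isClosed_of_closure_subset fun x hx => ?_
  have hxs : x ∈ specOf A :=
    hA.isClosed_specOf.closure_subset_iff.2 Set.sdiff_subset hx
  refine ⟨hxs, fun hd => ?_⟩
  obtain ⟨⟨r, hr, h⟩, -⟩ := id hd
  obtain ⟨y, hy, hyd⟩ := Metric.mem_closure_iff.1 hx r hr
  have h1 : y ∈ specOf A ∩ Metric.ball x r := ⟨hy.1, by rwa [Metric.mem_ball, dist_comm]⟩
  rw [h, Set.mem_singleton_iff] at h1
  exact hy.2 (h1 ▸ hd)

/-- Without essential spectrum in the ball, `B i` is bounded below by `ε / 2` off a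
finite-dimensional subspace. By comparison the spectral subspace of `A` for radius `ε / 4` is
finite-dimensional, so `lam₀` would be discrete. -/
theorem eventually_essSpecOf_inter_ball (hA : HasRealResolvent A a₀ S)
    (hB : ∀ i, HasRealResolvent (B i) (b₀ i) (T i)) (hδ : Tendsto δ l (𝓝 0))
    (hQ : ∀ᶠ i in l, OperatorQUE (δ i) (J i) A (B i)) {lam₀ : ℂ} (hlam : lam₀ ∈ essSpecOf A)
    {ε : ℝ} (hε : 0 < ε) : ∀ᶠ i in l, (essSpecOf (B i) ∩ Metric.ball lam₀ ε).Nonempty := by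
  obtain ⟨μ, rfl⟩ : ∃ μ : ℝ, lam₀ = μ := ⟨lam₀.re, (hA.ofReal_re_eq hlam.1).symm⟩
  have h2 : ε / 4 < ε / 2 := by linarith
  filter_upwards [hQ, eventually_mul_lt hδ
    ((ε / 4 + |μ| + 1) * (2 * (ε / 2) + ε / 4 + |μ| + 1)) (sub_pos.2 h2)] with i hiQ hiδ
  by_contra hne
  obtain ⟨X, hXfin, hX, hXl⟩ := (hB i).exists_finiteDimensional_of_disc (μ := μ) (half_pos hε).le
    fun x hx hxd => by
      by_contra hc
      exact hne ⟨x, ⟨hx, hc⟩, hxd.trans_lt (half_lt_self hε)⟩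
  obtain ⟨V, -, hV, hVu, hVl⟩ := hA.exists_spectral_subspace μ (by positivity : 0 ≤ ε / 4)
  obtain ⟨hVfin, -⟩ := hiQ.finrank_le hA (hB i) le_rfl (by positivity) h2 hiδ hV hVu hX hXl
  obtain ⟨s, hs, hsd, -⟩ := hA.exists_finset_specOf hV hVl
  refine hlam.2 (hsd _ ?_)
  rw [← Finset.mem_coe, hs]
  exact ⟨hlam.1, Metric.mem_ball_self (by positivity)⟩

theorem exists_discSpecOf_tendsto (hA : HasRealResolvent A a₀ S)
    (hB : ∀ i, HasRealResolvent (B i) (b₀ i) (T i)) (hδ : Tendsto δ l (𝓝 0))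
    (hQ : ∀ᶠ i in l, OperatorQUE (δ i) (J i) A (B i)) {lam₀ : ℂ} (hlam : lam₀ ∈ discSpecOf A) :
    ∃ lam : ι → ℂ, (∀ᶠ i in l, lam i ∈ discSpecOf (B i)) ∧ Tendsto lam l (𝓝 lam₀) := by
  obtain ⟨lam, h1, h2⟩ := exists_tendsto_of_eventually_nonempty
    (fun i => (hB i).isClosed_specOf) fun ε hε =>
      eventually_specOf_inter_ball hA hB hδ hQ (mem_specOf_of_mem_discSpecOf hlam) hε
  refine ⟨lam, ?_, h2⟩
  obtain ⟨r₀, hr₀, h⟩ := exists_eventually_finset hA hB hδ hQ hlam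
  filter_upwards [h1, h (r₀ / 2) (half_pos hr₀) (half_lt_self hr₀),
    h2.eventually_mem (Metric.ball_mem_nhds _ (half_pos hr₀))] with i hi1 hi2 hi3
  obtain ⟨s, hs, hsd, -⟩ := hi2
  refine hsd _ ?_
  rw [← Finset.mem_coe, hs]
  exact ⟨hi1, hi3⟩

/-- An eigenvector of `A`, mapped by `J`, is close to a spectral subspace of `B`. -/
theorem OperatorQUE.exists_norm_sub_le {F : Type v} [NormedAddCommGroup F]
    [InnerProductSpace ℂ F] [CompleteSpace F] {B : F →ₗ.[ℂ] F} {b₀ : ℝ} {T : F →L[ℂ] F}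
    {J : E →L[ℂ] F} {δ : ℝ} (hA : HasRealResolvent A a₀ S) (hB : HasRealResolvent B b₀ T)
    (hQ : OperatorQUE δ J A B) {μ r : ℝ} (hr : 0 < r) {X : Submodule ℂ F}
    [FiniteDimensional ℂ X] (hX : IsReducing B X) (hXl : LowerOff B μ r X)
    (hδ : δ * (2 * ((1 + |μ|) + (1 + |μ|) ^ 2 / r) + (1 + |μ|)) < 1)
    {φ : E} (hφ : φ ∈ eigenspaceOf A (μ : ℂ)) (hφ1 : ‖φ‖ = 1) :
    ∃ ψ ∈ X, ‖ψ‖ = 1 ∧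
      ‖J φ - ψ‖ ≤ δ * (2 * ((1 + |μ|) + (1 + |μ|) ^ 2 / r) + (1 + |μ|)) := by
  have hδ0 := hQ.nonneg
  set m := 1 + |μ| with hm
  have hm0 : 0 < m := by positivity
  have hIμ : ‖Complex.I - μ‖ ≤ m := norm_I_sub_ofReal_le μ
  have hRes : IsResolvent A Complex.I _ := hA.isResolvent_of_im_ne_zero (by simp)
  have hRes' : IsResolvent B Complex.I _ := hB.isResolvent_of_im_ne_zero (by simp)
  -- Chosen so that `R φ' = φ`; the estimates for `J R` thereby apply to the eigenvector itself and
  -- make `(B - μ)(B - i)⁻¹ J φ` small.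
  set φ' := ((μ : ℂ) - Complex.I) • φ with hφ'
  have hφ'n : ‖φ'‖ ≤ m := by rw [hφ', norm_smul, hφ1, mul_one, norm_sub_rev]; exact hIμ
  have hRφ : resolventOf A Complex.I φ' = φ := by
    rw [hφ', sub_smul]; exact hRes.2 _ _ (mem_eigenspaceOf.1 hφ)
  have h1 := hQ.norm_adjoint_sub_le φ'
  have h2 := hQ.norm_comm_le φ'
  rw [hRφ] at h1 h2
  set g := J φ with hg
  set y := resolventOf B Complex.I g with hy
  have hd : δ * ‖φ'‖ ≤ δ * m := by gcongr
  have h3 : ‖g + (Complex.I - μ) • y‖ ≤ δ * m := by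
    refine le_trans (le_of_eq ?_) (h2.trans hd)
    congr 1
    rw [hφ', map_smul, map_smul, ← hg, ← hy]; module
  have hyg := hRes'.1 g
  rw [← hy] at hyg
  have hyP := hX.starProjection_mem_graph hB hyg
  have hyQ := B.graph.sub_mem hyg hyP
  have hcontr : ∀ x : F, ‖x - X.starProjection x‖ ≤ ‖x‖ := by
    intro x
    rw [← Submodule.starProjection_orthogonal_val]
    exact Submodule.norm_starProjection_apply_le _ _
  have h4 := hXl _ _ hyQ (Submodule.sub_starProjection_mem_orthogonal y)
  set yq := y - X.starProjection y with hyq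
  set gq := g - X.starProjection g with hgq
  have h5 : ‖gq + (Complex.I - μ) • yq‖ ≤ δ * m := by
    refine le_trans (le_of_eq ?_) ((hcontr (g + (Complex.I - μ) • y)).trans h3)
    congr 1
    rw [hyq, hgq, map_add, map_smul]; module
  have h6 : r * ‖yq‖ ≤ δ * m := by
    refine h4.trans (le_trans (le_of_eq ?_) h5)
    congr 1
    simp only [hyq, hgq, map_add, map_smul]; module
  -- The part of `J φ` off `X` is small: `B - μ` is bounded below there, which first bounds the
  -- resolvent part `yq` and then `gq`. In the final estimate this error counts twice, for the
  -- projection and for the normalisation; the last `δ m` is the deviation of `‖J φ‖` from 1.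
  have h7 : ‖gq‖ ≤ δ * (m + m ^ 2 / r) := by
    have h8 : gq = (gq + (Complex.I - μ) • yq) - (Complex.I - μ) • yq := by abel
    have h9 : ‖gq‖ ≤ ‖gq + (Complex.I - μ) • yq‖ + ‖Complex.I - μ‖ * ‖yq‖ := by
      rw [← norm_smul]; nth_rewrite 1 [h8]; exact norm_sub_le _ _
    have h10 : ‖yq‖ ≤ δ * m / r := by rw [le_div_iff₀ hr]; linarith
    have h11 : ‖Complex.I - (μ : ℂ)‖ * ‖yq‖ ≤ m * (δ * m / r) := by gcongr
    calc ‖gq‖ ≤ δ * m + m * (δ * m / r) := by linarith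
      _ = _ := by ring
  have h8 : |‖g‖ - 1| ≤ δ * m := by
    have h9 := abs_norm_sq_sub_le J φ
    rw [hφ1, ← hg] at h9
    have h10 : |‖g‖ - 1| * (‖g‖ + 1) ≤ δ * m := by
      rw [← abs_of_pos (by positivity : 0 < ‖g‖ + 1), ← abs_mul]
      calc |(‖g‖ - 1) * (‖g‖ + 1)| = |‖g‖ ^ 2 - 1 ^ 2| := by ring_nf
        _ ≤ _ := by linarith
    nlinarith [abs_nonneg (‖g‖ - 1), norm_nonneg g]
  set p := X.starProjection g with hp
  have hgp : g - p = gq := rfl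
  have h9 : |‖p‖ - ‖g‖| ≤ ‖gq‖ := by
    rw [← hgp, norm_sub_rev]; exact abs_norm_sub_norm_le _ _
  have h10 : |‖p‖ - 1| ≤ δ * (m + m ^ 2 / r) + δ * m := by
    have := abs_sub_le ‖p‖ ‖g‖ 1
    linarith
  have hmr : 0 ≤ δ * (m + m ^ 2 / r) := by positivity
  have hp0 : 0 < ‖p‖ := by
    have := (abs_le.1 h10).1
    linarith
  have hpX : p ∈ X := Submodule.starProjection_apply_mem _ _
  refine ⟨((‖p‖⁻¹ : ℝ) : ℂ) • p, X.smul_mem _ hpX, ?_, ?_⟩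
  · rw [norm_smul, Complex.norm_real, norm_inv, norm_norm, inv_mul_cancel₀ hp0.ne']
  · have h11 : ‖p - ((‖p‖⁻¹ : ℝ) : ℂ) • p‖ = |‖p‖ - 1| := by
      have h12 : p - ((‖p‖⁻¹ : ℝ) : ℂ) • p = ((1 - ‖p‖⁻¹ : ℝ) : ℂ) • p := by push_cast; module
      rw [h12, norm_smul, Complex.norm_real, Real.norm_eq_abs]
      nth_rewrite 2 [← abs_of_pos hp0]
      rw [← abs_mul, sub_mul, inv_mul_cancel₀ hp0.ne', one_mul]
    have h12 := norm_sub_le_norm_sub_add_norm_sub g p (((‖p‖⁻¹ : ℝ) : ℂ) • p)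
    rw [h11, hgp] at h12
    linarith

theorem exists_eigenvector_tendsto (hA : HasRealResolvent A a₀ S)
    (hB : ∀ i, HasRealResolvent (B i) (b₀ i) (T i)) (hδ : Tendsto δ l (𝓝 0))
    (hQ : ∀ᶠ i in l, OperatorQUE (δ i) (J i) A (B i)) {lam₀ : ℂ} (hlam : lam₀ ∈ discSpecOf A)
    (hmult : multOf A lam₀ = 1) {φ : E} (hφ : φ ∈ eigenspaceOf A lam₀) (hφ1 : ‖φ‖ = 1) :
    ∃ (lam : ι → ℂ) (ψ : ∀ i, F i),
      (∀ᶠ i in l, lam i ∈ discSpecOf (B i) ∧ multOf (B i) (lam i) = 1 ∧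
        ψ i ∈ eigenspaceOf (B i) (lam i) ∧ ‖ψ i‖ = 1) ∧
      Tendsto lam l (𝓝 lam₀) ∧ Tendsto (fun i => ‖J i φ - ψ i‖) l (𝓝 0) := by
  classical
  obtain ⟨lam, h1, h2⟩ := exists_discSpecOf_tendsto hA hB hδ hQ hlam
  obtain ⟨r₀, hr₀, h⟩ := exists_eventually_finset hA hB hδ hQ hlam
  obtain ⟨μ, rfl⟩ : ∃ μ : ℝ, lam₀ = μ :=
    ⟨lam₀.re, (hA.ofReal_re_eq (mem_specOf_of_mem_discSpecOf hlam)).symm⟩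
  have hr : 0 < r₀ / 2 := half_pos hr₀
  set K := 2 * ((1 + |μ|) + (1 + |μ|) ^ 2 / (r₀ / 2)) + (1 + |μ|)
  have hev : ∀ᶠ i in l, multOf (B i) (lam i) = 1 ∧
      ∃ ψ ∈ eigenspaceOf (B i) (lam i), ‖ψ‖ = 1 ∧ ‖J i φ - ψ‖ ≤ δ i * K := by
    filter_upwards [h1, h (r₀ / 2) hr (half_lt_self hr₀), hQ, eventually_mul_lt hδ K one_pos,
      h2.eventually_mem (Metric.ball_mem_nhds _ hr)] with i hi1 hi2 hiQ hiδ hib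
    obtain ⟨s, hs, hsd, hsum, hX, hXl⟩ := hi2
    rw [Complex.ofReal_re] at hXl
    have hls : lam i ∈ s := by
      rw [← Finset.mem_coe, hs]
      exact ⟨mem_specOf_of_mem_discSpecOf hi1, hib⟩
    -- The multiplicities are positive integers with sum 1, so there is only one nearby eigenvalue
    -- and its eigenspace is the whole spectral subspace.
    have hcard : s.card ≤ 1 := by
      have h3 : ∑ x ∈ s, 1 ≤ ∑ x ∈ s, multOf (B i) x :=
        Finset.sum_le_sum fun x hx => (hB i).multOf_pos (hsd x hx)
      rw [hsum, hmult] at h3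
      simpa using h3
    have hs1 : s = {lam i} := Finset.eq_singleton_iff_unique_mem.2
      ⟨hls, fun x hx => Finset.card_le_one.1 hcard x hx _ hls⟩
    subst hs1
    rw [Finset.sum_singleton, hmult] at hsum
    have hsup : (⨆ x : ({lam i} : Finset ℂ), eigenspaceOf (B i) (x : ℂ))
        = eigenspaceOf (B i) (lam i) :=
      le_antisymm (iSup_le fun x => by rw [Finset.mem_singleton.1 x.2])
        (le_iSup (fun x : ({lam i} : Finset ℂ) => eigenspaceOf (B i) (x : ℂ)) ⟨lam i, by simp⟩)
    rw [hsup] at hX hXl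
    have : FiniteDimensional ℂ (eigenspaceOf (B i) (lam i)) := hi1.2
    exact ⟨hsum, hiQ.exists_norm_sub_le hA (hB i) hr hX hXl hiδ hφ hφ1⟩
  let ψ : ∀ i, F i := fun i =>
    if hi : ∃ ψ ∈ eigenspaceOf (B i) (lam i), ‖ψ‖ = 1 ∧ ‖J i φ - ψ‖ ≤ δ i * K
    then hi.choose else 0
  have hψ : ∀ᶠ i in l, ψ i ∈ eigenspaceOf (B i) (lam i) ∧ ‖ψ i‖ = 1 ∧
      ‖J i φ - ψ i‖ ≤ δ i * K := by
    filter_upwards [hev] with i hi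
    simp only [ψ, dif_pos hi.2]
    exact hi.2.choose_spec
  refine ⟨lam, ψ, ?_, h2, ?_⟩
  · filter_upwards [h1, hev, hψ] with i hi1 hi2 hi3
    exact ⟨hi1, hi2.1, hi3.1, hi3.2.1⟩
  · have h3 : Tendsto (fun i => δ i * K) l (𝓝 0) := by simpa using hδ.mul_const K
    exact squeeze_zero' (Eventually.of_forall fun i => norm_nonneg _)
      (hψ.mono fun i hi => hi.2.2) h3

end Families

/-! ### Form norms of resolvents and the commutator estimate -/

section FormEstimates

theorem ContinuousLinearMap.opNorm_le_of_unit_inner {E F : Type*} [NormedAddCommGroup E]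
    [InnerProductSpace ℂ E] [NormedAddCommGroup F] [InnerProductSpace ℂ F] (D : E →L[ℂ] F) {c : ℝ}
    (hc : 0 ≤ c) (h : ∀ f g, ‖f‖ = 1 → ‖g‖ = 1 → ‖⟪g, D f⟫_ℂ‖ ≤ c) : ‖D‖ ≤ c := by
  refine D.opNorm_le_of_unit_norm hc fun f hf => ?_
  rcases eq_or_ne (D f) 0 with h0 | h0
  · rw [h0, norm_zero]; exact hc
  have h1 := h f (((‖D f‖⁻¹ : ℝ) : ℂ) • D f) hf (by
    rw [norm_smul, Complex.norm_real, norm_inv, norm_norm,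
      inv_mul_cancel₀ (norm_ne_zero_iff.2 h0)])
  have h2 : ‖⟪D f, D f⟫_ℂ‖ = ‖D f‖ * ‖D f‖ := by
    rw [← pow_two]; simp [inner_self_eq_norm_sq_to_K]
  rwa [inner_smul_left, Complex.conj_ofReal, norm_mul, h2, Complex.norm_real, norm_inv, norm_norm,
    inv_mul_cancel_left₀ (norm_ne_zero_iff.2 h0)] at h1

/-- The constant in the estimate of the form norm of a resolvent. -/
noncomputable def resolventConst (z : ℂ) : ℝ := √(2 * (1 / |z.im| + (|z.re| + 1) / |z.im| ^ 2))

theorem resolventConst_nonneg (z : ℂ) : 0 ≤ resolventConst z := Real.sqrt_nonneg _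

theorem resolventConst_sq (z : ℂ) :
    resolventConst z ^ 2 = 2 * (1 / |z.im| + (|z.re| + 1) / |z.im| ^ 2) :=
  Real.sq_sqrt (by positivity)

theorem resolventConst_conj (z : ℂ) : resolventConst (conj z) = resolventConst z := by
  simp [resolventConst]

namespace ClosedForm

variable {E : Type u} [NormedAddCommGroup E] [InnerProductSpace ℂ E]

theorem mem_operator_graph_iff (h : ClosedForm E) {f w : E} : (f, w) ∈ h.operator.graph ↔
    ∃ d : h.Dom, h.incl d = f ∧ ∀ φ, h.form d φ = ⟪w, h.incl φ⟫_ℂ := by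
  rw [h.graph_operator]; rfl

/-- The weak equation tested with the solution `d` itself expresses the form value through `⟪f, d⟫`,
and the norm bound then controls the form norm. -/
theorem norm_sq_le (h : ClosedForm E) {C : ℝ} (hC : h.NormBound C) {z : ℂ} {f : E} {d : h.Dom}
    (hd : ∀ φ, h.form d φ = ⟪f + z • h.incl d, h.incl φ⟫_ℂ) :
    ‖d‖ ^ 2 ≤ 2 * ((⟪f, h.incl d⟫_ℂ).re + (|z.re| + C) * ‖h.incl d‖ ^ 2) := by
  have h1 : (h.form d d).re = (⟪f, h.incl d⟫_ℂ).re + z.re * ‖h.incl d‖ ^ 2 := by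
    rw [hd, inner_add_left, inner_smul_left, inner_self_eq_norm_sq_to_K, Complex.add_re,
      ← Complex.conj_re z]
    congr 1
    exact (congrArg Complex.re (by push_cast; rfl)).trans (Complex.re_mul_ofReal _ _)
  have h2 := hC d
  rw [h1] at h2
  have h3 : z.re * ‖h.incl d‖ ^ 2 ≤ |z.re| * ‖h.incl d‖ ^ 2 := by gcongr; exact le_abs_self _
  linarith

variable [CompleteSpace E]

theorem mem_resolventSetOf (h : ClosedForm E) {z : ℂ} (hz : z.im ≠ 0) :
    z ∈ resolventSetOf h.operator := by
  obtain ⟨z₀, T, hT⟩ := h.exists_hasRealResolvent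
  exact hT.mem_of_im_ne_zero hz

theorem adjoint_resolventOf (h : ClosedForm E) {z : ℂ} (hz : z.im ≠ 0) :
    (resolventOf h.operator z).adjoint = resolventOf h.operator (conj z) := by
  obtain ⟨z₀, T, hT⟩ := h.exists_hasRealResolvent
  exact hT.adjoint_resolventOf' hz

theorem exists_resolventOf (h : ClosedForm E) {z : ℂ} (hz : z.im ≠ 0) (f : E) :
    ∃ d : h.Dom, h.incl d = resolventOf h.operator z f ∧
      ∀ φ, h.form d φ = ⟪f + z • h.incl d, h.incl φ⟫_ℂ := by
  obtain ⟨d, hd, hd'⟩ := h.mem_operator_graph_iff.1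
    ((isResolvent_resolventOf (h.mem_resolventSetOf hz)).1 f)
  exact ⟨d, hd, hd ▸ hd'⟩

theorem norm_resolventOf_le (h : ClosedForm E) {z : ℂ} (hz : z.im ≠ 0) (f : E) :
    ‖resolventOf h.operator z f‖ ≤ ‖f‖ / |z.im| := by
  obtain ⟨z₀, T, hT⟩ := h.exists_hasRealResolvent
  rw [le_div_iff₀ (abs_pos.2 hz), mul_comm]
  exact hT.norm_resolventOf_le hz f

/-- `C ≥ 1` allows `C` to be pulled out of the sum, so that each form norm costs one factor `√C` and
a constant depending on `z` only. -/
theorem norm_le_resolventConst (h : ClosedForm E) {C : ℝ} (hC1 : 1 ≤ C) (hC : h.NormBound C) {z : ℂ}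
    (hz : z.im ≠ 0) {f : E} {d : h.Dom} (hdz : h.incl d = resolventOf h.operator z f)
    (hd : ∀ φ, h.form d φ = ⟪f + z • h.incl d, h.incl φ⟫_ℂ) :
    ‖d‖ ≤ resolventConst z * √C * ‖f‖ := by
  have h1 := h.norm_sq_le hC hd
  have h2 := h.norm_resolventOf_le hz f
  rw [← hdz] at h2
  have hy : 0 < |z.im| := abs_pos.2 hz
  have h3 : (⟪f, h.incl d⟫_ℂ).re ≤ ‖f‖ * (‖f‖ / |z.im|) :=
    (re_inner_le_norm (𝕜 := ℂ) f (h.incl d)).trans (by gcongr)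
  refine (sq_le_sq₀ (norm_nonneg _)
    (mul_nonneg (mul_nonneg (resolventConst_nonneg z) (Real.sqrt_nonneg _)) (norm_nonneg _))).1 ?_
  rw [mul_pow, mul_pow, resolventConst_sq, Real.sq_sqrt (by linarith)]
  have h4 : ‖h.incl d‖ ^ 2 ≤ (‖f‖ / |z.im|) ^ 2 := by gcongr
  calc ‖d‖ ^ 2 ≤ 2 * (‖f‖ * (‖f‖ / |z.im|) + (|z.re| + C) * (‖f‖ / |z.im|) ^ 2) := by
        refine h1.trans ?_
        gcongr
    _ = 2 * (1 / |z.im| + (|z.re| + C) / |z.im| ^ 2) * ‖f‖ ^ 2 := by ring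
    _ ≤ 2 * ((1 / |z.im|) * C + (|z.re| * C + C) / |z.im| ^ 2) * ‖f‖ ^ 2 := by
        gcongr
        · exact le_mul_of_one_le_right (by positivity) hC1
        · exact le_mul_of_one_le_right (by positivity) hC1
    _ = _ := by ring

theorem norm_add_smul_le (h : ClosedForm E) {z : ℂ} (hz : z.im ≠ 0) (f : E) :
    ‖f + z • resolventOf h.operator z f‖ ≤ (1 + ‖z‖ / |z.im|) * ‖f‖ := by
  refine (norm_add_le _ _).trans ?_
  rw [norm_smul, add_mul, one_mul]
  have := h.norm_resolventOf_le hz f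
  calc ‖f‖ + ‖z‖ * ‖resolventOf h.operator z f‖ ≤ ‖f‖ + ‖z‖ * (‖f‖ / |z.im|) := by gcongr
    _ = _ := by ring

end ClosedForm

/-- Quasi-unitarily equivalent forms, with given identification operators and norm bounds. -/
structure FormQUEData {E : Type u} [NormedAddCommGroup E] [InnerProductSpace ℂ E] [CompleteSpace E]
    {F : Type v} [NormedAddCommGroup F] [InnerProductSpace ℂ F] [CompleteSpace F]
    (δ C : ℝ) (J : E →L[ℂ] F) (h : ClosedForm E) (k : ClosedForm F)
    (J₁ : h.Dom →L[ℂ] k.Dom) (J₁' : k.Dom →L[ℂ] h.Dom) : Prop where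
  pos : 0 < δ
  one_le : 1 ≤ C
  left : ∀ f : h.Dom, ‖J (h.incl f) - k.incl (J₁ f)‖ ≤ δ * ‖f‖
  right : ∀ g : k.Dom, ‖J.adjoint (k.incl g) - h.incl (J₁' g)‖ ≤ δ * ‖g‖
  left_inv : ∀ f : h.Dom, ‖J.adjoint (J (h.incl f)) - h.incl f‖ ≤ δ * ‖f‖
  right_inv : ∀ g : k.Dom, ‖J (J.adjoint (k.incl g)) - k.incl g‖ ≤ δ * ‖g‖
  form : ∀ (f : h.Dom) (g : k.Dom), ‖h.form (J₁' g) f - k.form g (J₁ f)‖ ≤ δ * ‖g‖ * ‖f‖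
  bound : h.NormBound C
  bound' : k.NormBound C

variable {E : Type u} [NormedAddCommGroup E] [InnerProductSpace ℂ E] [CompleteSpace E]
  {F : Type v} [NormedAddCommGroup F] [InnerProductSpace ℂ F] [CompleteSpace F]
  {δ C : ℝ} {J : E →L[ℂ] F} {h : ClosedForm E} {k : ClosedForm F}
  {J₁ : h.Dom →L[ℂ] k.Dom} {J₁' : k.Dom →L[ℂ] h.Dom}

theorem FormQUE.exists_data (hδ : 0 < δ) (hC : 1 ≤ C) (hQ : FormQUE δ J h k)
    (hh : h.NormBound C) (hk : k.NormBound C) : ∃ J₁ J₁', FormQUEData δ C J h k J₁ J₁' := by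
  obtain ⟨J₁, J₁', h1, h2, h3, h4, h5⟩ := hQ
  have key : ∀ {a b : ℝ}, 0 ≤ a → 0 ≤ b → a ^ 2 ≤ δ ^ 2 * b ^ 2 → a ≤ δ * b :=
    fun ha hb hab => (sq_le_sq₀ ha (mul_nonneg hδ.le hb)).1 (by rwa [mul_pow])
  exact ⟨J₁, J₁', hδ, hC, fun f => key (norm_nonneg _) (norm_nonneg _) (h1 f),
    fun f => key (norm_nonneg _) (norm_nonneg _) (h2 f),
    fun f => key (norm_nonneg _) (norm_nonneg _) (h3 f),
    fun f => key (norm_nonneg _) (norm_nonneg _) (h4 f), h5, hh, hk⟩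

namespace FormQUEData

theorem norm_sq_le (H : FormQUEData δ C J h k J₁ J₁') (f : h.Dom) :
    ‖J (h.incl f)‖ ^ 2 ≤ ‖h.incl f‖ ^ 2 + δ * ‖f‖ * ‖h.incl f‖ := by
  have h1 := (abs_le.1 (abs_norm_sq_sub_le J (h.incl f))).2
  have h2 := mul_le_mul_of_nonneg_right (H.left_inv f) (norm_nonneg (h.incl f))
  linarith

theorem norm_adjoint_sq_le (H : FormQUEData δ C J h k J₁ J₁') (g : k.Dom) :
    ‖J.adjoint (k.incl g)‖ ^ 2 ≤ ‖k.incl g‖ ^ 2 + δ * ‖g‖ * ‖k.incl g‖ := by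
  have h1 := (abs_le.1 (abs_norm_sq_sub_le J.adjoint (k.incl g))).2
  rw [ContinuousLinearMap.adjoint_adjoint] at h1
  have h2 := mul_le_mul_of_nonneg_right (H.right_inv g) (norm_nonneg (k.incl g))
  linarith

/-- The commutator of the operators with the identification operator, in the weak sense. -/
theorem norm_inner_sub_inner_le (H : FormQUEData δ C J h k J₁ J₁') {d : h.Dom} {e : k.Dom} {w : E}
    {x : F} (hd : ∀ φ, h.form d φ = ⟪w, h.incl φ⟫_ℂ) (he : ∀ φ, k.form e φ = ⟪x, k.incl φ⟫_ℂ) :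
    ‖⟪x, J (h.incl d)⟫_ℂ - ⟪J.adjoint (k.incl e), w⟫_ℂ‖ ≤
      δ * (‖x‖ * ‖d‖ + ‖e‖ * ‖d‖ + ‖e‖ * ‖w‖) := by
  -- Inserting `J₁ d` and `J₁' e` turns the two inner products into the form values, up to the
  -- errors in the definition of quasi-unitary equivalence.
  have h1 : ⟪x, J (h.incl d)⟫_ℂ - ⟪J.adjoint (k.incl e), w⟫_ℂ =
      ⟪x, J (h.incl d) - k.incl (J₁ d)⟫_ℂ - (h.form (J₁' e) d - k.form e (J₁ d))
        - ⟪J.adjoint (k.incl e) - h.incl (J₁' e), w⟫_ℂ := by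
    rw [inner_sub_right, inner_sub_left, he, h.hermitian, hd, inner_conj_symm]; ring
  rw [h1]
  have h2 : ‖⟪x, J (h.incl d) - k.incl (J₁ d)⟫_ℂ‖ ≤ ‖x‖ * (δ * ‖d‖) :=
    (norm_inner_le_norm _ _).trans (by gcongr; exact H.left d)
  have h3 : ‖⟪J.adjoint (k.incl e) - h.incl (J₁' e), w⟫_ℂ‖ ≤ (δ * ‖e‖) * ‖w‖ :=
    (norm_inner_le_norm _ _).trans (by gcongr; exact H.right e)
  have h4 := H.form d e
  refine (norm_sub_le _ _).trans ((add_le_add (norm_sub_le _ _) le_rfl).trans ?_)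
  linarith

/-- The weak commutator is applied to `d = (H - z)⁻¹ f` and to `e`, the resolvent of the second
operator at `conj z` applied to `g`; the terms with `z` cancel. Two form norms give `√C · √C = C`.
-/
theorem norm_comm_le (H : FormQUEData δ C J h k J₁ J₁') {z : ℂ} (hz : z.im ≠ 0) :
    ‖J ∘L resolventOf h.operator z - resolventOf k.operator z ∘L J‖ ≤
      (2 * (1 + ‖z‖ / |z.im|) * resolventConst z + resolventConst z ^ 2) * C * δ := by
  have hC0 : 0 ≤ C := zero_le_one.trans H.one_le
  have ha := resolventConst_nonneg z
  have hδ := H.pos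
  refine ContinuousLinearMap.opNorm_le_of_unit_inner _ (by positivity) fun f g hf hg => ?_
  have hz' : (conj z).im ≠ 0 := by simpa using hz
  obtain ⟨d, hdz, hd⟩ := h.exists_resolventOf hz f
  obtain ⟨e, hez, he⟩ := k.exists_resolventOf hz' g
  have h1 := H.norm_inner_sub_inner_le hd he
  have h2 := h.norm_le_resolventConst H.one_le H.bound hz hdz hd
  have h3 := k.norm_le_resolventConst H.one_le H.bound' hz' hez he
  have h4 := h.norm_add_smul_le hz f
  have h5 := k.norm_add_smul_le hz' g
  rw [← hdz] at h4
  rw [← hez] at h5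
  rw [resolventConst_conj] at h3
  rw [Complex.norm_conj, Complex.conj_im, abs_neg] at h5
  rw [hf, mul_one] at h2 h4
  rw [hg, mul_one] at h3 h5
  have h6 : ⟪g, (J ∘L resolventOf h.operator z - resolventOf k.operator z ∘L J) f⟫_ℂ =
      ⟪g + conj z • k.incl e, J (h.incl d)⟫_ℂ - ⟪J.adjoint (k.incl e), f + z • h.incl d⟫_ℂ := by
    have h7 : ⟪g, resolventOf k.operator z (J f)⟫_ℂ = ⟪k.incl e, J f⟫_ℂ := by
      rw [hez, ← k.adjoint_resolventOf hz, ContinuousLinearMap.adjoint_inner_left]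
    rw [sub_apply, ContinuousLinearMap.comp_apply, ContinuousLinearMap.comp_apply, inner_sub_right,
      h7, inner_add_left, inner_smul_left, Complex.conj_conj, ContinuousLinearMap.adjoint_inner_left,
      map_add, map_smul, inner_add_right, inner_smul_right, hdz]
    ring
  rw [h6]
  refine h1.trans ?_
  set m := 1 + ‖z‖ / |z.im|
  set a := resolventConst z
  have hs : √C ^ 2 = C := Real.sq_sqrt hC0
  have hs1 : 1 ≤ √C := Real.one_le_sqrt.2 H.one_le
  have hm : 0 ≤ m := by positivity
  calc δ * (‖g + conj z • k.incl e‖ * ‖d‖ + ‖e‖ * ‖d‖ + ‖e‖ * ‖f + z • h.incl d‖)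
      ≤ δ * (m * (a * √C) + (a * √C) * (a * √C) + (a * √C) * m) := by gcongr
    _ = (2 * m * a * √C + a ^ 2 * √C ^ 2) * δ := by ring
    _ ≤ (2 * m * a * √C ^ 2 + a ^ 2 * √C ^ 2) * δ := by
        gcongr
        nlinarith
    _ = _ := by rw [hs]; ring

/-- At `±i` the resolvent constant is 2, and the commutator constant is `2 · (1 + 1) · 2 + 2² = 12`.
-/
theorem operatorQUE (H : FormQUEData δ C J h k J₁ J₁') :
    OperatorQUE (12 * C * δ) J h.operator k.operator := by
  intro z hz
  have hzim : z.im ≠ 0 := by rcases hz with rfl | rfl <;> simp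
  have hC0 : 0 ≤ C := zero_le_one.trans H.one_le
  have hδ := H.pos
  have hy : |z.im| = 1 := by rcases hz with rfl | rfl <;> simp
  have hre : z.re = 0 := by rcases hz with rfl | rfl <;> simp
  have hn : ‖z‖ = 1 := by rcases hz with rfl | rfl <;> simp
  have ha : resolventConst z = 2 := by
    rw [resolventConst, hy, hre, show (2 : ℝ) * (1 / 1 + (|0| + 1) / 1 ^ 2) = 2 ^ 2 by norm_num,
      Real.sqrt_sq (by norm_num)]
  have hs : √C ≤ C := by
    rw [Real.sqrt_le_left hC0]; nlinarith [H.one_le]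
  refine ⟨?_, ?_, ?_⟩
  · refine ContinuousLinearMap.opNorm_le_bound _ (by positivity) fun f => ?_
    obtain ⟨d, hdz, hd⟩ := h.exists_resolventOf hzim f
    have h2 := h.norm_le_resolventConst H.one_le H.bound hzim hdz hd
    have h3 := H.left_inv d
    rw [hdz, norm_sub_rev] at h3
    refine h3.trans ?_
    rw [ha] at h2
    calc δ * ‖d‖ ≤ δ * (2 * C * ‖f‖) := by
          gcongr; exact h2.trans (by gcongr)
      _ = 2 * (C * δ * ‖f‖) := by ring
      _ ≤ 12 * (C * δ * ‖f‖) := by gcongr; norm_num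
      _ = _ := by ring
  · refine ContinuousLinearMap.opNorm_le_bound _ (by positivity) fun f => ?_
    obtain ⟨d, hdz, hd⟩ := k.exists_resolventOf hzim f
    have h2 := k.norm_le_resolventConst H.one_le H.bound' hzim hdz hd
    have h3 := H.right_inv d
    rw [hdz, norm_sub_rev] at h3
    refine h3.trans ?_
    rw [ha] at h2
    calc δ * ‖d‖ ≤ δ * (2 * C * ‖f‖) := by
          gcongr; exact h2.trans (by gcongr)
      _ = 2 * (C * δ * ‖f‖) := by ring
      _ ≤ 12 * (C * δ * ‖f‖) := by gcongr; norm_num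
      _ = _ := by ring
  · have := H.norm_comm_le hzim
    rw [ha, hy, hn] at this
    norm_num at this
    exact this

end FormQUEData

end FormEstimates

/-! ### The estimate of `J R J† - R̃` without the norm of `J` -/

section Sandwich

variable {E : Type u} [NormedAddCommGroup E] [InnerProductSpace ℂ E] [CompleteSpace E]
  {F : Type v} [NormedAddCommGroup F] [InnerProductSpace ℂ F] [CompleteSpace F]
  {δ C : ℝ} {J : E →L[ℂ] F} {h : ClosedForm E} {k : ClosedForm F}
  {J₁ : h.Dom →L[ℂ] k.Dom} {J₁' : k.Dom →L[ℂ] h.Dom}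

/-- A constant that dominates all quantities at `z` that enter the resolvent estimates. -/
noncomputable def dominatingConst (z : ℂ) : ℝ :=
  1 + 1 / |z.im| + 1 / |z.im| ^ 2 + resolventConst z / |z.im| + resolventConst z + ‖z‖
    + ‖z‖ / |z.im|

theorem dominatingConst_spec (z : ℂ) : 1 ≤ dominatingConst z ∧ 1 / |z.im| ≤ dominatingConst z ∧
    1 / |z.im| ^ 2 ≤ dominatingConst z ∧ resolventConst z / |z.im| ≤ dominatingConst z ∧
    resolventConst z ≤ dominatingConst z ∧ ‖z‖ ≤ dominatingConst z ∧
    1 + ‖z‖ / |z.im| ≤ dominatingConst z := by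
  have h1 : 0 ≤ 1 / |z.im| := by positivity
  have h2 : 0 ≤ 1 / |z.im| ^ 2 := by positivity
  have h3 : 0 ≤ resolventConst z := resolventConst_nonneg z
  have h4 : 0 ≤ resolventConst z / |z.im| := by positivity
  have h5 : 0 ≤ ‖z‖ := norm_nonneg z
  have h6 : 0 ≤ ‖z‖ / |z.im| := by positivity
  unfold dominatingConst
  refine ⟨?_, ?_, ?_, ?_, ?_, ?_, ?_⟩ <;> linarith

theorem dominatingConst_conj (z : ℂ) : dominatingConst (conj z) = dominatingConst z := by
  simp [dominatingConst, resolventConst_conj]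

namespace FormQUEData

/-- The bound of `J (H - z)⁻¹` that does not use the norm of `J`. -/
theorem norm_sq_resolventOf_le (H : FormQUEData δ C J h k J₁ J₁') {z : ℂ} (hz : z.im ≠ 0) (f : E) :
    ‖J (resolventOf h.operator z f)‖ ^ 2 ≤ dominatingConst z * (1 + δ * √C) * ‖f‖ ^ 2 := by
  obtain ⟨d, hdz, hd⟩ := h.exists_resolventOf hz f
  obtain ⟨-, -, hK2, hK3, -, -, -⟩ := dominatingConst_spec z
  have h1 := H.norm_sq_le d
  have h2 := h.norm_resolventOf_le hz f
  have h3 := h.norm_le_resolventConst H.one_le H.bound hz hdz hd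
  rw [← hdz] at h2 ⊢
  have hδ := H.pos
  have ha := resolventConst_nonneg z
  calc ‖J (h.incl d)‖ ^ 2
      ≤ (‖f‖ / |z.im|) ^ 2 + δ * (resolventConst z * √C * ‖f‖) * (‖f‖ / |z.im|) := by
        refine h1.trans ?_
        gcongr
    _ = (1 / |z.im| ^ 2 + δ * √C * (resolventConst z / |z.im|)) * ‖f‖ ^ 2 := by ring
    _ ≤ (dominatingConst z + δ * √C * dominatingConst z) * ‖f‖ ^ 2 := by gcongr
    _ = _ := by ring

/-- By duality from the preceding bound: `‖w‖² = ⟪f, J R(conj z) w⟫`, after which one factor `‖w‖²`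
cancels. -/
theorem norm_sq_resolventOf_adjoint_le (H : FormQUEData δ C J h k J₁ J₁') {z : ℂ} (hz : z.im ≠ 0)
    (f : F) : ‖resolventOf h.operator z (J.adjoint f)‖ ^ 2 ≤
      dominatingConst z * (1 + δ * √C) * ‖f‖ ^ 2 := by
  have hz' : (conj z).im ≠ 0 := by simpa using hz
  set w := resolventOf h.operator z (J.adjoint f) with hw
  have h1 := H.norm_sq_resolventOf_le hz' w
  rw [dominatingConst_conj] at h1
  have h2 : ‖w‖ ^ 2 ≤ ‖f‖ * ‖J (resolventOf h.operator (conj z) w)‖ := by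
    have h3 : ⟪w, w⟫_ℂ = ⟪f, J (resolventOf h.operator (conj z) w)⟫_ℂ := by
      nth_rewrite 1 [hw]
      rw [← h.adjoint_resolventOf hz, ← ContinuousLinearMap.adjoint_inner_left J,
        ContinuousLinearMap.adjoint_inner_right]
    have h4 := norm_inner_le_norm (𝕜 := ℂ) f (J (resolventOf h.operator (conj z) w))
    rwa [← h3, inner_self_eq_norm_sq_to_K, norm_pow, RCLike.norm_ofReal, abs_norm] at h4
  have hM : 0 ≤ dominatingConst z * (1 + δ * √C) := by
    have := (dominatingConst_spec z).1
    have := H.pos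
    positivity
  set M := dominatingConst z * (1 + δ * √C)
  have h5 : (‖w‖ ^ 2) ^ 2 ≤ (M * ‖f‖ ^ 2) * ‖w‖ ^ 2 := by
    calc (‖w‖ ^ 2) ^ 2 ≤ (‖f‖ * ‖J (resolventOf h.operator (conj z) w)‖) ^ 2 := by gcongr
      _ = ‖f‖ ^ 2 * ‖J (resolventOf h.operator (conj z) w)‖ ^ 2 := by ring
      _ ≤ ‖f‖ ^ 2 * (M * ‖w‖ ^ 2) := by gcongr
      _ = _ := by ring
  rcases (sq_nonneg ‖w‖).eq_or_lt with h0 | h0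
  · rw [← h0]; positivity
  · rw [pow_two (‖w‖ ^ 2)] at h5
    exact le_of_mul_le_mul_right h5 h0

/-- The form norm of `J'¹` on the range of the resolvent. -/
theorem norm_right_le (H : FormQUEData δ C J h k J₁ J₁') {K s : ℝ} (hs : s ^ 2 = C) (hs1 : 1 ≤ s)
    (hK : 1 ≤ K) (hβ : δ * s ^ 2 ≤ 1) {v : k.Dom} {x : F}
    (hv : ∀ φ, k.form v φ = ⟪x, k.incl φ⟫_ℂ) (hx : ‖x‖ ≤ K) (hv0 : ‖k.incl v‖ ≤ K)
    (hv1 : ‖v‖ ≤ K * s) : ‖J₁' v‖ ≤ 9 * K * s := by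
  have hδ := H.pos
  have hs0 : 0 < s := by linarith
  have hK0 : 0 < K := by linarith
  have hδs : δ * s ≤ 1 := by nlinarith
  have hδ1 : δ ≤ 1 := by nlinarith
  set P := ‖J₁' v‖ with hP
  set n := ‖h.incl (J₁' v)‖ with hn
  have hP0 : 0 ≤ P := norm_nonneg _
  have hn0 : 0 ≤ n := norm_nonneg _
  have hδV : δ * ‖v‖ ≤ K := by
    calc δ * ‖v‖ ≤ δ * (K * s) := by gcongr
      _ = K * (δ * s) := by ring
      _ ≤ K * 1 := by gcongr
      _ = K := mul_one K
  have h1 : ‖J.adjoint (k.incl v)‖ ≤ 2 * K := by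
    refine (sq_le_sq₀ (norm_nonneg _) (by positivity)).1 ((H.norm_adjoint_sq_le v).trans ?_)
    calc ‖k.incl v‖ ^ 2 + δ * ‖v‖ * ‖k.incl v‖ ≤ K ^ 2 + K * K := by gcongr
      _ ≤ _ := by nlinarith
  have h2 : n ≤ 3 * K := by
    have h3 := norm_sub_norm_le (h.incl (J₁' v)) (J.adjoint (k.incl v))
    rw [norm_sub_rev] at h3
    linarith [H.right v]
  have h3 : ‖J (h.incl (J₁' v))‖ ≤ n + δ * P := by
    refine (sq_le_sq₀ (norm_nonneg _) (by positivity)).1 ((H.norm_sq_le _).trans ?_)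
    have : 0 ≤ δ * P := by positivity
    nlinarith [mul_nonneg this hn0, sq_nonneg (δ * P)]
  have h4 : ‖k.incl (J₁ (J₁' v))‖ ≤ n + 2 * (δ * P) := by
    have h5 := norm_sub_norm_le (k.incl (J₁ (J₁' v))) (J (h.incl (J₁' v)))
    rw [norm_sub_rev] at h5
    linarith [H.left (J₁' v)]
  -- The form of `J₁' v` is traded for the form of `v` against `J₁ J₁' v`, which the equation for
  -- `v` makes an inner product. The result is a quadratic inequality for `P`; the constant 9 works
  -- because `9² > 6 · 9 + 24`.
  have h5 : (h.form (J₁' v) (J₁' v)).re ≤ δ * ‖v‖ * P + K * (n + 2 * (δ * P)) := by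
    have h6 := H.form (J₁' v) v
    have h7 : ‖k.form v (J₁ (J₁' v))‖ ≤ K * (n + 2 * (δ * P)) := by
      rw [hv]
      exact (norm_inner_le_norm _ _).trans (by gcongr)
    have h8 := norm_sub_norm_le (h.form (J₁' v) (J₁' v)) (k.form v (J₁ (J₁' v)))
    have h9 := Complex.re_le_norm (h.form (J₁' v) (J₁' v))
    linarith
  have h6 := H.bound (J₁' v)
  rw [← hs] at h6
  have h7 : P ^ 2 ≤ 6 * (K * P) + 24 * (K ^ 2 * s ^ 2) := by
    have h8 : s ^ 2 * n ^ 2 ≤ s ^ 2 * (3 * K) ^ 2 := by gcongr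
    have h9 : δ * ‖v‖ * P ≤ K * P := by gcongr
    have h10 : K * (n + 2 * (δ * P)) ≤ K * (3 * K + 2 * (1 * P)) := by gcongr
    have h11 : K ^ 2 * 1 ≤ K ^ 2 * s ^ 2 := by gcongr; exact one_le_pow₀ hs1
    change P ^ 2 ≤ 2 * (_ + s ^ 2 * n ^ 2) at h6
    linarith
  by_contra hc
  push Not at hc
  have h8 : K * P ≤ K * P * s := le_mul_of_one_le_right (by positivity) hs1
  have h9 : 0 < K * s := by positivity
  have h10 : P * (9 * K * s) ≤ P * P := by gcongr
  have h11 : (9 * K * s) * (K * s) ≤ P * (K * s) := by gcongr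
  linarith [sq_pos_of_pos h9]

/-- The norm bounds of `w = (H - z)⁻¹ J† f` for a unit vector `f`. -/
theorem norm_left_le (H : FormQUEData δ C J h k J₁ J₁') {z : ℂ} {K s : ℝ} (hs : s ^ 2 = C)
    (hs1 : 1 ≤ s) (hK : 1 ≤ K) (hβ : δ * s ^ 2 ≤ 1) (hzK : ‖z‖ ≤ K) {w : h.Dom} {f : F}
    (hf : ‖f‖ = 1) (hw : ∀ φ, h.form w φ = ⟪J.adjoint f + z • h.incl w, h.incl φ⟫_ℂ)
    (hw0 : ‖h.incl w‖ ^ 2 ≤ K * (1 + δ * s)) : ‖h.incl w‖ ≤ 2 * K ∧ ‖w‖ ≤ 4 * (K * s) := by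
  have hδ := H.pos
  have hs0 : 0 < s := by linarith
  have hK0 : 0 < K := by linarith
  have hδs : δ * s ≤ 1 := by nlinarith
  have hδ1 : δ ≤ 1 := by nlinarith
  set N := ‖h.incl w‖ with hN
  set W := ‖w‖ with hW
  set X := ‖J (h.incl w)‖ with hX
  have hN0 : 0 ≤ N := norm_nonneg _
  have hW0 : 0 ≤ W := norm_nonneg _
  have hX0 : 0 ≤ X := norm_nonneg _
  have hN2 : N ^ 2 ≤ 2 * K := by
    calc N ^ 2 ≤ K * (1 + δ * s) := hw0
      _ ≤ K * (1 + 1) := by gcongr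
      _ = _ := by ring
  have hKK : K ≤ K ^ 2 := le_self_pow₀ hK two_ne_zero
  have hN1 : N ≤ 2 * K := by
    refine (sq_le_sq₀ hN0 (by positivity)).1 ?_
    rw [mul_pow]; linarith
  refine ⟨hN1, ?_⟩
  have hWX : W ^ 2 ≤ 2 * X + 8 * (K ^ 2 * s ^ 2) := by
    have h1 := h.norm_sq_le H.bound hw
    have h2 : (⟪J.adjoint f, h.incl w⟫_ℂ).re ≤ X := by
      rw [ContinuousLinearMap.adjoint_inner_left]
      have := re_inner_le_norm (𝕜 := ℂ) f (J (h.incl w))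
      rw [hf, one_mul] at this
      exact this
    have h3 : |z.re| + C ≤ 2 * K * s ^ 2 := by
      have h4 := (Complex.abs_re_le_norm z).trans hzK
      rw [← hs]
      have h5 : (1 : ℝ) ≤ s ^ 2 := one_le_pow₀ hs1
      have h6 : K * 1 ≤ K * s ^ 2 := by gcongr
      have h7 : 1 * s ^ 2 ≤ K * s ^ 2 := by gcongr
      linarith
    have h4 : (|z.re| + C) * N ^ 2 ≤ 2 * K * s ^ 2 * (2 * K) := by gcongr
    change W ^ 2 ≤ 2 * (_ + (|z.re| + C) * N ^ 2) at h1
    linarith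
  -- `W` and `X` bound each other: the form norm uses `X = ‖J w‖`, and `X` uses `δ W`. Since `δ` and
  -- `δ s` are at most 1 the loop closes as `X² ≤ X + 7 K²`, and `16 > 4 + 7`.
  have hXb : X ≤ 4 * K := by
    have h1 : X ^ 2 ≤ N ^ 2 + δ * W * N := H.norm_sq_le w
    have h2 : δ * W * N ≤ (δ ^ 2 * W ^ 2 + N ^ 2) / 2 := by linarith [sq_nonneg (δ * W - N)]
    have h3 : δ ^ 2 * W ^ 2 ≤ 2 * X + 8 * K ^ 2 := by
      have h4 : δ ^ 2 * W ^ 2 ≤ δ ^ 2 * (2 * X + 8 * (K ^ 2 * s ^ 2)) := by gcongr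
      have h5 : δ ^ 2 ≤ 1 := pow_le_one₀ hδ.le hδ1
      have h6 : (δ * s) ^ 2 ≤ 1 := pow_le_one₀ (by positivity) hδs
      have h7 : δ ^ 2 * (2 * X) ≤ 1 * (2 * X) := by gcongr
      have h8 : (δ * s) ^ 2 * (8 * K ^ 2) ≤ 1 * (8 * K ^ 2) := by gcongr
      linarith
    have h4 : X ^ 2 ≤ X + 7 * K ^ 2 := by linarith
    by_contra hc
    push Not at hc
    have h5 : X * (4 * K) ≤ X * X := by gcongr
    have h6 : (4 * K) * K ≤ X * K := by gcongr
    have h7 : X * 1 ≤ X * K := by gcongr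
    linarith [sq_pos_of_pos hK0]
  refine (sq_le_sq₀ hW0 (by positivity)).1 (hWX.trans ?_)
  have : K * 1 ≤ K ^ 2 * s ^ 2 := by
    gcongr; exact one_le_pow₀ hs1
  rw [mul_pow, mul_pow]
  linarith

/-- The identification operator on the difference of `J'¹ v` and `J† v`. -/
theorem norm_map_sub_le (H : FormQUEData δ C J h k J₁ J₁') {L : ℝ} (hL : 0 < L) {v : k.Dom}
    (hv1 : δ * ‖v‖ ≤ L) (hP : δ * ‖J₁' v‖ ≤ 9 * L) :
    ‖J (h.incl (J₁' v) - J.adjoint (k.incl v))‖ ≤ 4 * L := by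
  have hδ := H.pos
  set P := ‖J₁' v‖ with hPdef
  set e := h.incl (J₁' v) - J.adjoint (k.incl v) with he
  have heb : ‖e‖ ≤ L := by
    rw [he, norm_sub_rev]
    exact (H.right v).trans hv1
  set G := ‖J e‖ with hG
  have hG0 : 0 ≤ G := norm_nonneg _
  -- A bound by `‖J‖ ‖e‖` is not admissible. The expansion lets only `J† J - 1` and `J J† - 1` act,
  -- each on vectors from a form domain.
  have h1 : ⟪J e, J e⟫_ℂ = ⟪J.adjoint (J (h.incl (J₁' v))) - h.incl (J₁' v), e⟫_ℂ + ⟪e, e⟫_ℂ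
      - ⟪J (J.adjoint (k.incl v)) - k.incl v, J e⟫_ℂ := by
    have h2 : ⟪J e, J e⟫_ℂ = ⟪J (h.incl (J₁' v)), J e⟫_ℂ
        - ⟪J (J.adjoint (k.incl v)), J e⟫_ℂ := by
      rw [← inner_sub_left, ← map_sub]
    have h3 : ⟪e, e⟫_ℂ = ⟪h.incl (J₁' v), e⟫_ℂ - ⟪J.adjoint (k.incl v), e⟫_ℂ := by
      rw [← inner_sub_left]
    rw [h2, h3, inner_sub_left, inner_sub_left, ContinuousLinearMap.adjoint_inner_left,
      ContinuousLinearMap.adjoint_inner_left]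
    ring
  have h2 : G ^ 2 ≤ δ * P * ‖e‖ + ‖e‖ ^ 2 + δ * ‖v‖ * G := by
    have h4 : ‖⟪J e, J e⟫_ℂ‖ = G ^ 2 := by
      rw [inner_self_eq_norm_sq_to_K, norm_pow, RCLike.norm_ofReal, abs_norm]
    have h5 : ‖⟪e, e⟫_ℂ‖ = ‖e‖ ^ 2 := by
      rw [inner_self_eq_norm_sq_to_K, norm_pow, RCLike.norm_ofReal, abs_norm]
    rw [← h4, h1, ← h5]
    refine (norm_sub_le _ _).trans (add_le_add ((norm_add_le _ _).trans (add_le_add ?_ le_rfl)) ?_)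
    · exact (norm_inner_le_norm _ _).trans (by gcongr; exact H.left_inv _)
    · exact (norm_inner_le_norm _ _).trans (by gcongr; exact H.right_inv _)
  have h3 : G ^ 2 ≤ 10 * L ^ 2 + L * G := by
    calc G ^ 2 ≤ 9 * L * L + L ^ 2 + L * G := by
          refine h2.trans ?_
          gcongr
      _ = _ := by ring
  by_contra hc
  push Not at hc
  have h4 : G * (4 * L) ≤ G * G := by gcongr
  have h5 : (4 * L) * L ≤ G * L := by gcongr
  linarith [sq_pos_of_pos hL]

/-- The case `C δ ≤ 1`, with `s = √C`: here the a priori bounds on `J₁' v` and `w` close, and every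
error term is at most a multiple of `K³ δ s²`. -/
theorem norm_sandwich_le_of_le (H : FormQUEData δ C J h k J₁ J₁') {z : ℂ} {K s : ℝ} (hs : s ^ 2 = C)
    (hs1 : 1 ≤ s) (hK : 1 ≤ K) (hβ : δ * s ^ 2 ≤ 1) (hzK : ‖z‖ ≤ K) {v : k.Dom} {w : h.Dom}
    {f g : F} (hf : ‖f‖ = 1) (hv : ∀ φ, k.form v φ = ⟪g + conj z • k.incl v, k.incl φ⟫_ℂ)
    (hw : ∀ φ, h.form w φ = ⟪J.adjoint f + z • h.incl w, h.incl φ⟫_ℂ)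
    (hx : ‖g + conj z • k.incl v‖ ≤ K) (hv0 : ‖k.incl v‖ ≤ K)
    (hv1 : ‖v‖ ≤ K * s) (hw0 : ‖h.incl w‖ ^ 2 ≤ K * (1 + δ * s)) :
    ‖⟪g, J (h.incl w)⟫_ℂ - ⟪k.incl v, f⟫_ℂ‖ ≤ 15 * K ^ 3 * (δ * s ^ 2) := by
  have hδ := H.pos
  have hs0 : 0 < s := by linarith
  have hK0 : 0 < K := by linarith
  have hδsβ : δ * s ≤ δ * s ^ 2 := by
    gcongr; nlinarith
  have hP := H.norm_right_le hs hs1 hK hβ hv hx hv0 hv1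
  obtain ⟨hN1, hWb⟩ := H.norm_left_le hs hs1 hK hβ hzK hf hw hw0
  have hGb := H.norm_map_sub_le (L := K * (δ * s)) (by positivity) (v := v)
    (by calc δ * ‖v‖ ≤ δ * (K * s) := by gcongr
          _ = _ := by ring)
    (by calc δ * ‖J₁' v‖ ≤ δ * (9 * K * s) := by gcongr
          _ = _ := by ring)
  set x := g + conj z • k.incl v with hxdef
  set e := h.incl (J₁' v) - J.adjoint (k.incl v) with he
  -- The weak equation of `w` has the source `J† f`. Pairing it with `J₁' v` gives `⟪J J₁' v, f⟫`,
  -- which is replaced by `⟪J J† v, f⟫` at the cost of `⟪J e, f⟫`, and then by `⟪v, f⟫`.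
  have hmain : ⟪g, J (h.incl w)⟫_ℂ - ⟪k.incl v, f⟫_ℂ =
      (⟪x, J (h.incl w) - k.incl (J₁ w)⟫_ℂ - (h.form (J₁' v) w - k.form v (J₁ w))
        - z * ⟪J.adjoint (k.incl v) - h.incl (J₁' v), h.incl w⟫_ℂ)
        + (⟪J e, f⟫_ℂ + ⟪J (J.adjoint (k.incl v)) - k.incl v, f⟫_ℂ) := by
    have h1 : h.form (J₁' v) w = ⟪J (h.incl (J₁' v)), f⟫_ℂ + z * ⟪h.incl (J₁' v), h.incl w⟫_ℂ := by
      rw [h.hermitian, hw, inner_conj_symm, inner_add_right, inner_smul_right,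
        ContinuousLinearMap.adjoint_inner_right]
    have h2 : ⟪x, J (h.incl w)⟫_ℂ = ⟪g, J (h.incl w)⟫_ℂ + z * ⟪k.incl v, J (h.incl w)⟫_ℂ := by
      rw [hxdef, inner_add_left, inner_smul_left, Complex.conj_conj]
    rw [inner_sub_right, ← hv, h1, h2, he, map_sub, inner_sub_left, inner_sub_left, inner_sub_left,
      ContinuousLinearMap.adjoint_inner_left]
    ring
  rw [hmain]
  have h1 : ‖⟪x, J (h.incl w) - k.incl (J₁ w)⟫_ℂ‖ ≤ K * (δ * (4 * (K * s))) :=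
    (norm_inner_le_norm _ _).trans (by gcongr; exact (H.left w).trans (by gcongr))
  have h2 : ‖h.form (J₁' v) w - k.form v (J₁ w)‖ ≤ δ * (K * s) * (4 * (K * s)) :=
    (H.form w v).trans (by gcongr)
  have h3 : ‖z * ⟪J.adjoint (k.incl v) - h.incl (J₁' v), h.incl w⟫_ℂ‖
      ≤ K * (δ * (K * s) * (2 * K)) := by
    rw [norm_mul]
    gcongr
    exact (norm_inner_le_norm _ _).trans (by gcongr; exact (H.right v).trans (by gcongr))
  have h4 : ‖⟪J e, f⟫_ℂ‖ ≤ 4 * (K * (δ * s)) := by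
    have := norm_inner_le_norm (𝕜 := ℂ) (J e) f
    rw [hf, mul_one] at this
    exact this.trans hGb
  have h5 : ‖⟪J (J.adjoint (k.incl v)) - k.incl v, f⟫_ℂ‖ ≤ δ * (K * s) := by
    have := norm_inner_le_norm (𝕜 := ℂ) (J (J.adjoint (k.incl v)) - k.incl v) f
    rw [hf, mul_one] at this
    exact this.trans ((H.right_inv v).trans (by gcongr))
  have h6 := (norm_add_le (⟪x, J (h.incl w) - k.incl (J₁ w)⟫_ℂ - (h.form (J₁' v) w - k.form v (J₁ w))
        - z * ⟪J.adjoint (k.incl v) - h.incl (J₁' v), h.incl w⟫_ℂ)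
        (⟪J e, f⟫_ℂ + ⟪J (J.adjoint (k.incl v)) - k.incl v, f⟫_ℂ)).trans
    (add_le_add ((norm_sub_le _ _).trans (add_le_add (norm_sub_le _ _) le_rfl)) (norm_add_le _ _))
  refine (h6.trans (add_le_add (add_le_add (add_le_add h1 h2) h3) (add_le_add h4 h5))).trans ?_
  have hK2 : K ^ 2 ≤ K ^ 3 := pow_le_pow_right₀ hK (by norm_num)
  have hK1 : K ≤ K ^ 3 := le_self_pow₀ hK (by norm_num)
  calc K * (δ * (4 * (K * s))) + δ * (K * s) * (4 * (K * s)) + K * (δ * (K * s) * (2 * K))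
        + (4 * (K * (δ * s)) + δ * (K * s))
      = 4 * K ^ 2 * (δ * s) + 4 * K ^ 2 * (δ * s ^ 2) + 2 * K ^ 3 * (δ * s) + 5 * K * (δ * s) := by
        ring
    _ ≤ 4 * K ^ 3 * (δ * s ^ 2) + 4 * K ^ 3 * (δ * s ^ 2) + 2 * K ^ 3 * (δ * s ^ 2)
        + 5 * K ^ 3 * (δ * s ^ 2) := by gcongr
    _ = _ := by ring

/-- When `C δ ≥ 1` no cancellation is needed: `J R J†` alone already has norm of order `C δ`. -/
theorem norm_sandwich_le_of_ge (H : FormQUEData δ C J h k J₁ J₁') {z : ℂ} {K s : ℝ} (hs : s ^ 2 = C)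
    (hs1 : 1 ≤ s) (hK : 1 ≤ K) (hβ : 1 ≤ δ * s ^ 2) (hzK : ‖z‖ ≤ K) {w : h.Dom}
    {f : F} (hf : ‖f‖ = 1)
    (hw : ∀ φ, h.form w φ = ⟪J.adjoint f + z • h.incl w, h.incl φ⟫_ℂ)
    (hw0 : ‖h.incl w‖ ^ 2 ≤ K * (1 + δ * s)) :
    ‖J (h.incl w)‖ ≤ 4 * K * (δ * s ^ 2) := by
  have hδ := H.pos
  have hs0 : 0 < s := by linarith
  have hK0 : 0 < K := by linarith
  set β := δ * s ^ 2 with hβdef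
  have hβ0 : 0 < β := by linarith
  have hδs : δ * s ≤ β := by rw [hβdef]; gcongr; nlinarith
  have hδ1 : δ ≤ β := by rw [hβdef]; nlinarith
  set N := ‖h.incl w‖ with hN
  set W := ‖w‖ with hW
  set X := ‖J (h.incl w)‖ with hX
  have hN0 : 0 ≤ N := norm_nonneg _
  have hW0 : 0 ≤ W := norm_nonneg _
  have hX0 : 0 ≤ X := norm_nonneg _
  have hN2 : N ^ 2 ≤ 2 * K * β := by
    calc N ^ 2 ≤ K * (1 + δ * s) := hw0
      _ ≤ K * (β + β) := by gcongr
      _ = _ := by ring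
  have hWX : W ^ 2 ≤ 2 * X + 8 * (K ^ 2 * s ^ 2 * β) := by
    have h1 := h.norm_sq_le H.bound hw
    have h2 : (⟪J.adjoint f, h.incl w⟫_ℂ).re ≤ X := by
      rw [ContinuousLinearMap.adjoint_inner_left]
      have := re_inner_le_norm (𝕜 := ℂ) f (J (h.incl w))
      rw [hf, one_mul] at this
      exact this
    have h3 : |z.re| + C ≤ 2 * K * s ^ 2 := by
      have h4 := (Complex.abs_re_le_norm z).trans hzK
      rw [← hs]
      have h5 : (1 : ℝ) ≤ s ^ 2 := one_le_pow₀ hs1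
      have h6 : K * 1 ≤ K * s ^ 2 := by gcongr
      have h7 : 1 * s ^ 2 ≤ K * s ^ 2 := by gcongr
      linarith
    have h4 : (|z.re| + C) * N ^ 2 ≤ 2 * K * s ^ 2 * (2 * K * β) := by gcongr
    change W ^ 2 ≤ 2 * (_ + (|z.re| + C) * N ^ 2) at h1
    linarith
  have h1 : X ^ 2 ≤ N ^ 2 + δ * W * N := H.norm_sq_le w
  -- The inequality between the means with weight `β`, which balances the growth of `δ² W²` and of
  -- `N²` in `β`.
  have h2 : δ * W * N ≤ (δ ^ 2 * W ^ 2 / β + N ^ 2 * β) / 2 := by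
    have h3 : δ ^ 2 * W ^ 2 / β + N ^ 2 * β - 2 * (δ * W * N) = (δ * W - N * β) ^ 2 / β := by
      field_simp; ring
    have h4 : 0 ≤ (δ * W - N * β) ^ 2 / β := by positivity
    linarith
  have h3 : δ ^ 2 * W ^ 2 / β ≤ 2 * β * X + 8 * K ^ 2 * β ^ 2 := by
    rw [div_le_iff₀ hβ0]
    have h4 : δ ^ 2 * W ^ 2 ≤ δ ^ 2 * (2 * X + 8 * (K ^ 2 * s ^ 2 * β)) := by gcongr
    have h5 : δ ^ 2 ≤ β ^ 2 := by gcongr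
    have h6 : (δ * s) ^ 2 ≤ β ^ 2 := by gcongr
    have h7 : δ ^ 2 * (2 * X) ≤ β ^ 2 * (2 * X) := by gcongr
    have h8 : (δ * s) ^ 2 * (8 * K ^ 2 * β) ≤ β ^ 2 * (8 * K ^ 2 * β) := by gcongr
    calc δ ^ 2 * W ^ 2 ≤ δ ^ 2 * (2 * X) + (δ * s) ^ 2 * (8 * K ^ 2 * β) :=
          h4.trans (le_of_eq (by ring))
      _ ≤ β ^ 2 * (2 * X) + β ^ 2 * (8 * K ^ 2 * β) := add_le_add h7 h8
      _ = _ := by ring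
  have h4 : N ^ 2 * β ≤ 2 * K * β ^ 2 := by
    calc N ^ 2 * β ≤ 2 * K * β * β := by gcongr
      _ = _ := by ring
  have h5 : X ^ 2 ≤ β * X + 7 * (K * β) ^ 2 := by
    have h6 : K * β ≤ (K * β) ^ 2 := le_self_pow₀ (by nlinarith) two_ne_zero
    have h7 : K * β ^ 2 ≤ (K * β) ^ 2 := by
      rw [mul_pow K β]
      exact mul_le_mul_of_nonneg_right (le_self_pow₀ hK two_ne_zero) (sq_nonneg β)
    linarith
  have h6 : β * X ≤ K * β * X := mul_le_mul_of_nonneg_right (le_mul_of_one_le_left hβ0.le hK) hX0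
  have h7 : 0 < K * β := by positivity
  by_contra hc
  push Not at hc
  have h8 : X * (4 * (K * β)) ≤ X * X := by gcongr; linarith
  have h9 : (4 * (K * β)) * (K * β) ≤ X * (K * β) := by gcongr; linarith
  linarith [sq_pos_of_pos h7]

theorem norm_sandwich_le (H : FormQUEData δ C J h k J₁ J₁') {z : ℂ} (hz : z.im ≠ 0) :
    ‖J ∘L resolventOf h.operator z ∘L J.adjoint - resolventOf k.operator z‖ ≤
      15 * dominatingConst z ^ 3 * C * δ := by
  have hC0 : 0 ≤ C := zero_le_one.trans H.one_le
  have hδ := H.pos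
  obtain ⟨hK, hK1, -, -, hK4, hK5, hK6⟩ := dominatingConst_spec z
  set K := dominatingConst z with hKdef
  have hK0 : 0 < K := by linarith
  have hs : √C ^ 2 = C := Real.sq_sqrt hC0
  have hs1 : 1 ≤ √C := Real.one_le_sqrt.2 H.one_le
  refine ContinuousLinearMap.opNorm_le_of_unit_inner _ (by positivity) fun f g hf hg => ?_
  have hz' : (conj z).im ≠ 0 := by simpa using hz
  obtain ⟨w, hwz, hw⟩ := h.exists_resolventOf hz (J.adjoint f)
  obtain ⟨v, hvz, hv⟩ := k.exists_resolventOf hz' g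
  have hw0 := H.norm_sq_resolventOf_adjoint_le hz f
  rw [hf, one_pow, mul_one, ← hwz] at hw0
  have hv0 := k.norm_resolventOf_le hz' g
  rw [← hvz, hg, Complex.conj_im, abs_neg] at hv0
  have h6 : ⟪g, (J ∘L resolventOf h.operator z ∘L J.adjoint - resolventOf k.operator z) f⟫_ℂ =
      ⟪g, J (h.incl w)⟫_ℂ - ⟪k.incl v, f⟫_ℂ := by
    rw [sub_apply, ContinuousLinearMap.comp_apply, ContinuousLinearMap.comp_apply, inner_sub_right,
      hwz, hvz, ← k.adjoint_resolventOf hz, ContinuousLinearMap.adjoint_inner_left]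
  rw [h6]
  have hfin : 15 * K ^ 3 * C * δ = 15 * K ^ 3 * (δ * √C ^ 2) := by rw [hs]; ring
  rw [hfin]
  rcases le_total (δ * √C ^ 2) 1 with hβ | hβ
  · refine H.norm_sandwich_le_of_le hs hs1 hK hβ hK5 hf hv hw ?_ (hv0.trans hK1) ?_ hw0
    · have := k.norm_add_smul_le hz' g
      rw [← hvz, hg, mul_one, Complex.norm_conj, Complex.conj_im, abs_neg] at this
      exact this.trans hK6
    · have := k.norm_le_resolventConst H.one_le H.bound' hz' hvz hv
      rw [hg, mul_one, resolventConst_conj] at this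
      exact this.trans (by gcongr)
  · have h1 := H.norm_sandwich_le_of_ge hs hs1 hK hβ hK5 hf hw hw0
    have h2 : ‖⟪g, J (h.incl w)⟫_ℂ‖ ≤ ‖J (h.incl w)‖ := by
      have := norm_inner_le_norm (𝕜 := ℂ) g (J (h.incl w))
      rwa [hg, one_mul] at this
    have h3 : ‖⟪k.incl v, f⟫_ℂ‖ ≤ K := by
      have := norm_inner_le_norm (𝕜 := ℂ) (k.incl v) f
      rw [hf, mul_one] at this
      exact this.trans (hv0.trans hK1)
    have hK1 : K ≤ K ^ 3 := le_self_pow₀ hK (by norm_num)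
    calc ‖⟪g, J (h.incl w)⟫_ℂ - ⟪k.incl v, f⟫_ℂ‖ ≤ 4 * K * (δ * √C ^ 2) + K * 1 := by
          refine (norm_sub_le _ _).trans (add_le_add (h2.trans h1) (by rwa [mul_one]))
      _ ≤ 4 * K * (δ * √C ^ 2) + K * (δ * √C ^ 2) := by gcongr
      _ = 5 * K * (δ * √C ^ 2) := by ring
      _ ≤ 15 * K ^ 3 * (δ * √C ^ 2) := by gcongr; norm_num

end FormQUEData

end Sandwich

/-! ### Uniform approximation by combinations of `(x - z)⁻¹` -/

section StoneWeierstrass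

theorem tendsto_cocompact_inv_sub (z : ℂ) :
    Tendsto (fun x : ℝ => ((x : ℂ) - z)⁻¹) (cocompact ℝ) (𝓝 0) := by
  refine tendsto_inv₀_cobounded.comp ?_
  rw [← Metric.cobounded_eq_cocompact]
  have h1 : Tendsto (fun x : ℝ => (x : ℂ)) (Bornology.cobounded ℝ) (Bornology.cobounded ℂ) := by
    rw [← tendsto_norm_atTop_iff_cobounded]
    simpa only [Complex.norm_real] using tendsto_norm_cobounded_atTop (E := ℝ)
  exact (tendsto_sub_const_cobounded z).comp h1

theorem ofReal_sub_ne_zero {z : ℂ} (hz : z.im ≠ 0) (x : ℝ) : (x : ℂ) - z ≠ 0 := fun h =>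
  hz (by rw [← sub_eq_zero.1 h, Complex.ofReal_im])

theorem continuous_inv_sub {z : ℂ} (hz : z.im ≠ 0) :
    Continuous fun x : ℝ => ((x : ℂ) - z)⁻¹ :=
  (Complex.continuous_ofReal.sub continuous_const).inv₀ (ofReal_sub_ne_zero hz)

/-- The function `x ↦ (x - z)⁻¹` on the one-point compactification of the real line. -/
noncomputable def resolventMap (z : {z : ℂ // z.im ≠ 0}) : C(OnePoint ℝ, ℂ) :=
  OnePoint.continuousMapMk ⟨fun x : ℝ => ((x : ℂ) - z)⁻¹, continuous_inv_sub z.2⟩ 0 (by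
    rw [coclosedCompact_eq_cocompact]; exact tendsto_cocompact_inv_sub _)

theorem resolventMap_coe (z : {z : ℂ // z.im ≠ 0}) (x : ℝ) :
    resolventMap z (x : OnePoint ℝ) = ((x : ℂ) - z)⁻¹ := rfl

theorem resolventMap_infty (z : {z : ℂ // z.im ≠ 0}) : resolventMap z OnePoint.infty = 0 := rfl

/-- The resolvent identity for scalars: it makes the span of these functions closed under products
of distinct generators. -/
theorem resolventMap_mul (z w : {z : ℂ // z.im ≠ 0}) (h : z ≠ w) :
    resolventMap z * resolventMap w =
      ((z : ℂ) - w)⁻¹ • (resolventMap z - resolventMap w) := by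
  ext x
  induction x using OnePoint.rec with
  | infty => simp [resolventMap_infty]
  | coe x =>
    have h1 := ofReal_sub_ne_zero z.2 x
    have h2 := ofReal_sub_ne_zero w.2 x
    have h3 : (z : ℂ) - w ≠ 0 := sub_ne_zero.2 fun h' => h (Subtype.ext h')
    simp only [ContinuousMap.mul_apply, ContinuousMap.smul_apply, ContinuousMap.sub_apply,
      resolventMap_coe, smul_eq_mul]
    field_simp
    ring

theorem norm_resolventMap_le (z : {z : ℂ // z.im ≠ 0}) : ‖resolventMap z‖ ≤ 1 / |(z : ℂ).im| := by
  refine (ContinuousMap.norm_le _ (by positivity)).2 fun x => ?_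
  induction x using OnePoint.rec with
  | infty => rw [resolventMap_infty, norm_zero]; positivity
  | coe x =>
    rw [resolventMap_coe, norm_inv, one_div]
    refine inv_anti₀ (abs_pos.2 z.2) ?_
    simpa using Complex.abs_im_le_norm ((x : ℂ) - z)

/-- The closed span of the functions `x ↦ (x - z)⁻¹`. -/
noncomputable def resolventSpan : Submodule ℂ C(OnePoint ℝ, ℂ) :=
  (Submodule.span ℂ (Set.range resolventMap)).topologicalClosure

theorem resolventMap_mem (z : {z : ℂ // z.im ≠ 0}) : resolventMap z ∈ resolventSpan :=
  Submodule.le_topologicalClosure _ (Submodule.subset_span ⟨z, rfl⟩)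

theorem isClosed_resolventSpan : IsClosed (resolventSpan : Set C(OnePoint ℝ, ℂ)) :=
  Submodule.isClosed_topologicalClosure _

/-- The square of a generator is not covered by the resolvent identity; it is the limit of products
with generators at `z + 1 / (n + 1)`, which have the same imaginary part. -/
theorem resolventMap_mul_mem (z w : {z : ℂ // z.im ≠ 0}) :
    resolventMap z * resolventMap w ∈ resolventSpan := by
  by_cases h : z = w
  · subst h
    let a : ℕ → {z : ℂ // z.im ≠ 0} := fun n => ⟨z + ((1 / ((n : ℝ) + 1) : ℝ) : ℂ), by
      simpa using z.2⟩
    have hne : ∀ n, z ≠ a n := fun n hn => by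
      have h1 : ((1 / ((n : ℝ) + 1) : ℝ) : ℂ) = 0 := by
        have := congrArg Subtype.val hn
        simpa [a] using this
      have h2 : (1 / ((n : ℝ) + 1) : ℝ) ≠ 0 := by positivity
      exact h2 (by exact_mod_cast h1)
    have hlim : Tendsto (fun n => resolventMap (a n)) atTop (𝓝 (resolventMap z)) := by
      rw [tendsto_iff_norm_sub_tendsto_zero]
      refine squeeze_zero (fun n : ℕ => norm_nonneg (resolventMap (a n) - resolventMap z))
        (g := fun n : ℕ => (1 / ((n : ℝ) + 1)) * (1 / |(z : ℂ).im| * (1 / |(z : ℂ).im|))) (fun n => ?_) ?_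
      · have h1 := resolventMap_mul (a n) z (hne n).symm
        have h2 : ((a n : ℂ) - z) ≠ 0 := sub_ne_zero.2 fun h' => hne n (Subtype.ext h'.symm)
        rw [eq_comm, inv_smul_eq_iff₀ h2] at h1
        rw [h1, norm_smul]
        have h3 : ‖(a n : ℂ) - z‖ = 1 / ((n : ℝ) + 1) := by
          simp only [a, add_sub_cancel_left]
          rw [Complex.norm_real, Real.norm_of_nonneg (by positivity)]
        rw [h3]
        gcongr
        refine (norm_mul_le _ _).trans ?_
        have h4 := norm_resolventMap_le (a n)
        have h5 : ((a n : ℂ)).im = (z : ℂ).im := by simp [a]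
        rw [h5] at h4
        gcongr
        exact norm_resolventMap_le z
      · simpa using tendsto_one_div_add_atTop_nhds_zero_nat.mul_const
          (1 / |(z : ℂ).im| * (1 / |(z : ℂ).im|))
    refine isClosed_resolventSpan.mem_of_tendsto (hlim.const_mul (resolventMap z))
      (Eventually.of_forall fun n => ?_)
    rw [resolventMap_mul _ _ (hne n)]
    exact Submodule.smul_mem _ _ (Submodule.sub_mem _ (resolventMap_mem _) (resolventMap_mem _))
  · rw [resolventMap_mul _ _ h]
    exact Submodule.smul_mem _ _ (Submodule.sub_mem _ (resolventMap_mem _) (resolventMap_mem _))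

theorem resolventSpan_mul_mem {p q : C(OnePoint ℝ, ℂ)} (hp : p ∈ resolventSpan)
    (hq : q ∈ resolventSpan) : p * q ∈ resolventSpan := by
  have key : p * q ∈ closure (resolventSpan : Set C(OnePoint ℝ, ℂ)) := by
    refine map_mem_closure₂ continuous_mul hp hq fun a ha b hb => ?_
    induction ha, hb using Submodule.span_induction₂ with
    | mem_mem x y hx hy =>
      obtain ⟨z, rfl⟩ := hx
      obtain ⟨w, rfl⟩ := hy
      exact resolventMap_mul_mem z w
    | zero_left y hy => simp
    | zero_right x hx => simp
    | add_left x y z hx hy hz h1 h2 => rw [add_mul]; exact Submodule.add_mem _ h1 h2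
    | add_right x y z hx hy hz h1 h2 => rw [mul_add]; exact Submodule.add_mem _ h1 h2
    | smul_left r x y hx hy h1 => rw [smul_mul_assoc]; exact Submodule.smul_mem _ _ h1
    | smul_right r x y hx hy h1 => rw [mul_smul_comm]; exact Submodule.smul_mem _ _ h1
  rwa [isClosed_resolventSpan.closure_eq] at key

theorem resolventSpan_star_mem {p : C(OnePoint ℝ, ℂ)} (hp : p ∈ resolventSpan) :
    star p ∈ resolventSpan := by
  have key : star p ∈ closure (resolventSpan : Set C(OnePoint ℝ, ℂ)) := by
    refine map_mem_closure continuous_star hp fun a ha => ?_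
    induction ha using Submodule.span_induction with
    | mem x hx =>
      obtain ⟨z, rfl⟩ := hx
      have : star (resolventMap z) = resolventMap ⟨conj (z : ℂ), by simpa using z.2⟩ := by
        ext x
        induction x using OnePoint.rec with
        | infty => simp [resolventMap_infty]
        | coe x => simp [resolventMap_coe]
      rw [this]
      exact resolventMap_mem _
    | zero => simp
    | add x y hx hy h1 h2 => rw [star_add]; exact Submodule.add_mem _ h1 h2
    | smul r x hx h1 => rw [star_smul]; exact Submodule.smul_mem _ _ h1
  rwa [isClosed_resolventSpan.closure_eq] at key

/-- The functions that differ from their value at infinity by an element of `resolventSpan`. -/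
noncomputable def resolventAlgebra : StarSubalgebra ℂ C(OnePoint ℝ, ℂ) where
  carrier := {p | p - algebraMap ℂ _ (p OnePoint.infty) ∈ resolventSpan}
  mul_mem' {p q} hp hq := by
    have h1 : p * q - algebraMap ℂ C(OnePoint ℝ, ℂ) ((p * q) OnePoint.infty) =
        (p - algebraMap ℂ _ (p OnePoint.infty)) * (q - algebraMap ℂ _ (q OnePoint.infty))
        + (q OnePoint.infty) • (p - algebraMap ℂ _ (p OnePoint.infty))
        + (p OnePoint.infty) • (q - algebraMap ℂ _ (q OnePoint.infty)) := by
      ext x; simp; ring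
    simp only [Set.mem_ofPred_eq] at hp hq ⊢
    rw [h1]
    exact Submodule.add_mem _ (Submodule.add_mem _ (resolventSpan_mul_mem hp hq)
      (Submodule.smul_mem _ _ hp)) (Submodule.smul_mem _ _ hq)
  add_mem' {p q} hp hq := by
    have h1 : p + q - algebraMap ℂ C(OnePoint ℝ, ℂ) ((p + q) OnePoint.infty) =
        (p - algebraMap ℂ _ (p OnePoint.infty)) + (q - algebraMap ℂ _ (q OnePoint.infty)) := by
      ext x; simp; ring
    simp only [Set.mem_ofPred_eq] at hp hq ⊢
    rw [h1]
    exact Submodule.add_mem _ hp hq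
  algebraMap_mem' r := by
    have h1 : algebraMap ℂ C(OnePoint ℝ, ℂ) r
        - algebraMap ℂ _ ((algebraMap ℂ C(OnePoint ℝ, ℂ) r) OnePoint.infty) = 0 := by
      ext x; simp
    simp only [Set.mem_ofPred_eq]
    rw [h1]
    exact Submodule.zero_mem _
  star_mem' {p} hp := by
    have h1 : star p - algebraMap ℂ C(OnePoint ℝ, ℂ) ((star p) OnePoint.infty) =
        star (p - algebraMap ℂ _ (p OnePoint.infty)) := by
      ext x; simp
    simp only [Set.mem_ofPred_eq] at hp ⊢
    rw [h1]
    exact resolventSpan_star_mem hp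

/-- Adjoining constants gives a closed star subalgebra of the functions on the compact space
`OnePoint ℝ`, and `(x - i)⁻¹` separates points, including infinity. By Stone–Weierstrass it is
everything; a function vanishing at infinity has no constant part. -/
theorem mem_resolventSpan {p : C(OnePoint ℝ, ℂ)} (hp : p OnePoint.infty = 0) :
    p ∈ resolventSpan := by
  have h1 : resolventAlgebra.topologicalClosure = ⊤ := by
    refine ContinuousMap.starSubalgebra_topologicalClosure_eq_top_of_separatesPoints _ ?_
    intro x y hxy
    have hI : (Complex.I).im ≠ 0 := by simp
    refine ⟨resolventMap ⟨Complex.I, hI⟩, ⟨resolventMap ⟨Complex.I, hI⟩, ?_, rfl⟩, ?_⟩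
    · change _ - _ ∈ resolventSpan
      simpa [resolventMap_infty] using resolventMap_mem _
    · induction x using OnePoint.rec with
      | infty =>
        induction y using OnePoint.rec with
        | infty => exact absurd rfl hxy
        | coe y =>
          rw [resolventMap_infty, resolventMap_coe]
          exact (inv_ne_zero (ofReal_sub_ne_zero hI y)).symm
      | coe x =>
        induction y using OnePoint.rec with
        | infty =>
          rw [resolventMap_infty, resolventMap_coe]
          exact inv_ne_zero (ofReal_sub_ne_zero hI x)
        | coe y =>
          rw [resolventMap_coe, resolventMap_coe]
          intro h
          have h2 := sub_left_injective (inv_injective h)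
          exact hxy (by rw [Complex.ofReal_injective h2])
  have h2 : IsClosed (resolventAlgebra : Set C(OnePoint ℝ, ℂ)) := by
    refine isClosed_resolventSpan.preimage (f := fun p : C(OnePoint ℝ, ℂ) =>
      p - algebraMap ℂ _ (p OnePoint.infty)) ?_
    have h3 : Continuous fun p : C(OnePoint ℝ, ℂ) => p OnePoint.infty :=
      continuous_eval_const _
    have h4 : Continuous (algebraMap ℂ C(OnePoint ℝ, ℂ)) := continuous_algebraMap _ _
    exact continuous_id.sub (h4.comp h3)
  have h3 : p ∈ resolventAlgebra.topologicalClosure := by rw [h1]; trivial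
  rw [← SetLike.mem_coe, StarSubalgebra.topologicalClosure_coe, h2.closure_eq] at h3
  have h4 : p - algebraMap ℂ _ (p OnePoint.infty) ∈ resolventSpan := h3
  simpa [hp] using h4

/-- Linear combinations of the functions `x ↦ (x - z)⁻¹` are uniformly dense in the continuous
functions that vanish at infinity. -/
theorem exists_finsupp_approx {ψ : ℝ → ℂ} (hψ : Continuous ψ) (h0 : Tendsto ψ (cocompact ℝ) (𝓝 0))
    {ε : ℝ} (hε : 0 < ε) : ∃ c : {z : ℂ // z.im ≠ 0} →₀ ℂ,
      ∀ x, ‖ψ x - c.sum fun z a => a * ((x : ℂ) - z)⁻¹‖ ≤ ε := by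
  let p : C(OnePoint ℝ, ℂ) := OnePoint.continuousMapMk ⟨ψ, hψ⟩ 0 (by
    rw [coclosedCompact_eq_cocompact]; exact h0)
  have hp : p ∈ closure (Submodule.span ℂ (Set.range resolventMap) : Set C(OnePoint ℝ, ℂ)) :=
    mem_resolventSpan (p := p) rfl
  obtain ⟨q, hq, hpq⟩ := Metric.mem_closure_iff.1 hp ε hε
  obtain ⟨c, rfl⟩ := Finsupp.mem_span_range_iff_exists_finsupp.1 hq
  refine ⟨c, fun x => ?_⟩
  rw [dist_eq_norm] at hpq
  refine le_trans (le_of_eq ?_) ((ContinuousMap.norm_coe_le_norm _ (x : OnePoint ℝ)).trans hpq.le)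
  rw [ContinuousMap.sub_apply]
  congr 2
  simp [Finsupp.sum, ContinuousMap.sum_apply, resolventMap_coe]

end StoneWeierstrass

/-! ### Finite measures are determined by their Stieltjes transforms -/

section StieltjesTransform

theorem integrable_of_norm_le {μ : Measure ℝ} [IsFiniteMeasure μ] {ψ : ℝ → ℂ}
    (hψ : Measurable ψ) {b : ℝ} (hb : ∀ x, ‖ψ x‖ ≤ b) : Integrable ψ μ :=
  Integrable.of_bound hψ.aestronglyMeasurable b (Eventually.of_forall hb)

theorem integrable_inv_sub {μ : Measure ℝ} [IsFiniteMeasure μ] {z : ℂ} (hz : z.im ≠ 0) :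
    Integrable (fun x : ℝ => ((x : ℂ) - z)⁻¹) μ := by
  refine integrable_of_norm_le (continuous_inv_sub hz).measurable
    (b := 1 / |z.im|) fun x => ?_
  rw [norm_inv, one_div]
  refine inv_anti₀ (abs_pos.2 hz) ?_
  simpa using Complex.abs_im_le_norm ((x : ℂ) - z)

/-- A linear relation between the Stieltjes transforms of finite measures holds between the
measures. -/
theorem sum_integral_eq_zero {κ : Type*} (s : Finset κ) (a : κ → ℂ) (μ : κ → Measure ℝ)
    [∀ i, IsFiniteMeasure (μ i)]
    (h : ∀ z : ℂ, z.im ≠ 0 → ∑ i ∈ s, a i * ∫ x : ℝ, ((x : ℂ) - z)⁻¹ ∂(μ i) = 0)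
    {φ : ℝ → ℂ} (hφ : Measurable φ) {b : ℝ} (hb : ∀ x, ‖φ x‖ ≤ b) :
    ∑ i ∈ s, a i * ∫ x, φ x ∂(μ i) = 0 := by
  -- A common dominating measure: one approximation of `φ` in `L¹(ν)` by a compactly supported
  -- continuous `g` works for all `μ i`. Then `g` is approximated uniformly by combinations of `(x -
  -- z)⁻¹`, for which the relation holds by hypothesis.
  set ν : Measure ℝ := ∑ i ∈ s, μ i with hν
  have hνi : ∀ i ∈ s, μ i ≤ ν := fun i hi =>
    Finset.single_le_sum (f := μ) (fun _ _ => Measure.zero_le _) hi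
  have : IsFiniteMeasure ν := by rw [hν]; infer_instance
  have hφi : ∀ (ρ : Measure ℝ) [IsFiniteMeasure ρ], Integrable φ ρ := fun ρ _ =>
    integrable_of_norm_le hφ hb
  set K : ℝ := ∑ i ∈ s, ‖a i‖ with hK
  have hK0 : 0 ≤ K := Finset.sum_nonneg fun _ _ => norm_nonneg _
  set V : ℝ := ν.real Set.univ with hV
  have hV0 : 0 ≤ V := measureReal_nonneg
  have key : ∀ ε : ℝ, 0 < ε → ‖∑ i ∈ s, a i * ∫ x, φ x ∂(μ i)‖ ≤ K * (ε + ε * V) := by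
    intro ε hε
    obtain ⟨g, hgc, hg, hgcont, hgi⟩ := (hφi ν).exists_hasCompactSupport_integral_sub_le hε
    obtain ⟨c, hc⟩ := exists_finsupp_approx hgcont hgc.is_zero_at_infty hε
    set p : ℝ → ℂ := fun x => c.sum fun z a => a * ((x : ℂ) - z)⁻¹ with hp
    have hpi : ∀ (ρ : Measure ℝ) [IsFiniteMeasure ρ], Integrable p ρ := fun ρ _ =>
      integrable_finsetSum _ fun z _ => (integrable_inv_sub z.2).const_mul _
    have hp0 : ∑ i ∈ s, a i * ∫ x, p x ∂(μ i) = 0 := by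
      have h1 : ∀ i, ∫ x, p x ∂(μ i) =
          ∑ z ∈ c.support, c z * ∫ x : ℝ, ((x : ℂ) - z)⁻¹ ∂(μ i) := fun i => by
        simp only [hp, Finsupp.sum]
        rw [integral_finsetSum _ fun z _ => (integrable_inv_sub z.2).const_mul _]
        simp only [integral_const_mul]
      simp only [h1, Finset.mul_sum]
      rw [Finset.sum_comm]
      refine Finset.sum_eq_zero fun z _ => ?_
      calc ∑ i ∈ s, a i * (c z * ∫ x : ℝ, ((x : ℂ) - z)⁻¹ ∂(μ i))
          = c z * ∑ i ∈ s, a i * ∫ x : ℝ, ((x : ℂ) - z)⁻¹ ∂(μ i) := by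
            rw [Finset.mul_sum]; exact Finset.sum_congr rfl fun i _ => by ring
        _ = 0 := by rw [h z z.2, mul_zero]
    have hdiff : ∀ i ∈ s, ‖(∫ x, φ x ∂(μ i)) - ∫ x, p x ∂(μ i)‖ ≤ ε + ε * V := fun i hi => by
      have hgi' : Integrable g (μ i) := hgi.mono_measure (hνi i hi)
      have h1 : ‖(∫ x, φ x ∂(μ i)) - ∫ x, g x ∂(μ i)‖ ≤ ε := by
        rw [← integral_sub (hφi _) hgi']
        refine (norm_integral_le_integral_norm _).trans (le_trans ?_ hg)
        exact integral_mono_measure (hνi i hi) (Eventually.of_forall fun x => norm_nonneg _)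
          ((hφi ν).sub hgi).norm
      have h2 : ‖(∫ x, g x ∂(μ i)) - ∫ x, p x ∂(μ i)‖ ≤ ε * V := by
        rw [← integral_sub hgi' (hpi _)]
        refine (norm_integral_le_of_norm_le_const (Eventually.of_forall hc)).trans ?_
        gcongr
        exact ENNReal.toReal_mono (measure_ne_top ν _) (hνi i hi _)
      calc _ = ‖((∫ x, φ x ∂(μ i)) - ∫ x, g x ∂(μ i)) + ((∫ x, g x ∂(μ i)) - ∫ x, p x ∂(μ i))‖ := by
            rw [sub_add_sub_cancel]
        _ ≤ _ := (norm_add_le _ _).trans (add_le_add h1 h2)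
    calc ‖∑ i ∈ s, a i * ∫ x, φ x ∂(μ i)‖
        = ‖∑ i ∈ s, a i * ((∫ x, φ x ∂(μ i)) - ∫ x, p x ∂(μ i))‖ := by
          simp only [mul_sub, Finset.sum_sub_distrib, hp0, sub_zero]
      _ ≤ ∑ i ∈ s, ‖a i‖ * (ε + ε * V) := by
          refine norm_sum_le_of_le _ fun i hi => ?_
          rw [norm_mul]
          gcongr
          exact hdiff i hi
      _ = _ := by rw [← Finset.sum_mul]
  rw [← norm_le_zero_iff]
  have hlim : Tendsto (fun ε : ℝ => K * (ε + ε * V)) (𝓝[>] 0) (𝓝 (K * (0 + 0 * V))) :=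
    (Continuous.tendsto (by fun_prop) 0).mono_left nhdsWithin_le_nhds
  rw [zero_mul, add_zero, mul_zero] at hlim
  exact ge_of_tendsto hlim (eventually_mem_nhdsWithin.mono fun ε hε => key ε hε)

end StieltjesTransform

/-! ### Spectral measures at vectors -/

section SpectralMeasure

open scoped CompactlySupported

variable {E : Type*} [NormedAddCommGroup E] [InnerProductSpace ℂ E] [CompleteSpace E]

/-- The spectral measure of a bounded normal operator at a vector. -/
theorem exists_measure_cfc (a : E →L[ℂ] E) (ha : IsStarNormal a) (f : E) :
    ∃ μ : Measure ℂ, IsFiniteMeasure μ ∧ (∀ᵐ ζ ∂μ, ζ ∈ spectrum ℂ a) ∧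
      ∀ g : ℂ → ℂ, ContinuousOn g (spectrum ℂ a) → ⟪f, cfc g a f⟫_ℂ = ∫ ζ, g ζ ∂μ := by
  let X := spectrum ℂ a
  let c : C(X, ℝ) → C(X, ℂ) := fun g => ⟨fun x => (g x : ℂ), by fun_prop⟩
  have hcadd : ∀ g g', c (g + g') = c g + c g' := fun g g' => by ext; simp [c]
  have hcsmul : ∀ (r : ℝ) g, c (r • g) = (r : ℂ) • c g := fun r g => by ext; simp [c]
  let Λ₀ : C_c(X, ℝ) →ₗ[ℝ] ℝ :=
    { toFun := fun g => (⟪f, cfcHom ha (c g.toContinuousMap) f⟫_ℂ).re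
      map_add' := fun g g' => by
        have : (g + g').toContinuousMap = g.toContinuousMap + g'.toContinuousMap := rfl
        rw [this, hcadd, map_add, add_apply, inner_add_right, Complex.add_re]
      map_smul' := fun r g => by
        have : (r • g).toContinuousMap = r • g.toContinuousMap := rfl
        rw [this, hcsmul, map_smul, smul_apply, inner_smul_right, Complex.re_ofReal_mul]
        rfl }
  -- Positivity: `g` is the square of the real function `√g`, so the quadratic form is a square
  -- norm.
  have hΛ₀ : ∀ g : C_c(X, ℝ), 0 ≤ g → 0 ≤ Λ₀ g := fun g hg => by
    let s : C(X, ℝ) := ⟨fun x => √(g x), by fun_prop⟩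
    have h1 : c g.toContinuousMap = star (c s) * c s := by
      ext x
      have h2 : √(g x) * √(g x) = g x := Real.mul_self_sqrt (hg x)
      have h3 : g.toContinuousMap x = g x := rfl
      simp only [c, s, ContinuousMap.coe_mk, ContinuousMap.mul_apply, ContinuousMap.star_apply,
        RCLike.star_def, Complex.conj_ofReal, h3]
      exact_mod_cast h2.symm
    change 0 ≤ (⟪f, cfcHom ha (c g.toContinuousMap) f⟫_ℂ).re
    rw [h1, map_mul, map_star, ContinuousLinearMap.star_eq_adjoint, mul_apply_eq_comp,
      ContinuousLinearMap.adjoint_inner_right]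
    exact inner_self_nonneg (𝕜 := ℂ)
  let Λ : C_c(X, ℝ) →ₚ[ℝ] ℝ := PositiveLinearMap.mk₀ Λ₀ hΛ₀
  let μ : Measure X := RealRMK.rieszMeasure Λ
  have hfin : IsFiniteMeasure μ := inferInstance
  have hreal : ∀ g : C(X, ℝ), ∫ x, g x ∂μ = (⟪f, cfcHom ha (c g) f⟫_ℂ).re := fun g =>
    RealRMK.integral_rieszMeasure Λ (CompactlySupportedContinuousMap.continuousMapEquiv g)
  have him : ∀ g : C(X, ℝ), (⟪f, cfcHom ha (c g) f⟫_ℂ).im = 0 := fun g => by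
    have h1 : star (c g) = c g := by ext x; simp [c]
    have h2 : (cfcHom ha (c g)).adjoint = cfcHom ha (c g) := by
      rw [← ContinuousLinearMap.star_eq_adjoint, ← map_star, h1]
    have h3 := inner_conj_symm (𝕜 := ℂ) f (cfcHom ha (c g) f)
    rw [← ContinuousLinearMap.adjoint_inner_right, h2] at h3
    exact Complex.conj_eq_iff_im.1 h3
  have hcomplex : ∀ g : C(X, ℝ), ⟪f, cfcHom ha (c g) f⟫_ℂ = ∫ x, (g x : ℂ) ∂μ := fun g => by
    rw [integral_complex_ofReal, hreal]
    exact Complex.ext (by simp) (by simp [him])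
  have hall : ∀ g : C(X, ℂ), ⟪f, cfcHom ha g f⟫_ℂ = ∫ x, g x ∂μ := fun g => by
    let g₁ : C(X, ℝ) := ⟨fun x => (g x).re, by fun_prop⟩
    let g₂ : C(X, ℝ) := ⟨fun x => (g x).im, by fun_prop⟩
    have h1 : g = c g₁ + Complex.I • c g₂ := by
      ext x
      simp only [c, g₁, g₂, ContinuousMap.add_apply, ContinuousMap.smul_apply,
        ContinuousMap.coe_mk, smul_eq_mul]
      rw [mul_comm, Complex.re_add_im]
    have hi : ∀ g : C(X, ℝ), Integrable (fun x => (g x : ℂ)) μ := fun g =>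
      (c g).continuous.integrable_of_hasCompactSupport (HasCompactSupport.of_compactSpace _)
    have h2 : ∫ x, g x ∂μ = (∫ x, (g₁ x : ℂ) ∂μ) + Complex.I * ∫ x, (g₂ x : ℂ) ∂μ := by
      rw [← integral_const_mul, ← integral_add (hi _) ((hi _).const_mul _)]
      refine integral_congr_ae (Eventually.of_forall fun x => ?_)
      exact congrArg (fun p : C(X, ℂ) => p x) h1
    rw [h2, ← hcomplex, ← hcomplex]
    conv_lhs => rw [h1]
    rw [map_add, map_smul, add_apply, smul_apply, inner_add_right, inner_smul_right]
  have hX : IsClosed X := spectrum.isClosed a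
  have hemb : MeasurableEmbedding (Subtype.val : X → ℂ) :=
    MeasurableEmbedding.subtype_coe hX.measurableSet
  refine ⟨μ.map Subtype.val, inferInstance, ?_, fun g hg => ?_⟩
  · rw [hemb.ae_map_iff]
    exact Eventually.of_forall fun x => x.2
  · rw [hemb.integral_map, cfc_apply g a ha hg, hall]
    rfl

namespace HasRealResolvent

variable {A : E →ₗ.[ℂ] E} {z₀ : ℝ} {T : E →L[ℂ] E}

theorem one_add_mul_ne_zero (h : HasRealResolvent A z₀ T) {z : ℂ} (hz : z.im ≠ 0) {ζ : ℂ}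
    (hζ : ζ ∈ spectrum ℂ T) : 1 + (z₀ - z) * ζ ≠ 0 := by
  rw [h.isSelfAdjoint.mem_spectrum_eq_re hζ]
  intro h0
  have h1 := congrArg Complex.im h0
  have h2 := congrArg Complex.re h0
  simp at h1 h2
  rcases h1 with h1 | h1
  · exact hz h1
  · rw [h1] at h2; simp at h2

/-- With `A = z₀ + T⁻¹`, the resolvent is `ζ / (1 + (z₀ - z) ζ)` at `ζ = T`, a continuous function
on the real spectrum of `T`. -/
theorem resolventOf_eq_cfc (h : HasRealResolvent A z₀ T) {z : ℂ} (hz : z.im ≠ 0) :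
    resolventOf A z = cfc (fun ζ : ℂ => ζ / (1 + (z₀ - z) * ζ)) T := by
  have hn : IsStarNormal T := h.isSelfAdjoint.isStarNormal
  have hcont : ContinuousOn (fun ζ : ℂ => ζ / (1 + (z₀ - z) * ζ)) (spectrum ℂ T) :=
    continuousOn_id.div (by fun_prop) fun ζ hζ => h.one_add_mul_ne_zero hz hζ
  have h1 := (h.isResolvent.mul_shift (h.isResolvent_of_im_ne_zero hz))
  have h2 := (h.isResolvent.of_isUnit h1.1 h1.2).resolventOf_eq
  have h3 : cfc (fun ζ : ℂ => ζ / (1 + (z₀ - z) * ζ)) T * (1 - (z - z₀) • T) = T := by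
    have h4 : (1 - (z - (z₀ : ℂ)) • T) = cfc (fun ζ : ℂ => 1 + (z₀ - z) * ζ) T := by
      rw [cfc_const_add (1 : ℂ) (fun ζ => (z₀ - z) * ζ) T (by fun_prop),
        cfc_const_mul_id (z₀ - z) T, map_one, ← neg_sub (z₀ : ℂ) z, neg_smul, sub_neg_eq_add]
    rw [h4, ← cfc_mul _ _ T hcont (by fun_prop)]
    conv_rhs => rw [← cfc_id' ℂ T]
    refine cfc_congr fun ζ hζ => ?_
    exact div_mul_cancel₀ _ (h.one_add_mul_ne_zero hz hζ)
  rw [h2]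
  nth_rewrite 1 [← h3]
  rw [mul_assoc, h1.1, mul_one]

/-- The spectral measures of a bounded operator with dense range have no atom at zero. -/
theorem measure_singleton_zero (h : HasRealResolvent A z₀ T) (hd : DenseRange T) {f : E}
    {μ : Measure ℂ} [IsFiniteMeasure μ]
    (hg : ∀ g : ℂ → ℂ, ContinuousOn g (spectrum ℂ T) → ⟪f, cfc g T f⟫_ℂ = ∫ ζ, g ζ ∂μ) :
    μ {0} = 0 := by
  have hn : IsStarNormal T := h.isSelfAdjoint.isStarNormal
  have key : ∀ η : ℝ, 0 < η → μ.real {0} ≤ ‖f‖ * (2 * η) := by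
    intro η hη
    obtain ⟨g, hfg⟩ := hd.exists_dist_lt f hη
    rw [dist_eq_norm] at hfg
    set ε : ℝ := η / (‖g‖ + 1) with hε
    have hε0 : 0 < ε := by positivity
    -- A bump of height 1 at zero with `u(T) T` of norm at most `ε`. As `f` is close to `T g`, the
    -- vector `u(T) f` is small, and the integral of `u` bounds the mass at zero.
    let u : ℂ → ℝ := fun ζ => ε ^ 2 / (ε ^ 2 + ‖ζ‖ ^ 2)
    have hu0 : ∀ ζ, 0 ≤ u ζ := fun ζ => by positivity
    have hucont : Continuous u := by
      refine Continuous.div (by fun_prop) (by fun_prop) fun ζ => ?_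
      positivity
    have huc : Continuous fun ζ => (u ζ : ℂ) := by fun_prop
    have hu1 : ∀ ζ, u ζ ≤ 1 := fun ζ => by
      refine (div_le_one (by positivity)).2 ?_
      linarith [sq_nonneg ‖ζ‖]
    have h1 : ‖cfc (fun ζ => (u ζ : ℂ)) T‖ ≤ 1 := by
      refine norm_cfc_le zero_le_one fun ζ _ => ?_
      rw [Complex.norm_real, Real.norm_of_nonneg (hu0 ζ)]
      exact hu1 ζ
    have h2 : ‖cfc (fun ζ => (u ζ : ℂ)) T * T‖ ≤ ε := by
      have h3 : cfc (fun ζ => (u ζ : ℂ)) T * T = cfc (fun ζ => (u ζ : ℂ) * ζ) T := by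
        rw [cfc_mul (fun ζ => (u ζ : ℂ)) (fun ζ => ζ) T huc.continuousOn continuousOn_id,
          cfc_id' ℂ T]
      rw [h3]
      refine norm_cfc_le hε0.le fun ζ _ => ?_
      rw [norm_mul, Complex.norm_real, Real.norm_of_nonneg (hu0 ζ), div_mul_eq_mul_div,
        div_le_iff₀ (by positivity)]
      nlinarith [sq_nonneg (ε - ‖ζ‖), mul_nonneg hε0.le (norm_nonneg ζ)]
    have h3 : ‖cfc (fun ζ => (u ζ : ℂ)) T f‖ ≤ 2 * η := by
      have h4 : cfc (fun ζ => (u ζ : ℂ)) T f =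
          cfc (fun ζ => (u ζ : ℂ)) T (f - T g) + (cfc (fun ζ => (u ζ : ℂ)) T * T) g := by
        rw [mul_apply_eq_comp, map_sub, sub_add_cancel]
      rw [h4]
      have h5 := ContinuousLinearMap.le_of_opNorm_le _ h1 (f - T g)
      have h6 := ContinuousLinearMap.le_of_opNorm_le _ h2 g
      have h7 : ε * ‖g‖ ≤ η := by
        rw [hε, div_mul_eq_mul_div, div_le_iff₀ (by positivity)]
        nlinarith
      refine (norm_add_le _ _).trans ?_
      linarith
    have h4 : ∫ ζ, u ζ ∂μ ≤ ‖f‖ * (2 * η) := by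
      have h5 := hg _ huc.continuousOn
      rw [integral_complex_ofReal] at h5
      have h6 := (norm_inner_le_norm (𝕜 := ℂ) f (cfc (fun ζ => (u ζ : ℂ)) T f))
      rw [h5, Complex.norm_real] at h6
      exact (le_abs_self _).trans (h6.trans (by gcongr))
    refine le_trans ?_ h4
    have hui : Integrable u μ :=
      Integrable.of_bound hucont.aestronglyMeasurable 1 (Eventually.of_forall fun ζ => by
        rw [Real.norm_of_nonneg (hu0 ζ)]; exact hu1 ζ)
    have h5 : ∫ ζ in ({0} : Set ℂ), u ζ ∂μ = μ.real {0} := by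
      rw [integral_singleton]
      have : u 0 = 1 := by simp [u, hε0.ne']
      rw [this, smul_eq_mul, mul_one]
    rw [← h5]
    exact setIntegral_le_integral hui (Eventually.of_forall hu0)
  have h1 : μ.real {0} ≤ 0 := by
    have hlim : Tendsto (fun η : ℝ => ‖f‖ * (2 * η)) (𝓝[>] 0) (𝓝 (‖f‖ * (2 * 0))) :=
      (Continuous.tendsto (by fun_prop) 0).mono_left nhdsWithin_le_nhds
    rw [mul_zero, mul_zero] at hlim
    exact ge_of_tendsto hlim (eventually_mem_nhdsWithin.mono key)
  exact (measureReal_eq_zero_iff).1 (le_antisymm h1 measureReal_nonneg)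

theorem denseRange (h : HasRealResolvent A z₀ T) : DenseRange T := by
  have h1 : (LinearMap.range (T : E →ₗ[ℂ] E)).topologicalClosure = ⊤ := by
    rw [Submodule.topologicalClosure_eq_top_iff, eq_bot_iff]
    intro f hf
    refine h.isResolvent.eq_zero (ext_inner_left ℂ fun g => ?_)
    rw [inner_zero_right, ← ContinuousLinearMap.adjoint_inner_left,
      ← ContinuousLinearMap.star_eq_adjoint, h.isSelfAdjoint.star_eq]
    exact (Submodule.mem_orthogonal _ _).1 hf _ ⟨g, rfl⟩
  have h2 := Submodule.dense_iff_topologicalClosure_eq_top.2 h1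
  exact h2

/-- The spectral measure of a self-adjoint operator at a vector. -/
theorem exists_isSpectralMeasureAt (h : HasRealResolvent A z₀ T) (f : E) :
    ∃ μ : Measure ℝ, IsSpectralMeasureAt A f μ ∧ μ.real Set.univ = ‖f‖ ^ 2 ∧
      ∀ᵐ x : ℝ ∂μ, (x : ℂ) ∈ specOf A := by
  have hn : IsStarNormal T := h.isSelfAdjoint.isStarNormal
  obtain ⟨μ, hμ, hsp, hg⟩ := exists_measure_cfc T hn f
  have h0 : ∀ᵐ ζ ∂μ, ζ ≠ 0 := by
    have := h.measure_singleton_zero h.denseRange hg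
    rw [ae_iff]
    simpa using this
  -- The measure for `A` is the image of that for `T` under `ζ ↦ z₀ + ζ⁻¹`. The value at `ζ = 0` is
  -- meaningless, which is why the absence of an atom there is needed.
  let p : ℂ → ℝ := fun ζ => z₀ + (ζ⁻¹).re
  have hp : Measurable p := by fun_prop
  have hpz : ∀ ζ ∈ spectrum ℂ T, ((p ζ : ℝ) : ℂ) = z₀ + ζ⁻¹ := fun ζ hζ => by
    rw [h.isSelfAdjoint.mem_spectrum_eq_re hζ]
    simp only [p]
    rw [← Complex.ofReal_inv, Complex.ofReal_re, Complex.ofReal_add]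
  refine ⟨μ.map p, ⟨inferInstance, fun z hz => ?_⟩, ?_, ?_⟩
  · have hcont : ContinuousOn (fun ζ : ℂ => ζ / (1 + (z₀ - z) * ζ)) (spectrum ℂ T) :=
      continuousOn_id.div (by fun_prop) fun ζ hζ => h.one_add_mul_ne_zero hz hζ
    rw [h.resolventOf_eq_cfc hz, hg _ hcont, integral_map hp.aemeasurable
      (continuous_inv_sub hz).aestronglyMeasurable]
    refine integral_congr_ae ?_
    filter_upwards [hsp, h0] with ζ h1 h2
    have h3 := h.one_add_mul_ne_zero hz h1
    rw [hpz ζ h1, show (z₀ : ℂ) + ζ⁻¹ - z = (1 + (z₀ - z) * ζ) / ζ by field_simp; ring, inv_div]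
  · rw [measureReal_def, Measure.map_apply hp MeasurableSet.univ, Set.preimage_univ,
      ← measureReal_def]
    have h1 := hg (fun _ => 1) continuousOn_const
    rw [cfc_const_one ℂ T, one_apply_eq_self, inner_self_eq_norm_sq_to_K, integral_const] at h1
    simp only [mul_one, Complex.real_smul] at h1
    exact Complex.ofReal_injective (by rw [← h1]; simp)
  · refine (ae_map_iff hp.aemeasurable ?_).2 ?_
    · exact (h.isClosed_specOf.preimage Complex.continuous_ofReal).measurableSet
    · filter_upwards [hsp, h0] with ζ h1 h2
      rw [hpz ζ h1]
      exact h.isResolvent.mem_spectrum h2 h1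

end HasRealResolvent

end SpectralMeasure

/-! ### Bounded Borel functions of the operator -/

section BorelCalculus

variable {E : Type*} [NormedAddCommGroup E] [InnerProductSpace ℂ E]

/-- A bound of a sesquilinear form by the bound of its quadratic form. -/
theorem norm_sesquilinear_le (b : E →ₗ⋆[ℂ] E →ₗ[ℂ] ℂ) {K : ℝ} (hb : ∀ f, ‖b f f‖ ≤ K * ‖f‖ ^ 2)
    (f g : E) : ‖b f g‖ ≤ 2 * K * ‖f‖ * ‖g‖ := by
  have key : ∀ f g, ‖b f g‖ ≤ K * (‖f‖ ^ 2 + ‖g‖ ^ 2) := fun f g => by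
    -- Polarisation, followed by the parallelogram law and by scaling to unit vectors.
    have h1 : 4 * b f g = b (f + g) (f + g) - b (f - g) (f - g)
        - Complex.I * b (f + Complex.I • g) (f + Complex.I • g)
        + Complex.I * b (f - Complex.I • g) (f - Complex.I • g) := by
      simp only [map_add, map_sub, LinearMap.add_apply, LinearMap.sub_apply, LinearMap.map_smulₛₗ,
        LinearMap.smul_apply, smul_eq_mul, map_smul, Complex.conj_I]
      linear_combination (2 * b f g - 2 * b g f) * Complex.I_sq
    have h2 : 4 * ‖b f g‖ ≤ K * ‖f + g‖ ^ 2 + K * ‖f - g‖ ^ 2 + K * ‖f + Complex.I • g‖ ^ 2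
        + K * ‖f - Complex.I • g‖ ^ 2 := by
      have h3 : 4 * ‖b f g‖ = ‖4 * b f g‖ := by rw [norm_mul]; norm_num
      rw [h3, h1]
      refine (norm_add_le _ _).trans (add_le_add ((norm_sub_le _ _).trans
        (add_le_add ((norm_sub_le _ _).trans (add_le_add (hb _) (hb _))) ?_)) ?_)
      · rw [norm_mul, Complex.norm_I, one_mul]; exact hb _
      · rw [norm_mul, Complex.norm_I, one_mul]; exact hb _
    have h3 := parallelogram_law_with_norm ℂ f g
    have h4 := parallelogram_law_with_norm ℂ f (Complex.I • g)
    rw [norm_smul, Complex.norm_I, one_mul] at h4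
    linear_combination h2 / 4 + K / 4 * h3 + K / 4 * h4
  rcases eq_or_ne f 0 with rfl | hf
  · simp
  rcases eq_or_ne g 0 with rfl | hg
  · simp
  have hf0 : ‖f‖ ≠ 0 := norm_ne_zero_iff.2 hf
  have hg0 : ‖g‖ ≠ 0 := norm_ne_zero_iff.2 hg
  have h1 := key (((‖f‖⁻¹ : ℝ) : ℂ) • f) (((‖g‖⁻¹ : ℝ) : ℂ) • g)
  have h2 : ∀ v : E, ‖v‖ ≠ 0 → ‖((‖v‖⁻¹ : ℝ) : ℂ) • v‖ = 1 := fun v hv => by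
    rw [norm_smul, Complex.norm_real, norm_inv, norm_norm, inv_mul_cancel₀ hv]
  rw [h2 f hf0, h2 g hg0, map_smul, LinearMap.map_smulₛₗ, LinearMap.smul_apply, norm_smul, norm_smul,
    Complex.conj_ofReal, Complex.norm_real, Complex.norm_real, norm_inv, norm_inv, norm_norm,
    norm_norm] at h1
  calc ‖b f g‖ = (‖g‖⁻¹ * (‖f‖⁻¹ * ‖b f g‖)) * (‖f‖ * ‖g‖) := by field_simp
    _ ≤ (K * (1 ^ 2 + 1 ^ 2)) * (‖f‖ * ‖g‖) := by gcongr
    _ = _ := by ring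

theorem ContinuousLinearMap.opNorm_le_of_inner_self (D : E →L[ℂ] E) {K : ℝ} (hK : 0 ≤ K)
    (hD : ∀ f, ‖⟪f, D f⟫_ℂ‖ ≤ K * ‖f‖ ^ 2) : ‖D‖ ≤ 2 * K := by
  refine D.opNorm_le_of_unit_inner (by positivity) fun f g hf hg => ?_
  have h1 := norm_sesquilinear_le ((innerₛₗ ℂ).compl₂ (D : E →ₗ[ℂ] E)) (K := K) hD g f
  rw [hf, hg, mul_one, mul_one] at h1
  exact h1

/-- The formal linear combination of vectors that realizes the polarization identity. -/
noncomputable def polarization (f g : E) : E →₀ ℂ :=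
  (1 / 4 : ℂ) • (Finsupp.single (f + g) 1 - Finsupp.single (f - g) 1
    - Complex.I • Finsupp.single (f + Complex.I • g) 1
    + Complex.I • Finsupp.single (f - Complex.I • g) 1)

theorem linearCombination_polarization (R : E →L[ℂ] E) (f g : E) :
    Finsupp.linearCombination ℂ (fun v => ⟪v, R v⟫_ℂ) (polarization f g) = ⟪f, R g⟫_ℂ := by
  simp only [polarization, map_smul, map_add, map_sub, Finsupp.linearCombination_single,
    inner_add_left, inner_add_right, inner_sub_left, inner_sub_right, inner_smul_left,
    inner_smul_right, Complex.conj_I, smul_eq_mul]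
  linear_combination (1 / 2 * ⟪g, R f⟫_ℂ - 1 / 2 * ⟪f, R g⟫_ℂ) * Complex.I_sq

variable [CompleteSpace E] {A : E →ₗ.[ℂ] E} {z₀ : ℝ} {T : E →L[ℂ] E}

namespace HasRealResolvent

/-- The spectral measure at a vector. -/
noncomputable def spectralMeasure (h : HasRealResolvent A z₀ T) (f : E) : Measure ℝ :=
  (h.exists_isSpectralMeasureAt f).choose

theorem isSpectralMeasureAt (h : HasRealResolvent A z₀ T) (f : E) : IsSpectralMeasureAt A f (h.spectralMeasure f) :=
  (h.exists_isSpectralMeasureAt f).choose_spec.1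

instance (h : HasRealResolvent A z₀ T) (f : E) : IsFiniteMeasure (h.spectralMeasure f) := (h.isSpectralMeasureAt f).1

theorem spectralMeasure_univ (h : HasRealResolvent A z₀ T) (f : E) : (h.spectralMeasure f).real Set.univ = ‖f‖ ^ 2 :=
  (h.exists_isSpectralMeasureAt f).choose_spec.2.1

theorem ae_mem_specOf (h : HasRealResolvent A z₀ T) (f : E) : ∀ᵐ x : ℝ ∂(h.spectralMeasure f), (x : ℂ) ∈ specOf A :=
  (h.exists_isSpectralMeasureAt f).choose_spec.2.2

theorem norm_integral_le (h : HasRealResolvent A z₀ T) (f : E) {φ : ℝ → ℂ} {b : ℝ}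
    (hb : ∀ x : ℝ, (x : ℂ) ∈ specOf A → ‖φ x‖ ≤ b) :
    ‖∫ x, φ x ∂(h.spectralMeasure f)‖ ≤ b * ‖f‖ ^ 2 := by
  rw [← h.spectralMeasure_univ f]
  exact norm_integral_le_of_norm_le_const ((h.ae_mem_specOf f).mono hb)

/-- A linear relation between the quadratic forms of all bounded operators holds between the
integrals of a bounded function with respect to the spectral measures. -/
theorem linearCombination_eq_zero (h : HasRealResolvent A z₀ T) {p : E →₀ ℂ}
    (hp : ∀ R : E →L[ℂ] E, Finsupp.linearCombination ℂ (fun v => ⟪v, R v⟫_ℂ) p = 0)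
    {φ : ℝ → ℂ} (hφ : Measurable φ) {b : ℝ} (hb : ∀ x, ‖φ x‖ ≤ b) :
    Finsupp.linearCombination ℂ (fun v => ∫ x, φ x ∂(h.spectralMeasure v)) p = 0 := by
  rw [Finsupp.linearCombination_apply]
  refine sum_integral_eq_zero p.support p h.spectralMeasure (fun z hz => ?_) hφ hb
  have h1 := hp (resolventOf A z)
  rw [Finsupp.linearCombination_apply] at h1
  refine Eq.trans (Finset.sum_congr rfl fun v _ => ?_) h1
  exact congrArg (p v * ·) ((h.isSpectralMeasureAt v).2 z hz).symm

/-- The operator comes from the polarised form of `f ↦ ∫ φ dμ_f`. Sesquilinearity is a family of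
linear relations between such integrals; each holds for the resolvents, hence for the Stieltjes
transforms, hence for `φ`. -/
theorem exists_isBorelFunctionOf (h : HasRealResolvent A z₀ T) {φ : ℝ → ℂ} (hφ : Measurable φ) {b : ℝ} (hb : ∀ x, ‖φ x‖ ≤ b) :
    ∃ B : E →L[ℂ] E, ∀ f, ⟪f, B f⟫_ℂ = ∫ x, φ x ∂(h.spectralMeasure f) := by
  let Q : (E →₀ ℂ) →ₗ[ℂ] ℂ :=
    Finsupp.linearCombination ℂ (fun v => ∫ x, φ x ∂(h.spectralMeasure v))
  have hQ : ∀ p q : E →₀ ℂ, (∀ R : E →L[ℂ] E, Finsupp.linearCombination ℂ (fun v => ⟪v, R v⟫_ℂ) p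
      = Finsupp.linearCombination ℂ (fun v => ⟪v, R v⟫_ℂ) q) → Q p = Q q := fun p q hpq => by
    rw [← sub_eq_zero, ← map_sub]
    refine h.linearCombination_eq_zero (fun R => ?_) hφ hb
    rw [map_sub, hpq, sub_self]
  let β : E →ₗ⋆[ℂ] E →ₗ[ℂ] ℂ := LinearMap.mk₂'ₛₗ (starRingEnd ℂ) (RingHom.id ℂ)
    (fun f g => Q (polarization f g))
    (fun f f' g => by
      rw [← map_add]
      refine hQ _ _ fun R => ?_
      simp only [map_add, linearCombination_polarization, inner_add_left])
    (fun c f g => by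
      rw [← map_smul]
      refine hQ _ _ fun R => ?_
      simp only [map_smul, linearCombination_polarization, inner_smul_left, smul_eq_mul])
    (fun f g g' => by
      rw [← map_add]
      refine hQ _ _ fun R => ?_
      simp only [map_add, linearCombination_polarization, inner_add_right])
    (fun c f g => by
      rw [← map_smul]
      refine hQ _ _ fun R => ?_
      simp only [map_smul, linearCombination_polarization, inner_smul_right, smul_eq_mul,
        RingHom.id_apply])
  have hβ : ∀ f, β f f = ∫ x, φ x ∂(h.spectralMeasure f) := fun f => by
    have h1 : Q (polarization f f) = Q (Finsupp.single f 1) := hQ _ _ fun R => by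
      rw [linearCombination_polarization, Finsupp.linearCombination_single, one_smul]
    refine h1.trans ?_
    simp only [Q, Finsupp.linearCombination_single, one_smul]
  have hβb : ∀ f g, ‖β f g‖ ≤ (2 * b) * ‖f‖ * ‖g‖ := norm_sesquilinear_le β fun f => by
    rw [hβ]; exact h.norm_integral_le f fun x _ => hb x
  let βc : E →L⋆[ℂ] E →L[ℂ] ℂ := β.mkContinuous₂ (2 * b) hβb
  refine ⟨(InnerProductSpace.continuousLinearMapOfBilin βc).adjoint, fun f => ?_⟩
  rw [ContinuousLinearMap.adjoint_inner_right, InnerProductSpace.continuousLinearMapOfBilin_apply]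
  exact hβ f

theorem isBorelFunctionOf_borelFunctionOf (h : HasRealResolvent A z₀ T) {φ : ℝ → ℂ} (hφ : Measurable φ) {b : ℝ}
    (hb : ∀ x, ‖φ x‖ ≤ b) : IsBorelFunctionOf A φ (borelFunctionOf A φ) := by
  have hex : ∃ B : E →L[ℂ] E, IsBorelFunctionOf A φ B := by
    obtain ⟨B, hB⟩ := h.exists_isBorelFunctionOf hφ hb
    exact ⟨B, fun f => ⟨_, h.isSpectralMeasureAt f, hB f⟩⟩
  rw [borelFunctionOf, dif_pos hex]
  exact hex.choose_spec

/-- The definition of `φ(A)` supplies some spectral measure at `f`; uniqueness, as a relation with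
coefficients `1` and `-1`, identifies its integrals with those of the chosen one. -/
theorem inner_borelFunctionOf (h : HasRealResolvent A z₀ T) {φ : ℝ → ℂ} (hφ : Measurable φ) {b : ℝ} (hb : ∀ x, ‖φ x‖ ≤ b)
    (f : E) : ⟪f, borelFunctionOf A φ f⟫_ℂ = ∫ x, φ x ∂(h.spectralMeasure f) := by
  obtain ⟨μ, hμ, h1⟩ := h.isBorelFunctionOf_borelFunctionOf hφ hb f
  rw [h1]
  let ν : Bool → Measure ℝ := fun i => if i then μ else h.spectralMeasure f
  have hν : ∀ i, IsFiniteMeasure (ν i) := fun i => by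
    cases i
    · exact (h.isSpectralMeasureAt f).1
    · exact hμ.1
  have h2 := sum_integral_eq_zero Finset.univ (fun i : Bool => if i then (1 : ℂ) else -1) ν
    (fun z hz => by
      simp only [Fintype.sum_bool, ν, if_true, Bool.false_eq_true, if_false]
      rw [← hμ.2 z hz, ← (h.isSpectralMeasureAt f).2 z hz]
      ring) hφ hb
  simp only [Fintype.sum_bool, ν, if_true, Bool.false_eq_true, if_false] at h2
  linear_combination h2

/-- A function of the operator is close to a combination of resolvents, if the functions are close
on the spectrum. -/
theorem norm_borelFunctionOf_sub_le (h : HasRealResolvent A z₀ T) {φ : ℝ → ℂ} (hφ : Measurable φ) {b : ℝ} (hb : ∀ x, ‖φ x‖ ≤ b)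
    (a : ℂ) (c : {z : ℂ // z.im ≠ 0} →₀ ℂ) {η : ℝ} (hη : 0 ≤ η)
    (hc : ∀ x : ℝ, (x : ℂ) ∈ specOf A →
      ‖φ x - (a + c.sum fun z k => k * ((x : ℂ) - z)⁻¹)‖ ≤ η) :
    ‖borelFunctionOf A φ - (a • 1 + c.sum fun z k => k • resolventOf A z)‖ ≤ 2 * η := by
  refine ContinuousLinearMap.opNorm_le_of_inner_self _ hη fun f => ?_
  refine le_trans (le_of_eq ?_) (h.norm_integral_le f hc)
  congr 1
  have hi : ∀ z ∈ c.support, Integrable (fun x : ℝ => c z * ((x : ℂ) - z)⁻¹)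
      (h.spectralMeasure f) := fun z _ => (integrable_inv_sub z.2).const_mul _
  have h1 : (⟪f, (1 : E →L[ℂ] E) f⟫_ℂ) = ((h.spectralMeasure f).real Set.univ : ℂ) := by
    rw [h.spectralMeasure_univ, one_apply_eq_self, inner_self_eq_norm_sq_to_K]; simp
  have h2 : ∫ x : ℝ, (c.sum fun z k => k * ((x : ℂ) - z)⁻¹) ∂(h.spectralMeasure f) =
      ∑ z ∈ c.support, c z * ⟪f, resolventOf A z f⟫_ℂ := by
    simp only [Finsupp.sum]
    rw [integral_finsetSum _ hi]
    refine Finset.sum_congr rfl fun z _ => ?_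
    rw [integral_const_mul, (h.isSpectralMeasureAt f).2 z z.2]
  have hi' : Integrable (fun x : ℝ => c.sum fun z k => k * ((x : ℂ) - z)⁻¹)
      (h.spectralMeasure f) := integrable_finsetSum _ hi
  have hi'' : Integrable (fun x : ℝ => a + c.sum fun z k => k * ((x : ℂ) - z)⁻¹)
      (h.spectralMeasure f) := (integrable_const a).add hi'
  rw [integral_sub (integrable_of_norm_le hφ hb) hi'', integral_add (integrable_const a) hi', h2, ← h.inner_borelFunctionOf hφ hb, integral_const, sub_apply, add_apply, smul_apply,
    inner_sub_right, inner_add_right, inner_smul_right, h1, Finsupp.sum, sum_apply, inner_sum]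
  simp only [smul_apply, inner_smul_right, Complex.real_smul]
  rw [mul_comm a]

end HasRealResolvent

end BorelCalculus

/-! ### Location of the spectrum of the second operator -/

section SpectralLocalization

variable {E : Type u} [NormedAddCommGroup E] [InnerProductSpace ℂ E] [CompleteSpace E]
  {F : Type v} [NormedAddCommGroup F] [InnerProductSpace ℂ F] [CompleteSpace F]
  {δ C : ℝ} {J : E →L[ℂ] F} {h : ClosedForm E} {k : ClosedForm F}
  {J₁ : h.Dom →L[ℂ] k.Dom} {J₁' : k.Dom →L[ℂ] h.Dom}

/-- Points of the spectrum are approximate eigenvalues. -/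
theorem HasRealResolvent.exists_approx_eigenvector {A : E →ₗ.[ℂ] E} {z₀ : ℝ} {T : E →L[ℂ] E}
    (hA : HasRealResolvent A z₀ T) {μ : ℝ} (hμ : (μ : ℂ) ∈ specOf A) {ε : ℝ} (hε : 0 < ε) :
    ∃ f g, (f, g) ∈ A.graph ∧ ‖f‖ = 1 ∧ ‖g - (μ : ℂ) • f‖ < ε := by
  by_contra hc
  push Not at hc
  refine hμ (hA.mem_of_le_norm (μ := μ) (r := ε) (fun f g hfg => ?_) (by simpa using hε))
  rcases eq_or_ne f 0 with rfl | hf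
  · simp
  have hf0 : ‖f‖ ≠ 0 := norm_ne_zero_iff.2 hf
  have h1 := hc (((‖f‖⁻¹ : ℝ) : ℂ) • f) (((‖f‖⁻¹ : ℝ) : ℂ) • g)
    (A.graph.smul_mem (((‖f‖⁻¹ : ℝ) : ℂ)) hfg) (by
      rw [norm_smul, Complex.norm_real, norm_inv, norm_norm, inv_mul_cancel₀ hf0])
  rw [smul_comm, ← smul_sub, norm_smul, Complex.norm_real, norm_inv, norm_norm,
    le_inv_mul_iff₀ (by positivity)] at h1
  linarith

/-- Here `d` solves `(H + t) d = v`. Testing with `d` gives a term `-t ‖w‖²` that is dropped, and `t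
≤ C` lets the remaining terms be bounded with a single factor `√C`. -/
theorem ClosedForm.norm_le_of_form_add {E : Type*} [NormedAddCommGroup E] [InnerProductSpace ℂ E]
    (h : ClosedForm E) (hb : h.NormBound C) {t : ℝ} (ht0 : 0 < t)
    (htC : t ≤ C) {v w : E} {d : h.Dom} (htw : t * ‖w‖ ≤ 2 * ‖v‖) (hdw : h.incl d = w)
    (hd : ∀ φ, h.form d φ = ⟪v + ((-t : ℝ) : ℂ) • w, h.incl φ⟫_ℂ) : ‖d‖ ≤ 4 * √C * ‖v‖ / t := by
  have hC0 : 0 < C := by linarith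
  set y := ‖v‖ with hy
  have hy0 : 0 ≤ y := norm_nonneg _
  set q := v + ((-t : ℝ) : ℂ) • w with hq
  refine (sq_le_sq₀ (norm_nonneg _) (by positivity)).1 ?_
  have h1 := hb d
  rw [hd, hdw] at h1
  have h2 : (⟪q, w⟫_ℂ).re ≤ y * ‖w‖ := by
    rw [hq, inner_add_left, inner_smul_left, Complex.conj_ofReal, inner_self_eq_norm_sq_to_K]
    have h3 := re_inner_le_norm (𝕜 := ℂ) (v) w
    have h4 : (⟪v, w⟫_ℂ).re ≤ y * ‖w‖ := h3
    have h5 : 0 ≤ t * ‖w‖ ^ 2 := by positivity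
    have h6 : ((((-t : ℝ) : ℂ)) * ((‖w‖ : ℂ)) ^ 2).re = -(t * ‖w‖ ^ 2) := by
      rw [← Complex.ofReal_pow, ← Complex.ofReal_mul, Complex.ofReal_re]; ring
    calc _ = (⟪v, w⟫_ℂ).re + -(t * ‖w‖ ^ 2) := by
          rw [Complex.add_re]; exact congrArg _ h6
      _ ≤ _ := by linarith
  have h3 : t ^ 2 * ‖d‖ ^ 2 ≤ 16 * C * y ^ 2 := by
    have h4 : t ^ 2 * (y * ‖w‖) ≤ C * y * (2 * y) := by
      calc t ^ 2 * (y * ‖w‖) = t * y * (t * ‖w‖) := by ring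
        _ ≤ C * y * (2 * y) := by gcongr
    have h5 : t ^ 2 * (C * ‖w‖ ^ 2) ≤ C * (2 * y) ^ 2 := by
      calc t ^ 2 * (C * ‖w‖ ^ 2) = C * (t * ‖w‖) ^ 2 := by ring
        _ ≤ _ := by gcongr
    have h6 : t ^ 2 * ‖d‖ ^ 2 ≤ t ^ 2 * (2 * (y * ‖w‖ + C * ‖w‖ ^ 2)) := by
      refine mul_le_mul_of_nonneg_left (h1.trans ?_) (by positivity)
      linarith
    have h7 : 0 ≤ C * y ^ 2 := by positivity
    linarith
  rw [div_pow, le_div_iff₀ (by positivity), mul_pow, mul_pow, Real.sq_sqrt hC0.le]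
  linarith

namespace FormQUEData

/-- The point `-t` is not in the spectrum of the second operator, if it is far from that of the
first one. -/
theorem neg_notMem_specOf (H : FormQUEData δ C J h k J₁ J₁') (hκ : C * δ ≤ 1 / 100) {t : ℝ}
    (ht : 1 ≤ t) (hsp : ∀ z ∈ specOf h.operator, t / 2 ≤ dist z ((-t : ℝ) : ℂ)) :
    ((-t : ℝ) : ℂ) ∉ specOf k.operator := by
  intro hmem
  obtain ⟨a₀, S, hA⟩ := h.exists_hasRealResolvent
  obtain ⟨b₀, T, hB⟩ := k.exists_hasRealResolvent
  have hδ := H.pos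
  have hC := H.one_le
  have hC0 : 0 < C := by linarith
  have ht0 : 0 < t := by linarith
  set κ := C * δ with hκdef
  have hκ0 : 0 < κ := by positivity
  -- The precision of the approximate eigenvector may depend on `‖J†‖`, since `ε` does not enter the
  -- conclusion.
  set ε : ℝ := min (1 / 4) (κ / (‖J.adjoint‖ + 1)) with hε
  have hε0 : 0 < ε := by positivity
  have hε1 : ε ≤ 1 / 4 := min_le_left _ _
  have hε2 : ‖J.adjoint‖ * ε ≤ κ := by
    have h1 : ε ≤ κ / (‖J.adjoint‖ + 1) := min_le_right _ _
    rw [le_div_iff₀ (by positivity)] at h1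
    linarith
  obtain ⟨u, x, hux, hu, hr⟩ := hB.exists_approx_eigenvector hmem hε0
  obtain ⟨e, rfl, he⟩ := k.mem_operator_graph_iff.1 hux
  set r := x - ((-t : ℝ) : ℂ) • k.incl e with hrdef
  have hx : x = r - (t : ℂ) • k.incl e := by rw [hrdef]; push_cast; module
  have hform : (k.form e e).re ≤ -t + ε := by
    rw [he, hx, inner_sub_left, inner_smul_left, Complex.conj_ofReal, inner_self_eq_norm_sq_to_K, hu]
    have h1 := re_inner_le_norm (𝕜 := ℂ) r (k.incl e)
    rw [hu, mul_one] at h1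
    have h2 : (⟪r, k.incl e⟫_ℂ).re ≤ ε := h1.trans hr.le
    simp
    linarith
  have he1 := H.bound' e
  rw [hu] at he1
  have he0 : 1 ≤ ‖e‖ ^ 2 := by
    have := k.norm_incl_le e
    rw [hu] at this
    exact one_le_pow₀ this
  -- The norm bound alone gives `1 ≤ ‖e‖² ≤ 2 (-t + ε + C)`, so only `-t ≥ -C` has to be excluded.
  have htC : t ≤ C := by linarith
  have heC : ‖e‖ ^ 2 ≤ 2 * C := by linarith
  set s := √C with hs
  have hs2 : s ^ 2 = C := Real.sq_sqrt hC0.le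
  have hs1 : 1 ≤ s := Real.one_le_sqrt.2 hC
  have heS : ‖e‖ ≤ 2 * s := by
    refine (sq_le_sq₀ (norm_nonneg _) (by positivity)).1 ?_
    rw [mul_pow, hs2]; linarith
  have hsC : s ≤ C := by rw [← hs2]; exact le_self_pow₀ hs1 two_ne_zero
  set y := ‖J.adjoint (k.incl e)‖ with hy
  have hy0 : 0 ≤ y := norm_nonneg _
  have hylow : 1 - 2 * κ ≤ y ^ 2 := by
    have h1 := (abs_le.1 (abs_norm_sq_sub_le J.adjoint (k.incl e))).1
    rw [ContinuousLinearMap.adjoint_adjoint, hu] at h1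
    have h2 := H.right_inv e
    have h3 : δ * ‖e‖ ≤ 2 * κ := by
      calc δ * ‖e‖ ≤ δ * (2 * C) := by gcongr; linarith
        _ = _ := by rw [hκdef]; ring
    linarith
  have hmemA : ((-t : ℝ) : ℂ) ∈ resolventSetOf h.operator := by
    by_contra hc
    have := hsp _ hc
    rw [dist_self] at this
    linarith
  have hR := isResolvent_resolventOf hmemA
  have hgr := hR.1 (J.adjoint (k.incl e))
  set w := resolventOf h.operator ((-t : ℝ) : ℂ) (J.adjoint (k.incl e)) with hw
  have hwn : ‖w‖ ≤ 2 * y / t := by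
    have h1 := hA.le_norm_of_disjoint (by positivity) hsp hgr
    rw [add_sub_cancel_right] at h1
    rw [le_div_iff₀ ht0]
    linarith
  obtain ⟨d, hdw, hd⟩ := h.mem_operator_graph_iff.1 hgr
  have htw : t * ‖w‖ ≤ 2 * y := by
    rw [le_div_iff₀ ht0] at hwn; linarith
  -- The approximate eigenvector `e` is tested against `(H + t)⁻¹ J† e`. The weak commutator is then
  -- `-y²` up to the residual, with `y = ‖J† e‖`, while the errors are at most `(22 + 2) κ y`. So
  -- `y` is small, although `y² ≥ 1 - 2 κ`.
  have hmain := H.norm_inner_sub_inner_le hd he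
  set q := J.adjoint (k.incl e) + ((-t : ℝ) : ℂ) • w with hq
  have hqn : ‖q‖ ≤ 3 * y := by
    refine (norm_add_le _ _).trans ?_
    rw [norm_smul, Complex.norm_real, norm_neg, Real.norm_of_nonneg ht0.le]
    linarith
  have hdn : ‖d‖ ≤ 4 * s * y / t := h.norm_le_of_form_add H.bound ht0 htC htw hdw hd
  have hxn : ‖x‖ ≤ 2 * t := by
    rw [hx]
    refine (norm_sub_le _ _).trans ?_
    rw [norm_smul, hu, Complex.norm_real, Real.norm_of_nonneg ht0.le]
    linarith
  have hupper : δ * (‖x‖ * ‖d‖ + ‖e‖ * ‖d‖ + ‖e‖ * ‖q‖) ≤ 22 * κ * y := by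
    have h1 : ‖x‖ * ‖d‖ ≤ 8 * C * y := by
      calc ‖x‖ * ‖d‖ ≤ 2 * t * (4 * s * y / t) := by gcongr
        _ = 8 * s * y := by field_simp; ring
        _ ≤ _ := by gcongr
    have h2 : ‖e‖ * ‖d‖ ≤ 8 * C * y := by
      calc ‖e‖ * ‖d‖ ≤ 2 * s * (4 * s * y / 1) := by
            refine mul_le_mul heS (hdn.trans ?_) (norm_nonneg _) (by positivity)
            gcongr
        _ = 8 * s ^ 2 * y := by ring
        _ = _ := by rw [hs2]
    have h3 : ‖e‖ * ‖q‖ ≤ 6 * C * y := by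
      calc ‖e‖ * ‖q‖ ≤ 2 * C * (3 * y) := by
            refine mul_le_mul (heS.trans (by linarith)) hqn (norm_nonneg _) (by positivity)
        _ = _ := by ring
    calc δ * (‖x‖ * ‖d‖ + ‖e‖ * ‖d‖ + ‖e‖ * ‖q‖) ≤ δ * (8 * C * y + 8 * C * y + 6 * C * y) := by
          gcongr
      _ = _ := by rw [hκdef]; ring
  have hid : ⟪x, J (h.incl d)⟫_ℂ - ⟪J.adjoint (k.incl e), q⟫_ℂ =
      ⟪J.adjoint r, w⟫_ℂ - ((y ^ 2 : ℝ) : ℂ) := by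
    have h1 : ⟪J.adjoint (k.incl e), J.adjoint (k.incl e)⟫_ℂ = ((y ^ 2 : ℝ) : ℂ) := by
      rw [inner_self_eq_norm_sq_to_K]; simp [hy]
    rw [hdw, hx, hq, inner_sub_left, inner_add_right, inner_smul_left, inner_smul_right, h1,
      ContinuousLinearMap.adjoint_inner_left, ContinuousLinearMap.adjoint_inner_left,
      Complex.conj_ofReal]
    push_cast
    ring
  rw [hid] at hmain
  have hrw : ‖⟪J.adjoint r, w⟫_ℂ‖ ≤ 2 * κ * y := by
    refine (norm_inner_le_norm _ _).trans ?_
    have h1 : ‖J.adjoint r‖ ≤ κ := by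
      refine (J.adjoint.le_opNorm r).trans (le_trans ?_ hε2)
      gcongr
    have h2 : ‖w‖ ≤ 2 * y := by
      refine le_trans ?_ htw
      exact le_mul_of_one_le_left (norm_nonneg _) ht
    calc ‖J.adjoint r‖ * ‖w‖ ≤ κ * (2 * y) := by gcongr
      _ = _ := by ring
  have hfin : y ^ 2 ≤ 24 * κ * y := by
    have h1 := norm_sub_norm_le ((y ^ 2 : ℝ) : ℂ) ⟪J.adjoint r, w⟫_ℂ
    rw [norm_sub_rev, Complex.norm_real, Real.norm_of_nonneg (by positivity)] at h1
    linarith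
  have hy1 : y ≤ 1 / 2 := by
    by_contra hc
    push Not at hc
    have h1 : 24 * κ * y ≤ 1 / 4 * y := mul_le_mul_of_nonneg_right (by linarith) hy0
    have h2 : 1 / 2 * y ≤ y * y := mul_le_mul_of_nonneg_right hc.le hy0
    linarith
  have h1 : y ^ 2 ≤ (1 / 2) ^ 2 := by gcongr
  linarith

/-- In a bounded region, the spectrum of the second operator is near that of the first one. -/
theorem exists_mem_specOf_dist_lt (H : FormQUEData δ C J h k J₁ J₁') {μ Λ ρ : ℝ} (hρ : 0 < ρ)
    (hρ1 : ρ ≤ 1) (hΛ : |μ| ≤ Λ) (hκ : C * δ * (24 * (Λ + 4) ^ 2) < ρ)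
    (hμ : (μ : ℂ) ∈ specOf k.operator) : ∃ z ∈ specOf h.operator, dist z μ < ρ := by
  by_contra hc
  push Not at hc
  obtain ⟨a₀, S, hA⟩ := h.exists_hasRealResolvent
  obtain ⟨b₀, T, hB⟩ := k.exists_hasRealResolvent
  have hδ := H.pos
  have hC := H.one_le
  have hΛ0 : 0 ≤ Λ := (abs_nonneg _).trans hΛ
  -- A gap `ρ` of the first operator persists as `ρ / 2` for the second; the factor 24 is twice the
  -- 12 of the operator estimate.
  refine hμ (H.operatorQUE.mem_resolventSetOf hA hB (r := ρ) (r' := ρ / 2) hΛ (by positivity)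
    (by linarith) ?_ (fun f g hfg _ => hA.le_norm_of_disjoint hρ hc hfg)
    (by rw [dist_self]; positivity))
  have h1 : (ρ / 2 + Λ + 1) * (2 * ρ + ρ / 2 + Λ + 1) ≤ (Λ + 4) * (Λ + 4) :=
    mul_le_mul (by linarith) (by linarith) (by positivity) (by positivity)
  calc 12 * C * δ * ((ρ / 2 + Λ + 1) * (2 * ρ + ρ / 2 + Λ + 1))
      ≤ 12 * C * δ * ((Λ + 4) * (Λ + 4)) := by gcongr
    _ = C * δ * (24 * (Λ + 4) ^ 2) / 2 := by ring
    _ < ρ - ρ / 2 := by linarith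

end FormQUEData

end SpectralLocalization

/-! ### Functions of quasi-unitarily equivalent operators -/

section FunctionalCalculus

/-- A function that is continuous near the closed set `S`, and has a limit at infinity, is near `S`
uniformly close to a constant plus a linear combination of the functions `x ↦ (x - z)⁻¹`. -/
theorem exists_finsupp_approx_near {φ : ℝ → ℂ} {a : ℂ} {S U : Set ℝ} (hlim : Tendsto φ atTop (𝓝 a))
    (hS : IsClosed S) (hSb : BddBelow S) (hU : IsOpen U) (hSU : S ⊆ U) (hφ : ContinuousOn φ U)
    {η : ℝ} (hη : 0 < η) : ∃ (c : {z : ℂ // z.im ≠ 0} →₀ ℂ) (N ρ : ℝ), 0 < ρ ∧ ρ ≤ 1 ∧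
      ∀ x : ℝ, (x ≤ N → ∃ s ∈ S, dist s x < ρ) →
        ‖φ x - (a + c.sum fun z k => k * ((x : ℂ) - z)⁻¹)‖ ≤ 2 * η := by
  obtain ⟨m, hm⟩ := hSb
  obtain ⟨N, hN⟩ := eventually_atTop.1 (hlim.eventually (Metric.closedBall_mem_nhds a hη))
  -- Beyond `N` the limit makes `φ - a` small, so only a compact part of `S` matters; the margin 1
  -- covers the points of `S` within `ρ ≤ 1` of some `x ≤ N`.
  set K : Set ℝ := S ∩ Set.Icc m (N + 1) with hK
  have hKc : IsCompact K := isCompact_Icc.inter_left hS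
  obtain ⟨ρ, hρ, hρU⟩ := hKc.exists_cthickening_subset_open hU (Set.inter_subset_left.trans hSU)
  obtain ⟨χ, hχ1, hχc, hχU, hχ01⟩ := exists_continuousMap_one_of_isCompact_subset_isOpen
    (hKc.cthickening (r := ρ)) hU hρU
  -- The cut-off removes the discontinuities of `φ` outside `U`; `ψ` is continuous with compact
  -- support and agrees with `φ - a` near `K`.
  set ψ : ℝ → ℂ := fun x => (χ x : ℂ) * (φ x - a) with hψ
  have hsupp : Function.support ψ ⊆ Function.support χ := fun x hx hx0 => by
    refine hx ?_
    simp only [hψ, hx0, Complex.ofReal_zero, zero_mul]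
  have hts : tsupport ψ ⊆ tsupport χ := closure_mono hsupp
  have hψc : Continuous ψ := by
    refine ContinuousOn.continuous_of_tsupport_subset ?_ hU (hts.trans hχU)
    exact (Complex.continuous_ofReal.comp χ.continuous).continuousOn.mul
      (hφ.sub continuousOn_const)
  have hψs : HasCompactSupport ψ := hχc.of_isClosed_subset isClosed_closure hts
  obtain ⟨c, hc⟩ := exists_finsupp_approx hψc hψs.is_zero_at_infty hη
  refine ⟨c, N, min ρ 1, by positivity, min_le_right _ _, fun x hx => ?_⟩
  have h1 : ‖φ x - a - ψ x‖ ≤ η := by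
    by_cases hxN : x ≤ N
    · obtain ⟨s, hs, hsx⟩ := hx hxN
      have hsK : s ∈ K := by
        refine ⟨hs, hm hs, ?_⟩
        have := (abs_lt.1 (Real.dist_eq s x ▸ hsx.trans_le (min_le_right _ _))).2
        linarith
      have hxK : x ∈ Metric.cthickening ρ K := Metric.mem_cthickening_of_dist_le x s ρ K hsK (by
        rw [dist_comm]; exact (hsx.trans_le (min_le_left _ _)).le)
      have h2 : χ x = 1 := hχ1 hxK
      simp only [hψ, h2, Complex.ofReal_one, one_mul, sub_self, norm_zero]
      exact hη.le
    · have h2 : ‖φ x - a‖ ≤ η := by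
        rw [← dist_eq_norm]; exact hN x (not_le.1 hxN).le
      have h3 : φ x - a - ψ x = ((1 - χ x : ℝ) : ℂ) * (φ x - a) := by
        simp only [hψ]; push_cast; ring
      have h4 := hχ01 x
      rw [h3, norm_mul, Complex.norm_real, Real.norm_of_nonneg (by linarith [h4.2])]
      calc (1 - χ x) * ‖φ x - a‖ ≤ 1 * η := by
            gcongr
            linarith [h4.1]
        _ = η := one_mul η
  have h2 := hc x
  calc _ = ‖(φ x - a - ψ x) + (ψ x - c.sum fun z k => k * ((x : ℂ) - z)⁻¹)‖ := by
        congr 1; ring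
    _ ≤ η + η := (norm_add_le _ _).trans (add_le_add h1 h2)
    _ = _ := by ring

/-- The constant of the resolvent estimates. -/
noncomputable def resolventEstimateConst (z : ℂ) : ℝ :=
  1 + (2 * (1 + ‖z‖ / |z.im|) * resolventConst z + resolventConst z ^ 2)
    + 15 * dominatingConst z ^ 3

theorem resolventEstimateConst_pos (z : ℂ) : 0 < resolventEstimateConst z := by
  have h1 := resolventConst_nonneg z
  have h2 : 0 ≤ dominatingConst z := zero_le_one.trans (dominatingConst_spec z).1
  unfold resolventEstimateConst
  positivity

variable {E : Type u} [NormedAddCommGroup E] [InnerProductSpace ℂ E] [CompleteSpace E]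
  {F : Type v} [NormedAddCommGroup F] [InnerProductSpace ℂ F] [CompleteSpace F]
  {δ C : ℝ} {J : E →L[ℂ] F} {h : ClosedForm E} {k : ClosedForm F}
  {J₁ : h.Dom →L[ℂ] k.Dom} {J₁' : k.Dom →L[ℂ] h.Dom}

namespace FormQUEData

theorem norm_comm_le' (H : FormQUEData δ C J h k J₁ J₁') {z : ℂ} (hz : z.im ≠ 0) :
    ‖J ∘L resolventOf h.operator z - resolventOf k.operator z ∘L J‖ ≤
      resolventEstimateConst z * C * δ := by
  have h1 := H.pos
  have h2 := H.one_le
  have h3 : 0 ≤ dominatingConst z := zero_le_one.trans (dominatingConst_spec z).1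
  refine (H.norm_comm_le hz).trans ?_
  gcongr
  unfold resolventEstimateConst
  have : 0 ≤ 15 * dominatingConst z ^ 3 := by positivity
  linarith

theorem norm_sandwich_le' (H : FormQUEData δ C J h k J₁ J₁') {z : ℂ} (hz : z.im ≠ 0) :
    ‖J ∘L resolventOf h.operator z ∘L J.adjoint - resolventOf k.operator z‖ ≤
      resolventEstimateConst z * C * δ := by
  have h1 := H.pos
  have h2 := H.one_le
  have h3 := resolventConst_nonneg z
  refine (H.norm_sandwich_le hz).trans ?_
  gcongr
  unfold resolventEstimateConst
  have : 0 ≤ 2 * (1 + ‖z‖ / |z.im|) * resolventConst z + resolventConst z ^ 2 := by positivity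
  linarith

theorem norm_comm_sum_le (H : FormQUEData δ C J h k J₁ J₁') (a : ℂ)
    (c : {z : ℂ // z.im ≠ 0} →₀ ℂ) :
    ‖J ∘L (a • 1 + c.sum fun z w => w • resolventOf h.operator z)
      - (a • 1 + c.sum fun z w => w • resolventOf k.operator z) ∘L J‖ ≤
      (c.sum fun z w => ‖w‖ * resolventEstimateConst z) * (C * δ) := by
  have h1 : J ∘L (a • 1 + c.sum fun z w => w • resolventOf h.operator z)
      - (a • 1 + c.sum fun z w => w • resolventOf k.operator z) ∘L J =
      ∑ z ∈ c.support, c z • (J ∘L resolventOf h.operator z - resolventOf k.operator z ∘L J) := by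
    ext f
    simp only [Finsupp.sum, sub_apply, ContinuousLinearMap.comp_apply, add_apply, smul_apply,
      one_apply_eq_self, sum_apply, map_add, map_sum, map_smul, smul_sub, Finset.sum_sub_distrib]
    abel
  rw [h1, Finsupp.sum, Finset.sum_mul]
  refine norm_sum_le_of_le _ fun z _ => ?_
  rw [norm_smul, mul_assoc, ← mul_assoc (resolventEstimateConst z)]
  gcongr
  exact H.norm_comm_le' z.2

theorem norm_sandwich_sum_le (H : FormQUEData δ C J h k J₁ J₁') (c : {z : ℂ // z.im ≠ 0} →₀ ℂ) :
    ‖J ∘L (c.sum fun z w => w • resolventOf h.operator z) ∘L J.adjoint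
      - c.sum fun z w => w • resolventOf k.operator z‖ ≤
      (c.sum fun z w => ‖w‖ * resolventEstimateConst z) * (C * δ) := by
  have h1 : J ∘L (c.sum fun z w => w • resolventOf h.operator z) ∘L J.adjoint
      - (c.sum fun z w => w • resolventOf k.operator z) =
      ∑ z ∈ c.support, c z • (J ∘L resolventOf h.operator z ∘L J.adjoint
        - resolventOf k.operator z) := by
    ext f
    simp only [Finsupp.sum, sub_apply, ContinuousLinearMap.comp_apply, smul_apply,
      sum_apply, map_sum, map_smul, smul_sub, Finset.sum_sub_distrib]
  rw [h1, Finsupp.sum, Finset.sum_mul]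
  refine norm_sum_le_of_le _ fun z _ => ?_
  rw [norm_smul, mul_assoc, ← mul_assoc (resolventEstimateConst z)]
  gcongr
  exact H.norm_sandwich_le' z.2

end FormQUEData

/-- Functions of quasi-unitarily equivalent operators are close. -/
theorem exists_norm_borelFunctionOf_le (φ : ℝ → ℂ) (a : ℂ) (S U : Set ℝ) (M : ℝ) (hφm : Measurable φ)
    (hφb : ∃ b : ℝ, ∀ x, ‖φ x‖ ≤ b) (hlim : Tendsto φ atTop (𝓝 a)) (hS : IsClosed S)
    (hSb : BddBelow S) (hU : IsOpen U) (hSU : S ⊆ U) (hφ : ContinuousOn φ U) {η : ℝ} (hη : 0 < η) :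
    ∃ κ > 0, ∀ (E : Type u) [NormedAddCommGroup E] [InnerProductSpace ℂ E] [CompleteSpace E]
      (F : Type v) [NormedAddCommGroup F] [InnerProductSpace ℂ F] [CompleteSpace F]
      (h : ClosedForm E) (k : ClosedForm F) (J : E →L[ℂ] F) (δ C : ℝ) (J₁ : h.Dom →L[ℂ] k.Dom)
      (J₁' : k.Dom →L[ℂ] h.Dom), FormQUEData δ C J h k J₁ J₁' →
      (∀ x : ℝ, (x : ℂ) ∈ specOf h.operator → x ∈ S) → ‖J‖ ≤ M → C * δ ≤ κ →
      ‖J ∘L borelFunctionOf h.operator φ - borelFunctionOf k.operator φ ∘L J‖ ≤ η ∧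
      (a = 0 →
        ‖J ∘L borelFunctionOf h.operator φ ∘L J.adjoint - borelFunctionOf k.operator φ‖ ≤ η) := by
  obtain ⟨b, hb⟩ := hφb
  set η' : ℝ := η / (16 * (|M| + 1) ^ 2) with hη'
  have hη'0 : 0 < η' := by positivity
  obtain ⟨c, N, ρ, hρ, hρ1, hc⟩ := exists_finsupp_approx_near hlim hS hSb hU hSU hφ hη'0
  obtain ⟨m, hm⟩ := hSb
  -- For `t ≥ 2 |m|` the point `-t` has distance at least `t / 2` from `S`, as the exclusion of far
  -- negative spectrum requires.
  set t₀ : ℝ := max 1 (2 * |m|) with ht₀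
  set Λ : ℝ := max t₀ |N| with hΛ
  have hΛ0 : 0 ≤ Λ := (abs_nonneg N).trans (le_max_right _ _)
  set L : ℝ := c.sum fun z w => ‖w‖ * resolventEstimateConst z with hL
  have hL0 : 0 ≤ L := Finset.sum_nonneg fun z _ =>
    mul_nonneg (norm_nonneg _) (resolventEstimateConst_pos _).le
  -- The three bounds serve to exclude far negative spectrum, to place the remaining spectrum up to
  -- `N` within `ρ` of `S`, and to make the combination of resolvent errors at most `η / 4`.
  refine ⟨min (1 / 100) (min (ρ / (24 * (Λ + 4) ^ 2 + 1)) (η / (4 * (L + 1)))), by positivity, ?_⟩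
  intro E _ _ _ F _ _ _ h k J δ C J₁ J₁' H hsp hJ hκ
  have hκ1 : C * δ ≤ 1 / 100 := hκ.trans (min_le_left _ _)
  have hκ2 : C * δ ≤ ρ / (24 * (Λ + 4) ^ 2 + 1) :=
    hκ.trans ((min_le_right _ _).trans (min_le_left _ _))
  have hκ3 : C * δ ≤ η / (4 * (L + 1)) := hκ.trans ((min_le_right _ _).trans (min_le_right _ _))
  have hCδ : 0 < C * δ := mul_pos (zero_lt_one.trans_le H.one_le) H.pos
  rw [le_div_iff₀ (by positivity)] at hκ2 hκ3
  obtain ⟨a₀, R, hA⟩ := h.exists_hasRealResolvent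
  obtain ⟨b₀, T, hB⟩ := k.exists_hasRealResolvent
  have hreal : ∀ z ∈ specOf h.operator, ((z.re : ℝ) : ℂ) = z ∧ z.re ∈ S := fun z hz => by
    have h1 : ((z.re : ℝ) : ℂ) = z := Complex.ext (by simp) (by simp [hA.im_eq_zero hz])
    exact ⟨h1, hsp _ (h1.symm ▸ hz)⟩
  have hcA : ∀ x : ℝ, (x : ℂ) ∈ specOf h.operator →
      ‖φ x - (a + c.sum fun z k => k * ((x : ℂ) - z)⁻¹)‖ ≤ 2 * η' := fun x hx =>
    hc x fun _ => ⟨x, hsp x hx, by rwa [dist_self]⟩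
  have hcB : ∀ x : ℝ, (x : ℂ) ∈ specOf k.operator →
      ‖φ x - (a + c.sum fun z k => k * ((x : ℂ) - z)⁻¹)‖ ≤ 2 * η' := fun x hx => by
    refine hc x fun hxN => ?_
    have hlow : -t₀ ≤ x := by
      by_contra hlt
      push Not at hlt
      have h1 : t₀ ≤ -x := by linarith
      have h2 : 1 ≤ -x := (le_max_left _ _).trans h1
      have h3 : 2 * |m| ≤ -x := (le_max_right _ _).trans h1
      refine H.neg_notMem_specOf hκ1 h2 (fun z hz => ?_) (by rwa [neg_neg])
      obtain ⟨h4, h5⟩ := hreal z hz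
      rw [← h4, Complex.dist_of_im_eq (by simp), Complex.ofReal_re, Complex.ofReal_re, neg_neg,
        Real.dist_eq]
      have h6 := hm h5
      have h7 := neg_abs_le m
      exact le_trans (by linarith) (le_abs_self _)
    have hxΛ : |x| ≤ Λ := by
      rw [abs_le]
      refine ⟨?_, hxN.trans ((le_abs_self N).trans (le_max_right _ _))⟩
      have : t₀ ≤ Λ := le_max_left _ _
      linarith
    obtain ⟨z, hz, hzx⟩ := H.exists_mem_specOf_dist_lt hρ hρ1 hxΛ (by linarith) hx
    obtain ⟨h4, h5⟩ := hreal z hz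
    refine ⟨z.re, h5, ?_⟩
    rw [← h4, Complex.dist_of_im_eq (by simp), Complex.ofReal_re, Complex.ofReal_re] at hzx
    exact hzx
  have hDA := hA.norm_borelFunctionOf_sub_le hφm hb a c (by positivity) hcA
  have hDB := hB.norm_borelFunctionOf_sub_le hφm hb a c (by positivity) hcB
  have hLκ : L * (C * δ) ≤ η / 4 := by linarith
  have hM : ‖J‖ ≤ |M| := hJ.trans (le_abs_self M)
  have hη4 : 16 * η' * (|M| + 1) ^ 2 = η := by rw [hη']; field_simp
  have hM0 : 0 ≤ |M| := abs_nonneg M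
  refine ⟨?_, fun ha => ?_⟩
  · have h1 := H.norm_comm_sum_le a c
    set PA := a • (1 : E →L[ℂ] E) + c.sum fun z w => w • resolventOf h.operator z
    set PB := a • (1 : F →L[ℂ] F) + c.sum fun z w => w • resolventOf k.operator z
    have h2 : J ∘L borelFunctionOf h.operator φ - borelFunctionOf k.operator φ ∘L J =
        J ∘L (borelFunctionOf h.operator φ - PA) + (J ∘L PA - PB ∘L J)
          - (borelFunctionOf k.operator φ - PB) ∘L J := by
      rw [ContinuousLinearMap.comp_sub, ContinuousLinearMap.sub_comp]; abel
    rw [h2]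
    have h3 : ‖J ∘L (borelFunctionOf h.operator φ - PA)‖ ≤ |M| * (2 * (2 * η')) :=
      (ContinuousLinearMap.opNorm_comp_le _ _).trans (by gcongr)
    have h4 : ‖(borelFunctionOf k.operator φ - PB) ∘L J‖ ≤ (2 * (2 * η')) * |M| :=
      (ContinuousLinearMap.opNorm_comp_le _ _).trans (by gcongr)
    refine (norm_sub_le _ _).trans ((add_le_add ((norm_add_le _ _).trans
      (add_le_add h3 (h1.trans hLκ))) h4).trans ?_)
    nlinarith
  · subst ha
    have h1 := H.norm_sandwich_sum_le c
    rw [zero_smul, zero_add] at hDA hDB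
    set PA := c.sum fun z w => w • resolventOf h.operator z
    set PB := c.sum fun z w => w • resolventOf k.operator z
    have h2 : J ∘L borelFunctionOf h.operator φ ∘L J.adjoint - borelFunctionOf k.operator φ =
        J ∘L (borelFunctionOf h.operator φ - PA) ∘L J.adjoint + (J ∘L PA ∘L J.adjoint - PB)
          - (borelFunctionOf k.operator φ - PB) := by
      rw [ContinuousLinearMap.sub_comp, ContinuousLinearMap.comp_sub]; abel
    rw [h2]
    have hJ' : ‖J.adjoint‖ ≤ |M| := by rwa [LinearIsometryEquiv.norm_map]
    have h3 : ‖J ∘L (borelFunctionOf h.operator φ - PA) ∘L J.adjoint‖ ≤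
        |M| * ((2 * (2 * η')) * |M|) :=
      (ContinuousLinearMap.opNorm_comp_le _ _).trans (mul_le_mul hM
        ((ContinuousLinearMap.opNorm_comp_le _ _).trans (by gcongr)) (norm_nonneg _) hM0)
    refine (norm_sub_le _ _).trans ((add_le_add ((norm_add_le _ _).trans
      (add_le_add h3 (h1.trans hLκ))) hDB).trans ?_)
    nlinarith

end FunctionalCalculus

/-! ### The main theorem -/

theorem mainTheorem4 :
    -- (i) quasi-unitary equivalence of the associated operators
    (∀ (E : Type u) [NormedAddCommGroup E] [InnerProductSpace ℂ E] [CompleteSpace E]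
        (F : Type v) [NormedAddCommGroup F] [InnerProductSpace ℂ F] [CompleteSpace F]
        (h : ClosedForm E) (k : ClosedForm F) (J : E →L[ℂ] F) (δ C : ℝ),
        0 < δ → 1 ≤ C → FormQUE δ J h k → h.NormBound C → k.NormBound C →
        OperatorQUE (12 * C * δ) J h.operator k.operator) ∧
    -- (ii) resolvent estimates with a universal constant `c z`
    (∃ c : ℂ → ℝ, ∀ z : ℂ, z.im ≠ 0 → 0 < c z ∧
      ∀ (E : Type u) [NormedAddCommGroup E] [InnerProductSpace ℂ E] [CompleteSpace E]
        (F : Type v) [NormedAddCommGroup F] [InnerProductSpace ℂ F] [CompleteSpace F]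
        (h : ClosedForm E) (k : ClosedForm F) (J : E →L[ℂ] F) (δ C : ℝ),
        0 < δ → 1 ≤ C → FormQUE δ J h k → h.NormBound C → k.NormBound C →
        z ∈ resolventSetOf h.operator ∧ z ∈ resolventSetOf k.operator ∧
        ‖J ∘L resolventOf h.operator z - resolventOf k.operator z ∘L J‖ ≤ c z * C * δ ∧
        ‖J ∘L resolventOf h.operator z ∘L J.adjoint - resolventOf k.operator z‖ ≤ c z * C * δ) ∧
    -- (ii), continued: bounded measurable functions `φ` with limit `a` at infinity, continuous in a
    -- neighbourhood `U` of the spectrum; the bound depends on the spectrum only through `S`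
    (∀ (φ : ℝ → ℂ) (a : ℂ) (S U : Set ℝ) (M : ℝ), Measurable φ → (∃ b : ℝ, ∀ x, ‖φ x‖ ≤ b) →
      Tendsto φ atTop (𝓝 a) → IsClosed S → BddBelow S → IsOpen U → S ⊆ U → ContinuousOn φ U →
      ∀ η > 0, ∃ κ > 0,
      ∀ (E : Type u) [NormedAddCommGroup E] [InnerProductSpace ℂ E] [CompleteSpace E]
        (F : Type v) [NormedAddCommGroup F] [InnerProductSpace ℂ F] [CompleteSpace F]
        (h : ClosedForm E) (k : ClosedForm F) (J : E →L[ℂ] F) (δ C : ℝ),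
        0 < δ → 1 ≤ C → FormQUE δ J h k → h.NormBound C → k.NormBound C →
        (∀ x : ℝ, (x : ℂ) ∈ specOf h.operator → x ∈ S) → ‖J‖ ≤ M → C * δ ≤ κ →
        IsBorelFunctionOf h.operator φ (borelFunctionOf h.operator φ) ∧
        IsBorelFunctionOf k.operator φ (borelFunctionOf k.operator φ) ∧
        ‖J ∘L borelFunctionOf h.operator φ - borelFunctionOf k.operator φ ∘L J‖ ≤ η ∧
        (a = 0 →
          ‖J ∘L borelFunctionOf h.operator φ ∘L J.adjoint - borelFunctionOf k.operator φ‖ ≤ η)) ∧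
    -- (iii), (iv): a family of operators, quasi-unitarily equivalent with a fixed one
    (∀ (E : Type u) [NormedAddCommGroup E] [InnerProductSpace ℂ E] [CompleteSpace E]
        (ι : Type w) (l : Filter ι) [l.NeBot]
        (F : ι → Type v) [∀ i, NormedAddCommGroup (F i)] [∀ i, InnerProductSpace ℂ (F i)]
        [∀ i, CompleteSpace (F i)]
        (h : ClosedForm E) (k : ∀ i, ClosedForm (F i)) (J : ∀ i, E →L[ℂ] F i) (δ : ι → ℝ),
        Tendsto δ l (𝓝 0) →
        (∀ᶠ i in l, OperatorQUE (δ i) (J i) h.operator (k i).operator) →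
        -- (iii) convergence of the spectrum
        (∀ (lam : ι → ℂ) (lam₀ : ℂ), (∀ᶠ i in l, lam i ∈ specOf (k i).operator) →
          Tendsto lam l (𝓝 lam₀) → lam₀ ∈ specOf h.operator) ∧
        (∀ lam₀ ∈ specOf h.operator, ∃ lam : ι → ℂ,
          (∀ᶠ i in l, lam i ∈ specOf (k i).operator) ∧ Tendsto lam l (𝓝 lam₀)) ∧
        -- (iii) convergence of the essential spectrum
        (∀ (lam : ι → ℂ) (lam₀ : ℂ), (∀ᶠ i in l, lam i ∈ essSpecOf (k i).operator) →
          Tendsto lam l (𝓝 lam₀) → lam₀ ∈ essSpecOf h.operator) ∧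
        (∀ lam₀ ∈ essSpecOf h.operator, ∃ lam : ι → ℂ,
          (∀ᶠ i in l, lam i ∈ essSpecOf (k i).operator) ∧ Tendsto lam l (𝓝 lam₀)) ∧
        -- (iv) convergence of discrete eigenvalues
        (∀ lam₀ ∈ discSpecOf h.operator, ∃ lam : ι → ℂ,
          (∀ᶠ i in l, lam i ∈ discSpecOf (k i).operator) ∧ Tendsto lam l (𝓝 lam₀)) ∧
        -- (iv) preservation of the multiplicity
        (∀ lam₀ ∈ discSpecOf h.operator, ∃ r₀ > 0, ∀ r : ℝ, 0 < r → r < r₀ → ∀ᶠ i in l,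
          ∃ s : Finset ℂ, (s : Set ℂ) = specOf (k i).operator ∩ Metric.ball lam₀ r ∧
            (∀ x ∈ s, x ∈ discSpecOf (k i).operator) ∧
            ∑ x ∈ s, multOf (k i).operator x = multOf h.operator lam₀) ∧
        -- (iv) convergence of simple eigenfunctions
        (∀ lam₀ ∈ discSpecOf h.operator, multOf h.operator lam₀ = 1 →
          ∀ φ ∈ eigenspaceOf h.operator lam₀, ‖φ‖ = 1 →
          ∃ (lam : ι → ℂ) (ψ : ∀ i, F i),
            (∀ᶠ i in l, lam i ∈ discSpecOf (k i).operator ∧ multOf (k i).operator (lam i) = 1 ∧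
              ψ i ∈ eigenspaceOf (k i).operator (lam i) ∧ ‖ψ i‖ = 1) ∧
            Tendsto lam l (𝓝 lam₀) ∧
            Tendsto (fun i => ‖J i φ - ψ i‖) l (𝓝 0))) := by
  refine ⟨?_, ⟨resolventEstimateConst, ?_⟩, ?_, ?_⟩
  · intro E _ _ _ F _ _ _ h k J δ C hδ hC hQ hh hk
    obtain ⟨J₁, J₁', H⟩ := hQ.exists_data hδ hC hh hk
    exact H.operatorQUE
  · intro z hz
    refine ⟨resolventEstimateConst_pos z, ?_⟩
    intro E _ _ _ F _ _ _ h k J δ C hδ hC hQ hh hk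
    obtain ⟨J₁, J₁', H⟩ := hQ.exists_data hδ hC hh hk
    exact ⟨h.mem_resolventSetOf hz, k.mem_resolventSetOf hz, H.norm_comm_le' hz,
      H.norm_sandwich_le' hz⟩
  · intro φ a S U M hφm hφb hlim hS hSb hU hSU hφ η hη
    obtain ⟨κ, hκ, hmain⟩ :=
      exists_norm_borelFunctionOf_le φ a S U M hφm hφb hlim hS hSb hU hSU hφ hη
    refine ⟨κ, hκ, ?_⟩
    intro E _ _ _ F _ _ _ h k J δ C hδ hC hQ hh hk hsp hJ hκ'
    obtain ⟨J₁, J₁', H⟩ := hQ.exists_data hδ hC hh hk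
    obtain ⟨b, hb⟩ := hφb
    obtain ⟨a₀, R, hA⟩ := h.exists_hasRealResolvent
    obtain ⟨b₀, T, hB⟩ := k.exists_hasRealResolvent
    exact ⟨hA.isBorelFunctionOf_borelFunctionOf hφm hb, hB.isBorelFunctionOf_borelFunctionOf hφm hb,
      hmain E F h k J δ C J₁ J₁' H hsp hJ hκ'⟩
  · intro E _ _ _ ι l _ F _ _ _ h k J δ hδ hQ
    obtain ⟨a₀, S, hA⟩ := h.exists_hasRealResolvent
    choose b₀ T hB using fun i => (k i).exists_hasRealResolvent
    refine ⟨fun lam lam₀ hlam hlim => mem_specOf_of_tendsto hA hB hδ hQ hlam hlim,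
      fun lam₀ hlam => exists_tendsto_of_eventually_nonempty (fun i => (hB i).isClosed_specOf)
        fun ε hε => eventually_specOf_inter_ball hA hB hδ hQ hlam hε,
      fun lam lam₀ hlam hlim => mem_essSpecOf_of_tendsto hA hB hδ hQ hlam hlim,
      fun lam₀ hlam => exists_tendsto_of_eventually_nonempty (fun i => (hB i).isClosed_essSpecOf)
        fun ε hε => eventually_essSpecOf_inter_ball hA hB hδ hQ hlam hε,
      fun lam₀ hlam => exists_discSpecOf_tendsto hA hB hδ hQ hlam,
      fun lam₀ hlam => ?_,
      fun lam₀ hlam hmult φ hφ hφ1 => exists_eigenvector_tendsto hA hB hδ hQ hlam hmult hφ hφ1⟩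
    obtain ⟨r₀, hr₀, h1⟩ := exists_eventually_finset hA hB hδ hQ hlam
    refine ⟨r₀, hr₀, fun r hr hrr => ?_⟩
    filter_upwards [h1 r hr hrr] with i hi
    obtain ⟨s, hs1, hs2, hs3, -⟩ := hi
    exact ⟨s, hs1, hs2, hs3⟩
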